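/- Let $\Omega=\mathbb R^3$ or $\Omega=\mathbb T^3=(\mathbb R/L\mathbb Z)^3$ for a fixed $L>0$, let $-\tfrac12<\nu<1$, $\beta>7$ and $w(v)=(1+|v|)^\beta$. For $F=F(t,x,v)\ge 0$ ($t\ge0$, $x\in\Omega$, $v\in\mathbb R^3$) put $$\rho=\int_{\mathbb R^3} F\,dv,\quad u=\frac1\rho\int_{\mathbb R^3} vF\,dv,\quad T=\frac1{3\rho}\int_{\mathbb R^3}|v-u|^2F\,dv,\quad \Theta=\frac1\rho\int_{\mathbb R^3}(v-u)\otimes(v-u)F\,dv,$$ $$\mathcal T_\nu=(1-\nu)T\,\mathrm{Id}+\nu\Theta,\qquad A_\nu=\frac{\rho T}{1-\nu},\qquad M_\nu=\frac{\rho}{\sqrt{\det(2\pi\mathcal T_\nu)}}\exp\Big(-\tfrac12(v-u)^t\mathcal T_\nu^{-1}(v-u)\Big),$$ and let $\mu(v)=(2\pi)^{-3/2}e^{-|v|^2/2}$. A global mild solution of the ES-BGK equation $\partial_tF+v\cdot\nabla_xF=A_\nu(M_\nu-F)$ with initial datum $F_0$ is a measurable $F$ for which all the integrals in the following identity converge and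 for which, for every $t\ge0$ and almost every $(x,v)$, $$F(t,x,v)=F_0(x-vt,v)\,e^{-\int_0^tA_\nu(\tau,x-v(t-\tau))\,d\tau}+\int_0^te^{-\int_s^tA_\nu(\tau,x-v(t-\tau))\,d\tau}A_\nu(s,x-v(t-s))\,M_\nu(s,x-v(t-s),v)\,ds .$$ Write $\|\cdot\|_{L^\infty}$ for the norm of $L^\infty(\Omega\times\mathbb R^3)$ and $$\mathcal E(F_0)=\int_\Omega\int_{\mathbb R^3}(F_0\ln F_0-\mu\ln\mu)\,dv\,dx+\Big[\tfrac32\ln(2\pi)-1\Big]\int_\Omega\int_{\mathbb R^3}(F_0-\mu)\,dv\,dx+\tfrac12\int_\Omega\int_{\mathbb R^3}|v|^2(F_0-\mu)\,dv\,dx .$$ **Theorem.** For every $C_0>0$ and every $M\ge 0$ there are constants $\varepsilon_0>0$, $\tilde C_1\ge1$ and $\tilde C_2\ge1$, depending only on $\nu$, $C_0$, $M$ (and on the fixed $\beta$ and $L$), with the following property. Let $F_0\ge0$ be measurable on $\Omega\times\mathbb R^3$ with $\|wF_0\|_{L^\infty}=M$, let the three integrals in $\mathcal E(F_0)$ converge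 absolutely, and suppose that $$\inf_{t\ge0,\,x\in\Omega}\int_{\mathbb R^3}F_0(x-vt,v)\,dv\ge C_0$$ and, with $t_1=(\tilde C_1\|wF_0\|_{L^\infty})^{-1}$, $$\mathcal E(F_0)+\sup_{t\ge t_1,\,x\in\Omega}e^{-\frac t{1-\nu}}\Big|\int_{\mathbb R^3}(1,v,|v|^2,v\otimes v)\,[F_0(x-vt,v)-\mu(v)]\,dv\Big|\le\varepsilon_0$$ (the infimum and the supremum being essential in $x$, for each $t$). Then there is a global mild solution $F\ge0$ with initial datum $F_0$ such that $$\sup_{t\ge0}\|wF(t)\|_{L^\infty}\le\tilde C_2,$$ and it is the only global mild solution $G\ge0$ with initial datum $F_0$ such that $\sup_{0\le t\le\tau}\|wG(t)\|_{L^\infty}<\infty$ for every $\tau>0$ (functions being identified when, for every $t\ge 0$, they agree for almost every $(x,v)$). -/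

import Mathlib

open MeasureTheory Set
open scoped ENNReal NNReal Matrix

noncomputable section

namespace ESBGK

/-- `ℝ³` with its Euclidean norm; the velocity space, and also one of the two position spaces. -/
abbrev R3 : Type := EuclideanSpace ℝ (Fin 3)

/-- The flat torus `𝕋³ = (ℝ/Lℤ)³` of side length `L`. -/
abbrev T3 (L : ℝ) : Type := Fin 3 → AddCircle L

/-- The quotient map `ℝ³ → (ℝ/Lℤ)³`. -/
def toT3 (L : ℝ) (y : R3) : T3 L := fun i => (y i : AddCircle L)

/-! ### Macroscopic quantities of a velocity profile `f : ℝ³ → ℝ` -/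

/-- Density `ρ = ∫ f dv`. -/
def density (f : R3 → ℝ) : ℝ := ∫ v, f v

/-- Bulk velocity `u = ρ⁻¹ ∫ v f dv`. -/
def bulkVelocity (f : R3 → ℝ) : R3 := (density f)⁻¹ • ∫ v, f v • v

/-- Temperature `T = (3ρ)⁻¹ ∫ |v - u|² f dv`. -/
def temperature (f : R3 → ℝ) : ℝ :=
  (3 * density f)⁻¹ * ∫ v, ‖v - bulkVelocity f‖ ^ 2 * f v

/-- Stress tensor `Θ = ρ⁻¹ ∫ (v - u) ⊗ (v - u) f dv`. -/
def stressTensor (f : R3 → ℝ) : Matrix (Fin 3) (Fin 3) ℝ :=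
  Matrix.of fun i j =>
    (density f)⁻¹ * ∫ v, (v - bulkVelocity f) i * (v - bulkVelocity f) j * f v

/-- Temperature tensor `𝒯_ν = (1 - ν) T Id + ν Θ`. -/
def temperatureTensor (ν : ℝ) (f : R3 → ℝ) : Matrix (Fin 3) (Fin 3) ℝ :=
  ((1 - ν) * temperature f) • (1 : Matrix (Fin 3) (Fin 3) ℝ) + ν • stressTensor f

/-- Anisotropic Gaussian
`M_ν = ρ / √(det (2π 𝒯_ν)) * exp (-½ (v - u)ᵗ 𝒯_ν⁻¹ (v - u))`. -/
def anisotropicGaussian (ν : ℝ) (f : R3 → ℝ) (v : R3) : ℝ :=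
  density f / √(((2 * Real.pi) • temperatureTensor ν f).det) *
    Real.exp (-(1 / 2) * ((v - bulkVelocity f).ofLp ⬝ᵥ
      ((temperatureTensor ν f)⁻¹ *ᵥ (v - bulkVelocity f).ofLp)))

/-- Collision frequency `A_ν = ρ T / (1 - ν)`. -/
def collisionFrequency (ν : ℝ) (f : R3 → ℝ) : ℝ :=
  density f * temperature f / (1 - ν)

/-- The normalized global Maxwellian `μ(v) = (2π)^(-3/2) exp (-|v|²/2)`. -/
def maxwellian (v : R3) : ℝ :=
  1 / (2 * Real.pi) ^ (3 / 2 : ℝ) * Real.exp (-(‖v‖ ^ 2 / 2))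

/-- The velocity weight `w(v) = (1 + |v|)^β`. -/
def weight (β : ℝ) (v : R3) : ℝ := (1 + ‖v‖) ^ β

/-! ### Functions on phase space `Ω × ℝ³`

`Ω` is the position space and `pr : ℝ³ → Ω` turns displacements into translations of `Ω`:
the identity if `Ω = ℝ³`, the quotient map if `Ω = 𝕋³`. The point `x - v t` of `Ω` is
`x - pr (t • v)`. -/

section PhaseSpace

variable {Ω : Type} [AddCommGroup Ω] [MeasureSpace Ω]

/-- The norm `‖w f‖` in `L^∞(Ω × ℝ³)` (an essential supremum), possibly infinite. -/
def weightedNorm (β : ℝ) (f : Ω → R3 → ℝ) : ℝ≥0∞ :=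
  eLpNorm (fun p : Ω × R3 => weight β p.2 * f p.1 p.2) ∞ volume

/-- Defect mass `M₀ = ∫∫ (F₀ - μ) dv dx`. -/
def defectMass (F₀ : Ω → R3 → ℝ) : ℝ :=
  ∫ p : Ω × R3, (F₀ p.1 p.2 - maxwellian p.2)

/-- Defect energy `E₀ = ∫∫ |v|² (F₀ - μ) dv dx`. -/
def defectEnergy (F₀ : Ω → R3 → ℝ) : ℝ :=
  ∫ p : Ω × R3, ‖p.2‖ ^ 2 * (F₀ p.1 p.2 - maxwellian p.2)

/-- The integrand `F₀ ln F₀ - μ ln μ`, with `0 ln 0 = 0`. -/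
def entropyDensity (F₀ : Ω → R3 → ℝ) (p : Ω × R3) : ℝ :=
  F₀ p.1 p.2 * Real.log (F₀ p.1 p.2) - maxwellian p.2 * Real.log (maxwellian p.2)

/-- `ℰ(F₀) = ∫∫ (F₀ ln F₀ - μ ln μ) dv dx + (3/2 ln (2π) - 1) M₀ + ½ E₀`. -/
def entropy (F₀ : Ω → R3 → ℝ) : ℝ :=
  (∫ p : Ω × R3, entropyDensity F₀ p)
    + (3 / 2 * Real.log (2 * Real.pi) - 1) * defectMass F₀ + 1 / 2 * defectEnergy F₀

/-- The integrals that make up `ℰ(F₀)` converge absolutely. -/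
structure EntropyDefined (F₀ : Ω → R3 → ℝ) : Prop where
  entropy : Integrable (entropyDensity F₀) volume
  mass : Integrable (fun p : Ω × R3 => F₀ p.1 p.2 - maxwellian p.2) volume
  energy : Integrable (fun p : Ω × R3 => ‖p.2‖ ^ 2 * (F₀ p.1 p.2 - maxwellian p.2)) volume

/-- The Euclidean length `|∫ (1, v, |v|², v ⊗ v) g(v) dv|` of a vector of moments. -/
def momentLength (g : R3 → ℝ) : ℝ :=
  √((∫ v, g v) ^ 2 + (∑ i, (∫ v, v i * g v) ^ 2) + (∫ v, ‖v‖ ^ 2 * g v) ^ 2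
    + ∑ i, ∑ j, (∫ v, v i * v j * g v) ^ 2)

/-- `F` is a global mild solution with initial datum `F₀`: all integrals in the mild form converge,
and for every `t ≥ 0` and almost every `(x, v)`
`F(t,x,v) = F₀(x-vt,v) exp (-∫₀ᵗ A_ν(τ,x-v(t-τ)) dτ)`
`+ ∫₀ᵗ exp (-∫ₛᵗ A_ν(τ,x-v(t-τ)) dτ) A_ν(s,x-v(t-s)) M_ν(s,x-v(t-s),v) ds`.
Values of `F` at negative times play no role. -/
structure IsMildSolution (pr : R3 → Ω) (ν : ℝ) (F₀ : Ω → R3 → ℝ) (F : ℝ → Ω → R3 → ℝ) :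
    Prop where
  measurable : Measurable fun q : ℝ × Ω × R3 => F q.1 q.2.1 q.2.2
  moments : ∀ t : ℝ, 0 ≤ t → ∀ᵐ x : Ω, Integrable (fun v => (1 + ‖v‖ ^ 2) * F t x v) volume
  frequency : ∀ t : ℝ, 0 ≤ t → ∀ᵐ p : Ω × R3,
    IntervalIntegrable
      (fun τ => collisionFrequency ν (F τ (p.1 - pr ((t - τ) • p.2)))) volume 0 t
  gain : ∀ t : ℝ, 0 ≤ t → ∀ᵐ p : Ω × R3,
    IntervalIntegrable
      (fun s =>
        Real.exp (-∫ τ in s..t, collisionFrequency ν (F τ (p.1 - pr ((t - τ) • p.2))))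
          * collisionFrequency ν (F s (p.1 - pr ((t - s) • p.2)))
          * anisotropicGaussian ν (F s (p.1 - pr ((t - s) • p.2))) p.2) volume 0 t
  mild_form : ∀ t : ℝ, 0 ≤ t → ∀ᵐ p : Ω × R3,
    F t p.1 p.2 =
      F₀ (p.1 - pr (t • p.2)) p.2
          * Real.exp (-∫ τ in (0 : ℝ)..t,
              collisionFrequency ν (F τ (p.1 - pr ((t - τ) • p.2))))
        + ∫ s in (0 : ℝ)..t,
            Real.exp (-∫ τ in s..t, collisionFrequency ν (F τ (p.1 - pr ((t - τ) • p.2))))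
              * collisionFrequency ν (F s (p.1 - pr ((t - s) • p.2)))
              * anisotropicGaussian ν (F s (p.1 - pr ((t - s) • p.2))) p.2

/-- The hypotheses on the initial datum. `M` is the value of `‖w F₀‖` and `t₁ = (C₁ M)⁻¹`; the
infimum and the supremum over `x` are essential ones, as `F₀` is an element of `L^∞`. -/
structure IsAdmissible (pr : R3 → Ω) (ν β C₀ : ℝ) (M : ℝ≥0) (ε₀ C₁ : ℝ) (F₀ : Ω → R3 → ℝ) :
    Prop where
  measurable : Measurable fun p : Ω × R3 => F₀ p.1 p.2
  nonneg : ∀ᵐ p : Ω × R3, 0 ≤ F₀ p.1 p.2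
  norm_eq : weightedNorm β F₀ = (M : ℝ≥0∞)
  density_ge : ∀ t : ℝ, 0 ≤ t → ∀ᵐ x : Ω, C₀ ≤ ∫ v, F₀ (x - pr (t • v)) v
  entropyDefined : EntropyDefined F₀
  small : ∀ t : ℝ, (C₁ * M)⁻¹ ≤ t → ∀ᵐ x : Ω,
    entropy F₀ + Real.exp (-(t / (1 - ν))) *
      momentLength (fun v => F₀ (x - pr (t • v)) v - maxwellian v) ≤ ε₀

/-- There is a global mild solution `F ≥ 0` with `sup_{t ≥ 0} ‖w F(t)‖ ≤ C₂`, and it is the only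
nonnegative global mild solution whose weighted norm is bounded on bounded time intervals. -/
def HasUniqueGlobalSolution (pr : R3 → Ω) (ν β C₂ : ℝ) (F₀ : Ω → R3 → ℝ) : Prop :=
  ∃ F : ℝ → Ω → R3 → ℝ,
    IsMildSolution pr ν F₀ F ∧
    (∀ t : ℝ, 0 ≤ t → ∀ᵐ p : Ω × R3, 0 ≤ F t p.1 p.2) ∧
    (∀ t : ℝ, 0 ≤ t → weightedNorm β (F t) ≤ ENNReal.ofReal C₂) ∧
    ∀ G : ℝ → Ω → R3 → ℝ,
      IsMildSolution pr ν F₀ G →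
      (∀ t : ℝ, 0 ≤ t → ∀ᵐ p : Ω × R3, 0 ≤ G t p.1 p.2) →
      (∀ τ : ℝ, ∃ B : ℝ≥0, ∀ t : ℝ, 0 ≤ t → t ≤ τ → weightedNorm β (G t) ≤ (B : ℝ≥0∞)) →
      ∀ t : ℝ, 0 ≤ t → ∀ᵐ p : Ω × R3, G t p.1 p.2 = F t p.1 p.2

end PhaseSpace

end ESBGK

end

/-!
# Global mild solutions of the ES-BGK equation for data with small entropy

**Truncation.** The frequency `A_ν` and the Gaussian `M_ν` depend on `F` only through its moments
`∫ (1, v) ⊗ (1, v) F dv`. On a compact convex box of moments, with density and energy about every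
point bounded below (`MomBox`), both are smooth, and composing them with the nonexpansive retraction
onto the box gives a globally bounded and Lipschitz law with Gaussian decay (`RelaxLaw`,
`exists_relaxLaw`). For a prescribed moment field the mild formulation is explicit (`flow`), so the
truncated problem is a fixed-point problem for the moment field, which Picard iteration solves
globally in time and which has all the bounds `F ≤ N / w` built in (`exists_fixedPoint`).

**Entropy.** Everything hinges on showing that the moments never leave the box. Let
`φ(z) = z log (z / μ) - z + μ`; then `ℰ(F₀) = ∫∫ φ(F₀)`. Jensen's inequality along characteristics
(`relEnt_relax_add_le`) bounds the entropy at time `t` plus its loss by the initial entropy plus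
the gain. It first gives `∫∫ φ(F(t)) < ∞` through the Picard iterates
(`exists_phaseEntropy_picard_le`), and then, as long as the moments are in the box, gain ≤ loss by
the pointwise entropy inequality `∫ φ(M_ν) ≤ ∫ φ(F)` (`HasFields.entropy_le`), which rests on
`det Θ ≤ det 𝒯_ν` for `-1/2 < ν < 1`. Hence the entropy does not exceed `ℰ(F₀)`
(`phaseEntropy_flow_le`).

**Closeness to `μ`.** The deviation `F - μ` relaxes at the constant rate `(1 - ν)⁻¹`, up to a
remainder that averages the deviation of the moments over the past of the characteristics. The last
`δ` units of time and large velocities contribute little. For the rest, free transport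
over a time `≥ δ` spreads bounded velocity sets over the position space with bounded density, so the
average is controlled by the total entropy (`exists_flowMom_close`). Thus the entropy bound up to
time `t - δ` puts the moments at time `t` next to those of `μ`, in the interior of the box, and one
advances in steps of length `δ` (`exists_solution_in_box`). In the initial layer `t ≤ (C₁ M)⁻¹`,
where the transported datum need not be small, the gain is small and the density keeps half of its
lower bound (`Calibration.momBox_of_le`).

**Uniqueness.** A bounded mild solution has a density that decays at most exponentially, so on a
bounded time interval its moments lie in some box, and any two such solutions solve the same
truncated problem (`exists_law_eq_flow`), for which the iteration is a contraction
(`IsMildSolution.unique`).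

The position space enters only through `IsCover`, which `ℝ³` and the torus satisfy.
-/

noncomputable section

namespace ESBGK

/-! ### Linear relaxation along a single characteristic -/

/-- A bounded measurable function of time, the class of coefficients allowed along
characteristics. -/
structure BddMeas (b : ℝ → ℝ) : Prop where
  meas : Measurable b
  bdd : ∃ C, ∀ s, |b s| ≤ C

lemma BddMeas.of_bound {b : ℝ → ℝ} (h : Measurable b) {C : ℝ} (hC : ∀ s, |b s| ≤ C) : BddMeas b :=
  ⟨h, C, hC⟩

lemma BddMeas.mul {b c : ℝ → ℝ} (hb : BddMeas b) (hc : BddMeas c) :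
    BddMeas (fun s => b s * c s) := by
  obtain ⟨hb, B, hB⟩ := hb
  obtain ⟨hc, C, hC⟩ := hc
  refine ⟨hb.mul hc, B * C, fun s => ?_⟩
  rw [abs_mul]
  exact mul_le_mul (hB s) (hC s) (abs_nonneg _) ((abs_nonneg _).trans (hB s))

lemma BddMeas.sub {b c : ℝ → ℝ} (hb : BddMeas b) (hc : BddMeas c) :
    BddMeas (fun s => b s - c s) := by
  obtain ⟨hb, B, hB⟩ := hb
  obtain ⟨hc, C, hC⟩ := hc
  refine ⟨hb.sub hc, B + C, fun s => ?_⟩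
  exact (abs_sub _ _).trans (add_le_add (hB s) (hC s))

lemma BddMeas.add {b c : ℝ → ℝ} (hb : BddMeas b) (hc : BddMeas c) :
    BddMeas (fun s => b s + c s) := by
  obtain ⟨hb, B, hB⟩ := hb
  obtain ⟨hc, C, hC⟩ := hc
  refine ⟨hb.add hc, B + C, fun s => ?_⟩
  exact (abs_add_le _ _).trans (add_le_add (hB s) (hC s))

lemma BddMeas.neg {b : ℝ → ℝ} (hb : BddMeas b) : BddMeas (fun s => -b s) := by
  obtain ⟨hb, B, hB⟩ := hb
  exact ⟨hb.neg, B, fun s => by rw [abs_neg]; exact hB s⟩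

lemma BddMeas.const (c : ℝ) : BddMeas (fun _ => c) := ⟨measurable_const, |c|, fun _ => le_rfl⟩

lemma BddMeas.intervalIntegrable {b : ℝ → ℝ} (hb : BddMeas b) (s t : ℝ) :
    IntervalIntegrable b volume s t := by
  obtain ⟨hb, B, hB⟩ := hb
  rw [intervalIntegrable_iff]
  exact Measure.integrableOn_of_bounded (M := B) (by simp) hb.aestronglyMeasurable
    (Filter.Eventually.of_forall hB)

lemma BddMeas.locallyIntegrable {b : ℝ → ℝ} (hb : BddMeas b) : LocallyIntegrable b volume := by
  obtain ⟨hb, B, hB⟩ := hb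
  intro x
  exact ⟨Icc (x - 1) (x + 1), Icc_mem_nhds (by linarith) (by linarith),
    Measure.integrableOn_of_bounded (M := B) (by simp) hb.aestronglyMeasurable
      (Filter.Eventually.of_forall hB)⟩

lemma abs_integral_le_of_bound {b : ℝ → ℝ} {B : ℝ} (hB : ∀ s, |b s| ≤ B) (s t : ℝ) :
    |∫ τ in s..t, b τ| ≤ B * |t - s| :=
  intervalIntegral.norm_integral_le_of_norm_le_const (f := b) fun x _ => hB x

lemma BddMeas.continuous {b : ℝ → ℝ} (hb : BddMeas b) :
    Continuous (fun t => ∫ τ in (0 : ℝ)..t, b τ) :=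
  intervalIntegral.continuous_primitive (fun s t => hb.intervalIntegrable s t) 0

lemma BddMeas.absolutelyContinuous {b : ℝ → ℝ} (hb : BddMeas b) {t : ℝ} (_ht : 0 ≤ t) :
    AbsolutelyContinuousOnInterval (fun t => ∫ τ in (0 : ℝ)..t, b τ) 0 t :=
  (hb.intervalIntegrable 0 t).absolutelyContinuousOnInterval_intervalIntegral (by simp)

lemma BddMeas.absolutelyContinuous_exp {b : ℝ → ℝ} (hb : BddMeas b) {t : ℝ} (_ht : 0 ≤ t) :
    AbsolutelyContinuousOnInterval (fun t => Real.exp (∫ τ in (0 : ℝ)..t, b τ)) 0 t := by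
  obtain ⟨B, hB⟩ := hb.bdd
  have hB0 : 0 ≤ B := (abs_nonneg _).trans (hB 0)
  set S := (fun t => ∫ τ in (0 : ℝ)..t, b τ) '' uIcc 0 t
  have hcpt : IsCompact S := isCompact_uIcc.image hb.continuous
  have hconv : Convex ℝ S := by
    rw [← convex_iff_ordConnected.trans Iff.rfl |>.symm]
    exact ((isPreconnected_uIcc).image _ hb.continuous.continuousOn).ordConnected
  obtain ⟨K, hK⟩ := (Real.contDiff_exp (n := 1)).contDiffOn.exists_lipschitzOnWith
    (s := S) (by decide) hconv hcpt
  have hL : LipschitzOnWith (Real.toNNReal B) (fun t => ∫ τ in (0 : ℝ)..t, b τ) (uIcc 0 t) := by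
    refine LipschitzOnWith.of_dist_le_mul fun x _ y _ => ?_
    rw [Real.dist_eq, Real.dist_eq, intervalIntegral.integral_interval_sub_left
      (hb.intervalIntegrable _ _) (hb.intervalIntegrable _ _), Real.coe_toNNReal _ hB0]
    exact abs_integral_le_of_bound hB _ _
  exact (hK.comp hL (mapsTo_image _ _)).absolutelyContinuousOnInterval

/-- The solution of `y' + b y = h`, `y 0 = y₀`. -/
def linearSol (b h : ℝ → ℝ) (y₀ t : ℝ) : ℝ :=
  y₀ * Real.exp (-∫ τ in (0 : ℝ)..t, b τ) + ∫ s in (0 : ℝ)..t, Real.exp (-∫ τ in s..t, b τ) * h s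

lemma exp_integral_split {b : ℝ → ℝ} (hb : BddMeas b) (s t : ℝ) :
    Real.exp (-∫ τ in s..t, b τ) =
      Real.exp (-∫ τ in (0 : ℝ)..t, b τ) * Real.exp (∫ τ in (0 : ℝ)..s, b τ) := by
  rw [← Real.exp_add, ← intervalIntegral.integral_interval_sub_left
    (hb.intervalIntegrable 0 t) (hb.intervalIntegrable 0 s)]
  ring_nf

lemma linearSol_eq {b h : ℝ → ℝ} (hb : BddMeas b) (y₀ t : ℝ) :
    linearSol b h y₀ t = Real.exp (-∫ τ in (0 : ℝ)..t, b τ) *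
      (y₀ + ∫ s in (0 : ℝ)..t, Real.exp (∫ τ in (0 : ℝ)..s, b τ) * h s) := by
  rw [linearSol, mul_add, mul_comm, ← intervalIntegral.integral_const_mul]
  congr 2
  ext s
  rw [exp_integral_split hb]; ring

lemma BddMeas.exp_mul_intervalIntegrable {b h : ℝ → ℝ} (hb : BddMeas b) (hh : BddMeas h)
    (s t : ℝ) :
    IntervalIntegrable (fun s => Real.exp (∫ τ in (0 : ℝ)..s, b τ) * h s) volume s t :=
  (hh.intervalIntegrable s t).continuousOn_mul (Real.continuous_exp.comp hb.continuous).continuousOn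

lemma BddMeas.exp_mul_locallyIntegrable {b h : ℝ → ℝ} (hb : BddMeas b) (hh : BddMeas h) :
    LocallyIntegrable (fun s => Real.exp (∫ τ in (0 : ℝ)..s, b τ) * h s) volume := by
  intro x
  refine ⟨Icc (x - 1) (x + 1), Icc_mem_nhds (by linarith) (by linarith), ?_⟩
  have := hb.exp_mul_intervalIntegrable hh (x - 1) (x + 1)
  rwa [intervalIntegrable_iff_integrableOn_Icc_of_le (by linarith)] at this

lemma linearSol_continuous {b h : ℝ → ℝ} (hb : BddMeas b) (hh : BddMeas h) (y₀ : ℝ) :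
    Continuous (linearSol b h y₀) := by
  have : linearSol b h y₀ = fun t => _ := funext fun t => linearSol_eq hb y₀ t
  rw [this]
  have h1 := hb.continuous
  have h2 : Continuous fun t => ∫ s in (0 : ℝ)..t, Real.exp (∫ τ in (0 : ℝ)..s, b τ) * h s :=
    intervalIntegral.continuous_primitive (fun s t => hb.exp_mul_intervalIntegrable hh s t) 0
  fun_prop

/-- The explicit solution satisfies the integrated equation. -/
lemma linearSol_integral_eq {b h : ℝ → ℝ} (hb : BddMeas b) (hh : BddMeas h) (y₀ : ℝ) {t : ℝ}
    (ht : 0 ≤ t) :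
    linearSol b h y₀ t = y₀ + ∫ s in (0 : ℝ)..t, (h s - b s * linearSol b h y₀ s) := by
  set Y : ℝ → ℝ := fun t => y₀ + ∫ s in (0 : ℝ)..t, Real.exp (∫ τ in (0 : ℝ)..s, b τ) * h s with hY
  have hexp : AbsolutelyContinuousOnInterval
      (fun t => Real.exp (-∫ τ in (0 : ℝ)..t, b τ)) 0 t := by
    have := hb.neg.absolutelyContinuous_exp ht
    simpa only [intervalIntegral.integral_neg] using this
  have hYac : AbsolutelyContinuousOnInterval Y 0 t := by
    have h1 : AbsolutelyContinuousOnInterval (fun _ : ℝ => y₀) 0 t :=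
      (LipschitzWith.const y₀).lipschitzOnWith.absolutelyContinuousOnInterval
    exact h1.add ((hb.exp_mul_intervalIntegrable hh 0 t).absolutelyContinuousOnInterval_intervalIntegral
      (c := 0) (by simp))
  have hac := hexp.mul hYac
  have hfun : linearSol b h y₀ = (fun t => Real.exp (-∫ τ in (0 : ℝ)..t, b τ)) * Y :=
    funext fun t => linearSol_eq hb y₀ t
  have hftc := hac.integral_deriv_eq_sub
  have h0 : ((fun t => Real.exp (-∫ τ in (0 : ℝ)..t, b τ)) * Y) 0 = y₀ := by simp [hY]
  rw [h0, ← hfun] at hftc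
  have hcongr : ∫ x in (0 : ℝ)..t, deriv (linearSol b h y₀) x
      = ∫ s in (0 : ℝ)..t, (h s - b s * linearSol b h y₀ s) := by
    apply intervalIntegral.integral_congr_ae
    filter_upwards [_root_.LocallyIntegrable.ae_hasDerivAt_integral hb.locallyIntegrable,
      _root_.LocallyIntegrable.ae_hasDerivAt_integral (hb.exp_mul_locallyIntegrable hh)] with x hx1 hx2 _
    have d1 := ((hx1 0).neg.exp).mul ((hx2 0).const_add y₀)
    refine ((congrArg (deriv · x) hfun).trans d1.deriv).trans ?_
    rw [linearSol_eq hb]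
    simp only [Pi.neg_apply]
    have e : Real.exp (-∫ τ in (0 : ℝ)..x, b τ) * Real.exp (∫ τ in (0 : ℝ)..x, b τ) = 1 := by
      rw [← Real.exp_add]; simp
    linear_combination (h x) * e
  linarith

/-- Variation of constants: a solution of the integrated equation is given by the explicit
formula. -/
lemma eq_linearSol {b h r z : ℝ → ℝ} (hb : BddMeas b) (hr : BddMeas r)
    {z₀ t : ℝ} (ht : 0 ≤ t) (hz : ∀ s ∈ Icc 0 t, z s = z₀ + ∫ τ in (0 : ℝ)..s, r τ)
    (hrz : ∀ s ∈ Icc 0 t, r s = h s - b s * z s) :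
    z t = linearSol b h z₀ t := by
  set Z : ℝ → ℝ := fun s => z₀ + ∫ τ in (0 : ℝ)..s, r τ with hZ
  have hZac : AbsolutelyContinuousOnInterval Z 0 t := by
    have h1 : AbsolutelyContinuousOnInterval (fun _ : ℝ => z₀) 0 t :=
      (LipschitzWith.const z₀).lipschitzOnWith.absolutelyContinuousOnInterval
    exact h1.add (hr.absolutelyContinuous ht)
  have hac := (hb.absolutelyContinuous_exp ht).mul hZac
  have hftc := hac.integral_deriv_eq_sub
  have hcongr : ∫ x in (0 : ℝ)..t,
      deriv ((fun t => Real.exp (∫ τ in (0 : ℝ)..t, b τ)) * Z) x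
      = ∫ s in (0 : ℝ)..t, Real.exp (∫ τ in (0 : ℝ)..s, b τ) * h s := by
    apply intervalIntegral.integral_congr_ae
    filter_upwards [_root_.LocallyIntegrable.ae_hasDerivAt_integral hb.locallyIntegrable,
      _root_.LocallyIntegrable.ae_hasDerivAt_integral hr.locallyIntegrable] with x hx1 hx2 hx
    have hx' : x ∈ Icc 0 t := by
      rw [uIoc_of_le ht] at hx; exact ⟨hx.1.le, hx.2⟩
    have d1 := ((hx1 0).exp).mul ((hx2 0).const_add z₀)
    rw [d1.deriv, hrz x hx', hz x hx']
    ring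
  rw [hcongr] at hftc
  simp only [Pi.mul_apply, intervalIntegral.integral_same, Real.exp_zero, one_mul] at hftc
  have hZ0 : Z 0 = z₀ := by simp [hZ]
  rw [linearSol_eq hb, hftc, hZ0, hz t ⟨ht, le_rfl⟩]
  have e : Real.exp (-∫ τ in (0 : ℝ)..t, b τ) * Real.exp (∫ τ in (0 : ℝ)..t, b τ) = 1 := by
    rw [← Real.exp_add]; simp
  linear_combination (-(Z t)) * e

/-- The value at time `t` of the solution of `y' = a (M - y)`, `y 0 = y₀`. -/
def relax (a M : ℝ → ℝ) (y₀ t : ℝ) : ℝ := linearSol a (fun s => a s * M s) y₀ t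

lemma relax_integral_eq {a M : ℝ → ℝ} (ha : BddMeas a) (hM : BddMeas M) (y₀ : ℝ) {t : ℝ}
    (ht : 0 ≤ t) :
    relax a M y₀ t = y₀ + ∫ s in (0 : ℝ)..t, a s * (M s - relax a M y₀ s) := by
  rw [relax, linearSol_integral_eq ha (ha.mul hM) y₀ ht]
  congr 2; ext s; rw [relax]; ring

lemma relax_continuous {a M : ℝ → ℝ} (ha : BddMeas a) (hM : BddMeas M) (y₀ : ℝ) :
    Continuous (relax a M y₀) := linearSol_continuous ha (ha.mul hM) y₀

lemma linearSol_mono {b h h' : ℝ → ℝ} (hb : BddMeas b) (hh : BddMeas h) (hh' : BddMeas h')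
    {y y' t : ℝ} (ht : 0 ≤ t) (hy : y ≤ y') (hle : ∀ s ∈ Icc 0 t, h s ≤ h' s) :
    linearSol b h y t ≤ linearSol b h' y' t := by
  rw [linearSol_eq hb, linearSol_eq hb]
  gcongr
  refine intervalIntegral.integral_mono_on ht (hb.exp_mul_intervalIntegrable hh _ _)
    (hb.exp_mul_intervalIntegrable hh' _ _) fun s hs => ?_
  have := hle s hs
  gcongr

lemma relax_mono {a M M' : ℝ → ℝ} (ha : BddMeas a) (hM : BddMeas M) (hM' : BddMeas M')
    {y y' t : ℝ} (ht : 0 ≤ t) (ha0 : ∀ s ∈ Icc 0 t, 0 ≤ a s) (hy : y ≤ y')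
    (hle : ∀ s ∈ Icc 0 t, M s ≤ M' s) : relax a M y t ≤ relax a M' y' t :=
  linearSol_mono ha (ha.mul hM) (ha.mul hM') ht hy fun s hs =>
    mul_le_mul_of_nonneg_left (hle s hs) (ha0 s hs)

lemma relax_const {a : ℝ → ℝ} (ha : BddMeas a) (c : ℝ) {t : ℝ} (ht : 0 ≤ t) :
    relax a (fun _ => c) c t = c := by
  symm
  refine eq_linearSol (z := fun _ => c) (r := fun _ => 0) ha (.const 0) ht
    (fun s _ => by simp) (fun s _ => by ring)

lemma relax_nonneg {a M : ℝ → ℝ} (ha : BddMeas a) (hM : BddMeas M)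
    {y t : ℝ} (ht : 0 ≤ t) (ha0 : ∀ s ∈ Icc 0 t, 0 ≤ a s) (hy : 0 ≤ y)
    (hle : ∀ s ∈ Icc 0 t, 0 ≤ M s) : 0 ≤ relax a M y t := by
  have := relax_mono ha (.const 0) hM ht ha0 hy hle
  rwa [relax_const ha 0 ht] at this

lemma relax_le {a M : ℝ → ℝ} (ha : BddMeas a) (hM : BddMeas M)
    {y t c : ℝ} (ht : 0 ≤ t) (ha0 : ∀ s ∈ Icc 0 t, 0 ≤ a s) (hy : y ≤ c)
    (hle : ∀ s ∈ Icc 0 t, M s ≤ c) : relax a M y t ≤ c := by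
  have := relax_mono ha hM (.const c) ht ha0 hy hle
  rwa [relax_const ha c ht] at this

lemma relax_ge {a M : ℝ → ℝ} (ha : BddMeas a) (hM : BddMeas M) {y t : ℝ} (ht : 0 ≤ t)
    (ha0 : ∀ s ∈ Icc 0 t, 0 ≤ a s) (hle : ∀ s ∈ Icc 0 t, 0 ≤ M s) :
    y * Real.exp (-∫ τ in (0 : ℝ)..t, a τ) ≤ relax a M y t := by
  have := relax_mono ha (.const 0) hM ht ha0 le_rfl hle (y := y)
  refine le_trans (le_of_eq ?_) this
  simp [relax, linearSol]

/-- For `0 ≤ a ≤ A` and `0 ≤ M ≤ B` the solution grows at most linearly. -/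
lemma relax_le_add {a M : ℝ → ℝ} (ha : BddMeas a) (hM : BddMeas M) {y t A B : ℝ} (ht : 0 ≤ t)
    (ha0 : ∀ s, 0 ≤ a s) (haA : ∀ s, a s ≤ A) (hM0 : ∀ s, 0 ≤ M s) (hMB : ∀ s, M s ≤ B)
    (hy : 0 ≤ y) : relax a M y t ≤ y + t * (A * B) := by
  rw [relax_integral_eq ha hM y ht]
  have h1 : ∫ s in (0 : ℝ)..t, a s * (M s - relax a M y s) ≤ ∫ s in (0 : ℝ)..t, A * B := by
    refine intervalIntegral.integral_mono_on ht ?_ (by simp) fun s hs => ?_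
    · simp only [mul_sub]
      exact ((ha.mul hM).intervalIntegrable 0 t).sub
        ((ha.intervalIntegrable 0 t).mul_continuousOn (relax_continuous ha hM y).continuousOn)
    · have h2 : 0 ≤ relax a M y s := relax_nonneg ha hM hs.1 (fun s _ => ha0 s) hy (fun s _ => hM0 s)
      have := ha0 s
      calc a s * (M s - relax a M y s) ≤ a s * B := by
            gcongr; linarith [hMB s]
        _ ≤ A * B := by gcongr; exacts [(hM0 0).trans (hMB 0), haA s]
  simp at h1
  linarith

/-- Comparison of two relaxation equations: the difference of the solutions relaxes with the first
frequency and is driven by the differences of the data. -/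
lemma relax_sub {a M a' M' : ℝ → ℝ} (ha : BddMeas a) (hM : BddMeas M) (ha' : BddMeas a')
    (hM' : BddMeas M') (y y' : ℝ) {t : ℝ} (ht : 0 ≤ t)
    (hbd : ∃ C, ∀ s, 0 ≤ s → |relax a' M' y' s| ≤ C) (hbd1 : ∃ C, ∀ s, 0 ≤ s → |relax a M y s| ≤ C) :
    relax a M y t - relax a' M' y' t =
      linearSol a (fun s => (a s - a' s) * (M' s - relax a' M' y' (max s 0)) + a s * (M s - M' s))
        (y - y') t := by
  have hy' : BddMeas fun s => relax a' M' y' (max s 0) := by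
    obtain ⟨C, hC⟩ := hbd
    exact ⟨((relax_continuous ha' hM' y').comp (by fun_prop)).measurable, C,
      fun s => hC _ (le_max_right _ _)⟩
  have hy : BddMeas fun s => relax a M y (max s 0) := by
    obtain ⟨C, hC⟩ := hbd1
    exact ⟨((relax_continuous ha hM y).comp (by fun_prop)).measurable, C,
      fun s => hC _ (le_max_right _ _)⟩
  refine eq_linearSol (z := fun s => relax a M y s - relax a' M' y' s)
    (r := fun s => a s * (M s - relax a M y (max s 0)) - a' s * (M' s - relax a' M' y' (max s 0)))
    ha ((ha.mul (hM.sub hy)).sub (ha'.mul (hM'.sub hy'))) ht ?_ ?_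
  · intro s hs
    have e1 : ∫ τ in (0 : ℝ)..s, a τ * (M τ - relax a M y τ) =
        ∫ τ in (0 : ℝ)..s, a τ * (M τ - relax a M y (max τ 0)) := by
      refine intervalIntegral.integral_congr fun τ hτ => ?_
      rw [uIcc_of_le hs.1] at hτ
      simp only [max_eq_left hτ.1]
    have e2 : ∫ τ in (0 : ℝ)..s, a' τ * (M' τ - relax a' M' y' τ) =
        ∫ τ in (0 : ℝ)..s, a' τ * (M' τ - relax a' M' y' (max τ 0)) := by
      refine intervalIntegral.integral_congr fun τ hτ => ?_
      rw [uIcc_of_le hs.1] at hτ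
      simp only [max_eq_left hτ.1]
    rw [relax_integral_eq ha hM y hs.1, relax_integral_eq ha' hM' y' hs.1, e1, e2,
      intervalIntegral.integral_sub ((ha.mul (hM.sub hy)).intervalIntegrable _ _)
        ((ha'.mul (hM'.sub hy')).intervalIntegrable _ _)]
    ring
  · intro s hs
    simp only [max_eq_left hs.1]
    ring

/-! ### Relative entropy densities -/

/-- The relative entropy density `z log (z / m) - z + m` of a value `z ≥ 0` with respect to a
reference value `m > 0`. -/
def relEnt (z m : ℝ) : ℝ := z * Real.log z - z * Real.log m - z + m

lemma fenchel_aux (z m g : ℝ) :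
    relEnt z m = (g * z - m * (Real.exp g - 1)) +
      z * (Real.log z - Real.log m - g) - z + m * Real.exp g := by
  rw [relEnt]; ring

/-- Young's inequality for the pair of conjugate functions `relEnt · m` and `m (exp · - 1)`. -/
lemma fenchel {z m : ℝ} (hz : 0 ≤ z) (hm : 0 < m) (g : ℝ) :
    g * z - m * (Real.exp g - 1) ≤ relEnt z m := by
  rcases hz.eq_or_lt with rfl | hz
  · simp only [relEnt]; nlinarith [mul_pos hm (Real.exp_pos g)]
  · rw [fenchel_aux z m g]
    have h := Real.add_one_le_exp (g - (Real.log z - Real.log m))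
    have e : z * Real.exp (g - (Real.log z - Real.log m)) = m * Real.exp g := by
      rw [Real.exp_sub, Real.exp_sub, Real.exp_log hz, Real.exp_log hm]; field_simp
    nlinarith [mul_le_mul_of_nonneg_left h hz.le]

lemma relEnt_nonneg {z m : ℝ} (hz : 0 ≤ z) (hm : 0 < m) : 0 ≤ relEnt z m := by
  simpa using fenchel hz hm 0

lemma relEnt_le_of_forall {z m C : ℝ} (hz : 0 ≤ z) (hm : 0 < m)
    (h : ∀ g : ℝ, g * z - m * (Real.exp g - 1) ≤ C) : relEnt z m ≤ C := by
  rcases hz.eq_or_lt with rfl | hz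
  · have hlim : Filter.Tendsto (fun g : ℝ => g * 0 - m * (Real.exp g - 1)) Filter.atBot
        (nhds (0 - m * (0 - 1))) := by
      simp only [mul_zero]
      exact ((Real.tendsto_exp_atBot.sub_const 1).const_mul m).const_sub 0
    have := le_of_tendsto' hlim h
    simp only [relEnt]; linarith
  · refine le_trans (le_of_eq ?_) (h (Real.log z - Real.log m))
    rw [Real.exp_sub, Real.exp_log hz, Real.exp_log hm, relEnt]; field_simp; ring

lemma exp_sub_one_sub_le (g : ℝ) : Real.exp g - 1 - g ≤ g ^ 2 * Real.exp |g| := by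
  rcases le_total 0 g with hg | hg
  · rw [abs_of_nonneg hg]
    have h1 : Real.exp g * (1 - g) ≤ 1 := by
      have := mul_le_mul_of_nonneg_left (Real.add_one_le_exp (-g)) (Real.exp_pos g).le
      rw [← Real.exp_add] at this; simp at this; linarith
    nlinarith
  · have h1 : Real.exp g * (1 - g) ≤ 1 := by
      have := mul_le_mul_of_nonneg_left (Real.add_one_le_exp (-g)) (Real.exp_pos g).le
      rw [← Real.exp_add] at this; simp at this; linarith
    have h2 : (Real.exp g - 1 - g) * (1 - g) ≤ g ^ 2 := by nlinarith
    have h3 : Real.exp g - 1 - g ≤ g ^ 2 := by nlinarith [Real.add_one_le_exp g]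
    have h4 : 1 ≤ Real.exp |g| := Real.one_le_exp (abs_nonneg g)
    nlinarith [sq_nonneg g]

/-- The relative entropy density is at most quadratic in the difference of the logarithms. -/
lemma relEnt_le_sq {z m : ℝ} (hz : 0 < z) (hm : 0 < m) :
    relEnt z m ≤ (Real.log z - Real.log m) ^ 2 * (z + m) := by
  set x := Real.log z - Real.log m with hx
  have hzx : z = m * Real.exp x := by
    rw [hx, Real.exp_sub, Real.exp_log hz, Real.exp_log hm]; field_simp
  have h0 : relEnt z m = m * (x * Real.exp x - Real.exp x + 1) := by
    have : relEnt z m = z * x - z + m := by rw [relEnt, hx]; ring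
    rw [this]; nth_rewrite 1 2 [hzx]; ring
  have h1 : x * Real.exp x - Real.exp x + 1 ≤ x ^ 2 * (Real.exp x + 1) := by
    have he := Real.exp_pos x
    have hf : Real.exp (-x) * Real.exp x = 1 := by rw [← Real.exp_add]; simp
    rcases le_total 0 x with h | h
    · have h2 := Real.add_one_le_exp x
      have h3 : Real.exp (-x) ≤ 1 - x + x ^ 2 := by
        have h4 : Real.exp (-x) * (1 + x) ≤ 1 := by nlinarith [Real.exp_pos (-x)]
        have h5 : (1 : ℝ) ≤ (1 - x + x ^ 2) * (1 + x) := by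
          have : 0 ≤ x ^ 3 := by positivity
          nlinarith
        nlinarith
      nlinarith [mul_le_mul_of_nonneg_right h3 he.le, sq_nonneg x]
    · have h2 := Real.add_one_le_exp x
      nlinarith [mul_le_mul_of_nonneg_right h2 (by linarith : (0 : ℝ) ≤ 1 - x), sq_nonneg x,
        mul_nonneg (sq_nonneg x) he.le]
  rw [h0]
  calc m * (x * Real.exp x - Real.exp x + 1) ≤ m * (x ^ 2 * (Real.exp x + 1)) := by gcongr
    _ = x ^ 2 * (z + m) := by rw [hzx]; ring

lemma continuous_relEnt (m : ℝ) : Continuous fun z => relEnt z m := by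
  unfold relEnt
  have := Real.continuous_mul_log
  fun_prop

@[fun_prop]
lemma measurable_relEnt {α : Type*} [MeasurableSpace α] {f g : α → ℝ} (hf : Measurable f)
    (hg : Measurable g) : Measurable fun x => relEnt (f x) (g x) := by
  unfold relEnt; fun_prop

lemma BddMeas.relEnt {M : ℝ → ℝ} (hM : BddMeas M) (m : ℝ) :
    BddMeas (fun s => relEnt (M s) m) := by
  obtain ⟨C, hC⟩ := hM.bdd
  obtain ⟨D, hD⟩ := (isCompact_Icc (a := -C) (b := C)).exists_bound_of_continuousOn
    (continuous_relEnt m).continuousOn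
  exact ⟨(continuous_relEnt m).measurable.comp hM.meas, D, fun s => hD _ (abs_le.mp (hC s))⟩

lemma relax_affine {a M : ℝ → ℝ} (ha : BddMeas a) (hM : BddMeas M) (y p q : ℝ) {t : ℝ}
    (ht : 0 ≤ t) : p * relax a M y t + q = relax a (fun s => p * M s + q) (p * y + q) t := by
  have h1 := relax_const ha q ht
  have h2 : relax a (fun s => p * M s + q) (p * y + q) t =
      p * relax a M y t + relax a (fun _ => q) q t := by
    simp only [relax, linearSol_eq ha]
    have h3 : ∫ s in (0 : ℝ)..t, Real.exp (∫ τ in (0 : ℝ)..s, a τ) * (a s * (p * M s + q)) =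
        p * (∫ s in (0 : ℝ)..t, Real.exp (∫ τ in (0 : ℝ)..s, a τ) * (a s * M s)) +
        ∫ s in (0 : ℝ)..t, Real.exp (∫ τ in (0 : ℝ)..s, a τ) * (a s * q) := by
      rw [← intervalIntegral.integral_const_mul, ← intervalIntegral.integral_add
        ((ha.exp_mul_intervalIntegrable (ha.mul hM) _ _).const_mul p)
        (ha.exp_mul_intervalIntegrable (ha.mul (.const q)) _ _)]
      congr 1; ext s; ring
    rw [h3]; ring
  rw [h2, h1]

/-- Jensen's inequality for the relative entropy along a relaxation equation. -/
lemma relEnt_relax_le {a M : ℝ → ℝ} (ha : BddMeas a) (hM : BddMeas M) {y m t : ℝ} (hm : 0 < m)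
    (ht : 0 ≤ t) (ha0 : ∀ s ∈ Icc 0 t, 0 ≤ a s) (hy : 0 ≤ y) (hM0 : ∀ s ∈ Icc 0 t, 0 ≤ M s) :
    relEnt (relax a M y t) m ≤ relax a (fun s => relEnt (M s) m) (relEnt y m) t := by
  refine relEnt_le_of_forall (relax_nonneg ha hM ht ha0 hy hM0) hm fun g => ?_
  rw [sub_eq_add_neg, relax_affine ha hM _ _ _ ht]
  refine relax_mono ha ?_ (hM.relEnt m) ht ha0 ?_ fun s hs => ?_
  · exact ((BddMeas.const g).mul hM).add (.const _)
  · rw [← sub_eq_add_neg]; exact fenchel hy hm g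
  · rw [← sub_eq_add_neg]; exact fenchel (hM0 s hs) hm g

/-! ### The weight and the global Maxwellian -/

lemma weight_pos (β : ℝ) (v : R3) : 0 < weight β v :=
  Real.rpow_pos_of_pos (by positivity) _

lemma one_le_weight {β : ℝ} (hβ : 0 ≤ β) (v : R3) : 1 ≤ weight β v :=
  Real.one_le_rpow (by linarith [norm_nonneg v]) hβ

@[fun_prop]
lemma continuous_weight (β : ℝ) : Continuous (weight β) := by
  unfold weight
  exact (continuous_const.add continuous_norm).rpow_const fun v =>
    Or.inl (ne_of_gt (add_pos_of_pos_of_nonneg one_pos (norm_nonneg v)))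

@[fun_prop]
lemma measurable_weight (β : ℝ) : Measurable (weight β) := (continuous_weight β).measurable

@[fun_prop]
lemma continuous_maxwellian : Continuous maxwellian := by
  unfold maxwellian; fun_prop

@[fun_prop]
lemma measurable_maxwellian : Measurable maxwellian := continuous_maxwellian.measurable

lemma maxwellian_pos (v : R3) : 0 < maxwellian v := by unfold maxwellian; positivity

lemma log_maxwellian (v : R3) :
    Real.log (maxwellian v) = -(3 / 2 * Real.log (2 * Real.pi)) - ‖v‖ ^ 2 / 2 := by
  unfold maxwellian
  rw [Real.log_mul (by positivity) (Real.exp_pos _).ne', Real.log_exp, one_div, Real.log_inv,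
    Real.log_rpow (by positivity)]
  ring

lemma integrable_one_add_sq_div_weight {β : ℝ} (hβ : 5 < β) :
    Integrable fun v : R3 => (1 + ‖v‖ ^ 2) / weight β v := by
  have h := integrable_one_add_norm (E := R3) (μ := volume) (r := β - 2)
    (by simp only [finrank_euclideanSpace, Fintype.card_fin]; norm_num; linarith)
  refine h.mono' (Measurable.aestronglyMeasurable (by fun_prop)) (Filter.Eventually.of_forall fun v => ?_)
  have hv : (0 : ℝ) < 1 + ‖v‖ := by positivity
  rw [Real.norm_eq_abs, abs_of_nonneg (div_nonneg (by positivity) (weight_pos β v).le),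
    div_le_iff₀ (weight_pos β v), weight, ← Real.rpow_add hv]
  have : -(β - 2) + β = (2 : ℕ) := by push_cast; ring
  rw [this, Real.rpow_natCast]
  nlinarith [norm_nonneg v]

lemma integrable_inv_weight {β : ℝ} (hβ : 5 < β) : Integrable fun v : R3 => (weight β v)⁻¹ := by
  refine (integrable_one_add_sq_div_weight hβ).mono' (by fun_prop)
    (Filter.Eventually.of_forall fun v => ?_)
  rw [Real.norm_eq_abs, abs_of_pos (inv_pos.2 (weight_pos β v)), ← one_div]
  have := weight_pos β v
  gcongr
  nlinarith [sq_nonneg ‖v‖]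

/-- Gaussians decay faster than any power. -/
lemma exists_gaussian_le_weight (β : ℝ) (n : ℕ) {k : ℝ} (hk : 0 < k) :
    ∃ C : ℝ, 0 < C ∧ ∀ v : R3,
      (1 + ‖v‖ ^ 2) ^ n * Real.exp (-(k * ‖v‖ ^ 2)) ≤ C * (weight β v)⁻¹ := by
  obtain ⟨N, hN⟩ := exists_nat_ge (β + 2 * n)
  refine ⟨N.factorial * Real.exp (1 + 1 / (4 * k)), by positivity, fun v => ?_⟩
  set r := ‖v‖ with hr
  have hr0 : 0 ≤ r := norm_nonneg v
  rw [← div_eq_mul_inv, le_div_iff₀ (weight_pos β v)]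
  have h1 : (1 + r ^ 2) ^ n * weight β v ≤ (1 + r) ^ N := by
    calc (1 + r ^ 2) ^ n * weight β v ≤ ((1 + r) ^ 2) ^ n * (1 + r) ^ β := by
          rw [weight]; gcongr; nlinarith
      _ = (1 + r) ^ (β + 2 * n) := by
          rw [Real.rpow_add (by positivity), ← pow_mul, mul_comm]
          congr 1
          rw [← Real.rpow_natCast]; push_cast; ring_nf
      _ ≤ (1 + r) ^ (N : ℝ) := Real.rpow_le_rpow_of_exponent_le (by linarith) hN
      _ = _ := Real.rpow_natCast _ _
  have h2 : (1 + r) ^ N ≤ N.factorial * Real.exp (1 + r) := by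
    have := Real.pow_div_factorial_le_exp (1 + r) (by positivity) N
    rwa [div_le_iff₀ (by positivity), mul_comm] at this
  have h3 : Real.exp (1 + r) * Real.exp (-(k * r ^ 2)) ≤ Real.exp (1 + 1 / (4 * k)) := by
    rw [← Real.exp_add, Real.exp_le_exp]
    have : r ≤ k * r ^ 2 + 1 / (4 * k) := by
      have h4 : 0 ≤ (2 * k * r - 1) ^ 2 / (4 * k) := by positivity
      have h5 : (2 * k * r - 1) ^ 2 / (4 * k) = k * r ^ 2 - r + 1 / (4 * k) := by field_simp; ring
      linarith
    linarith
  calc _ = ((1 + r ^ 2) ^ n * weight β v) * Real.exp (-(k * r ^ 2)) := by ring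
    _ ≤ (N.factorial * Real.exp (1 + r)) * Real.exp (-(k * r ^ 2)) := by
      refine mul_le_mul_of_nonneg_right (h1.trans h2) (Real.exp_pos _).le
    _ = N.factorial * (Real.exp (1 + r) * Real.exp (-(k * r ^ 2))) := by ring
    _ ≤ _ := by gcongr

lemma maxwellian_le_exp (v : R3) : maxwellian v ≤ Real.exp (-(1 / 2 * ‖v‖ ^ 2)) := by
  unfold maxwellian
  have h1 : (1 : ℝ) ≤ (2 * Real.pi) ^ (3 / 2 : ℝ) :=
    Real.one_le_rpow (by nlinarith [Real.pi_gt_three]) (by norm_num)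
  have h2 : 1 / (2 * Real.pi) ^ (3 / 2 : ℝ) ≤ 1 := by rw [div_le_one (by positivity)]; exact h1
  calc _ ≤ 1 * Real.exp (-(‖v‖ ^ 2 / 2)) := by gcongr
    _ = _ := by rw [one_mul]; congr 1; ring

/-- The kernel `κ = μ (1 + |v|²)² exp ((1 + |v|²) / 4)` that controls moments by entropy. -/
def entKernel (v : R3) : ℝ :=
  maxwellian v * (1 + ‖v‖ ^ 2) ^ 2 * Real.exp ((1 + ‖v‖ ^ 2) / 4)

lemma entKernel_nonneg (v : R3) : 0 ≤ entKernel v := by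
  have := maxwellian_pos v
  unfold entKernel; positivity

@[fun_prop]
lemma continuous_entKernel : Continuous entKernel := by unfold entKernel; fun_prop

lemma exists_entKernel_le (β : ℝ) : ∃ C : ℝ, 0 < C ∧ ∀ v, entKernel v ≤ C * (weight β v)⁻¹ := by
  obtain ⟨C, hC, h⟩ := exists_gaussian_le_weight β 2 (k := 1 / 4) (by norm_num)
  refine ⟨Real.exp (1 / 4) * C, by positivity, fun v => ?_⟩
  calc entKernel v ≤ Real.exp (-(1 / 2 * ‖v‖ ^ 2)) * (1 + ‖v‖ ^ 2) ^ 2 *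
        Real.exp ((1 + ‖v‖ ^ 2) / 4) := by
        unfold entKernel; gcongr; exact maxwellian_le_exp v
    _ = Real.exp (1 / 4) * ((1 + ‖v‖ ^ 2) ^ 2 * Real.exp (-(1 / 4 * ‖v‖ ^ 2))) := by
        have : Real.exp (-(1 / 2 * ‖v‖ ^ 2)) * Real.exp ((1 + ‖v‖ ^ 2) / 4) =
            Real.exp (1 / 4) * Real.exp (-(1 / 4 * ‖v‖ ^ 2)) := by
          rw [← Real.exp_add, ← Real.exp_add]; ring_nf
        linear_combination ((1 + ‖v‖ ^ 2) ^ 2) * this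
    _ ≤ Real.exp (1 / 4) * (C * (weight β v)⁻¹) :=
        mul_le_mul_of_nonneg_left (h v) (Real.exp_pos _).le
    _ = _ := by ring

lemma integrable_entKernel : Integrable entKernel := by
  obtain ⟨C, _, h⟩ := exists_entKernel_le 6
  refine ((integrable_inv_weight (β := 6) (by norm_num)).const_mul C).mono' (by fun_prop)
    (Filter.Eventually.of_forall fun v => ?_)
  rw [Real.norm_eq_abs, abs_of_nonneg (entKernel_nonneg v)]
  exact h v

/-- Quadratic moments of a deviation from `μ` are controlled by relative entropy, linearly with a
large constant up to a small error. -/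
lemma moment_le_relEnt {z : ℝ} (hz : 0 ≤ z) (v : R3) {l : ℝ} (hl : 0 < l) (hl' : l ≤ 1 / 4) :
    (1 + ‖v‖ ^ 2) * |z - maxwellian v| ≤ l⁻¹ * relEnt z (maxwellian v) + l * entKernel v := by
  set p := 1 + ‖v‖ ^ 2 with hp
  have hp0 : 0 < p := by positivity
  have hm := maxwellian_pos v
  set m := maxwellian v
  have key : ∀ g : ℝ, |g| = l * p →
      g * (z - m) ≤ relEnt z m + l ^ 2 * entKernel v := by
    intro g hg
    have h1 := fenchel hz hm g
    have h2 := exp_sub_one_sub_le g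
    have h3 : Real.exp |g| ≤ Real.exp (p / 4) := by
      rw [hg]; gcongr; nlinarith
    have h4 : g ^ 2 = l ^ 2 * p ^ 2 := by rw [← sq_abs, hg]; ring
    have h5 : m * (Real.exp g - 1 - g) ≤ l ^ 2 * entKernel v := by
      calc m * (Real.exp g - 1 - g) ≤ m * (g ^ 2 * Real.exp (p / 4)) := by
            gcongr; exact h2.trans (by gcongr)
        _ = _ := by rw [h4, entKernel]; ring
    nlinarith
  have h1 : l * p * |z - m| ≤ relEnt z m + l ^ 2 * entKernel v := by
    rcases le_total 0 (z - m) with h | h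
    · rw [abs_of_nonneg h]; exact key _ (abs_of_pos (by positivity))
    · rw [abs_of_nonpos h, mul_neg, ← neg_mul]
      exact key _ (by rw [abs_neg, abs_of_pos (by positivity)])
  have h2 : p * |z - m| = l⁻¹ * (l * p * |z - m|) := by field_simp
  rw [h2]
  calc _ ≤ l⁻¹ * (relEnt z m + l ^ 2 * entKernel v) := by gcongr
    _ = _ := by field_simp

/-! ### Gaussian integrals -/

lemma exists_diagonalization {S : Matrix (Fin 3) (Fin 3) ℝ} (hS : S.PosDef) :
    ∃ (U : Matrix (Fin 3) (Fin 3) ℝ) (l : Fin 3 → ℝ), U * Uᵀ = 1 ∧ (∀ i, 0 < l i) ∧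
      S = U * Matrix.diagonal l * Uᵀ := by
  refine ⟨hS.1.eigenvectorUnitary, hS.1.eigenvalues, ?_, hS.eigenvalues_pos, ?_⟩
  · have := (Matrix.mem_unitaryGroup_iff).1 hS.1.eigenvectorUnitary.2
    simpa [Matrix.star_eq_conjTranspose] using this
  · have := hS.1.spectral_theorem
    simpa [Unitary.conjStarAlgAut_apply, Matrix.star_eq_conjTranspose, Function.comp_def] using this

lemma integral_pdf_mul_pow (n : ℕ) (hn : n ≤ 2) :
    ∫ x : ℝ, x ^ n * ProbabilityTheory.gaussianPDFReal 0 1 x = if n = 1 then 0 else 1 := by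
  have h : ∀ f : ℝ → ℝ, ∫ x : ℝ, f x * ProbabilityTheory.gaussianPDFReal 0 1 x =
      ∫ x, f x ∂ProbabilityTheory.gaussianReal 0 1 := fun f => by
    rw [ProbabilityTheory.integral_gaussianReal_eq_integral_smul one_ne_zero]
    simp [mul_comm]
  rw [h]
  interval_cases n
  · simp
  · simp
  · have := ProbabilityTheory.variance_id_gaussianReal (μ := 0) (v := 1)
    rw [ProbabilityTheory.variance_eq_integral (by fun_prop)] at this
    simpa using this

lemma maxwellian_toLp (x : Fin 3 → ℝ) :
    maxwellian (WithLp.toLp 2 x) = ∏ i, ProbabilityTheory.gaussianPDFReal 0 1 (x i) := by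
  simp only [maxwellian, ProbabilityTheory.gaussianPDFReal_def, Finset.prod_mul_distrib,
    ← Real.exp_sum, EuclideanSpace.norm_sq_eq]
  congr 1
  · have : (2 * Real.pi : ℝ) ^ (3 / 2 : ℝ) = √(2 * Real.pi) ^ 3 := by
      rw [Real.sqrt_eq_rpow, ← Real.rpow_natCast, ← Real.rpow_mul (by positivity)]; norm_num
    simp [this]
    ring
  · congr 1
    simp only [Fin.sum_univ_three, Real.norm_eq_abs, sq_abs]
    simp; ring

lemma integral_monomial_maxwellian (e : Fin 3 → ℕ) (he : ∀ i, e i ≤ 2) :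
    ∫ v : R3, (∏ i, v i ^ e i) * maxwellian v = ∏ i, if e i = 1 then 0 else 1 := by
  rw [← (PiLp.volume_preserving_toLp (Fin 3)).integral_comp
    (MeasurableEquiv.toLp 2 (Fin 3 → ℝ)).measurableEmbedding]
  simp only [maxwellian_toLp, ← Finset.prod_mul_distrib]
  rw [integral_fintype_prod_volume_eq_prod
    (f := fun i x => x ^ e i * ProbabilityTheory.gaussianPDFReal 0 1 x)]
  exact Finset.prod_congr rfl fun i _ => integral_pdf_mul_pow _ (he i)

lemma integral_maxwellian : ∫ v : R3, maxwellian v = 1 := by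
  simpa using integral_monomial_maxwellian (fun _ => 0) (by simp)

lemma integral_coord_maxwellian (i : Fin 3) : ∫ v : R3, v i * maxwellian v = 0 := by
  have := integral_monomial_maxwellian (fun k => if k = i then 1 else 0)
    (fun k => by split_ifs <;> simp)
  fin_cases i <;> simpa [Fin.prod_univ_three] using this

lemma integral_coord_mul_coord_maxwellian (i j : Fin 3) :
    ∫ v : R3, v i * v j * maxwellian v = if i = j then 1 else 0 := by
  have := integral_monomial_maxwellian
    (fun k => (if k = i then 1 else 0) + (if k = j then 1 else 0))
    (fun k => by split_ifs <;> simp)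
  have e : ∀ v : R3, v i * v j =
      ∏ k, v k ^ ((if k = i then 1 else 0) + (if k = j then 1 else 0)) := fun v => by
    fin_cases i <;> fin_cases j <;> simp [Fin.prod_univ_three] <;> ring
  simp_rw [e, this]
  fin_cases i <;> fin_cases j <;> simp [Fin.prod_univ_three]

/-- The normalized Gaussian with mean `u` and covariance `S`. -/
def gaussian (S : Matrix (Fin 3) (Fin 3) ℝ) (u v : R3) : ℝ :=
  (√((2 * Real.pi) • S).det)⁻¹ * Real.exp (-(1 / 2) * ((v - u).ofLp ⬝ᵥ (S⁻¹ *ᵥ (v - u).ofLp)))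

lemma exists_sq_root {S : Matrix (Fin 3) (Fin 3) ℝ} (hS : S.PosDef) :
    ∃ C : Matrix (Fin 3) (Fin 3) ℝ, S = C * Cᵀ ∧ C.det ≠ 0 := by
  obtain ⟨U, l, hU, hl, rfl⟩ := exists_diagonalization hS
  have h : U * Matrix.diagonal l * Uᵀ = U * Matrix.diagonal (fun i => √(l i)) *
      (U * Matrix.diagonal (fun i => √(l i)))ᵀ := by
    have hd : Matrix.diagonal l =
        Matrix.diagonal (fun i => √(l i)) * Matrix.diagonal (fun i => √(l i)) := by
      rw [Matrix.diagonal_mul_diagonal]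
      congr 1; ext i; exact (Real.mul_self_sqrt (hl i).le).symm
    rw [Matrix.transpose_mul, Matrix.diagonal_transpose, hd]
    simp only [Matrix.mul_assoc]
  refine ⟨_, h, fun h0 => ?_⟩
  have := hS.det_pos
  rw [h, Matrix.det_mul, h0] at this
  simp at this

lemma gaussian_comp {C : Matrix (Fin 3) (Fin 3) ℝ} (hC : C.det ≠ 0) (u z : R3) :
    |C.det| * gaussian (C * Cᵀ) u (u + Matrix.toEuclideanLin C z) = maxwellian z := by
  have h1 : (u + Matrix.toEuclideanLin C z - u).ofLp = C *ᵥ z.ofLp := by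
    rw [add_sub_cancel_left]; rfl
  have hu : IsUnit C.det := hC.isUnit
  have h2 : (C *ᵥ z.ofLp) ⬝ᵥ ((C * Cᵀ)⁻¹ *ᵥ (C *ᵥ z.ofLp)) = ‖z‖ ^ 2 := by
    rw [Matrix.mul_inv_rev, Matrix.mulVec_mulVec, Matrix.mul_assoc, Matrix.nonsing_inv_mul _ hu,
      Matrix.mul_one, Matrix.dotProduct_mulVec, ← Matrix.mulVec_transpose,
      Matrix.transpose_nonsing_inv, Matrix.transpose_transpose, Matrix.mulVec_mulVec,
      Matrix.nonsing_inv_mul _ hu, Matrix.one_mulVec, EuclideanSpace.norm_sq_eq]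
    simp [dotProduct, sq]
  have h3 : √((2 * Real.pi) • (C * Cᵀ)).det = (2 * Real.pi) ^ (3 / 2 : ℝ) * |C.det| := by
    rw [Matrix.det_smul, Matrix.det_mul, Matrix.det_transpose, ← sq, Fintype.card_fin,
      Real.sqrt_mul (by positivity), Real.sqrt_sq_eq_abs, Real.sqrt_eq_rpow, ← Real.rpow_natCast,
      ← Real.rpow_mul (by positivity)]
    norm_num
  rw [gaussian, h1, h2, h3, maxwellian]
  have : |C.det| ≠ 0 := abs_ne_zero.2 hC
  field_simp

lemma gaussian_change_of_variables {C : Matrix (Fin 3) (Fin 3) ℝ} (hC : C.det ≠ 0) (u : R3)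
    (g : R3 → ℝ) :
    (Integrable (fun v => g v * gaussian (C * Cᵀ) u v) ↔
      Integrable fun z => g (u + Matrix.toEuclideanLin C z) * maxwellian z) ∧
    ∫ v, g v * gaussian (C * Cᵀ) u v =
      ∫ z, g (u + Matrix.toEuclideanLin C z) * maxwellian z := by
  set L := LinearMap.toContinuousLinearMap (Matrix.toEuclideanLin C) with hL
  have hdet : L.det = C.det := by
    change LinearMap.det (Matrix.toEuclideanLin C) = _
    rw [Matrix.toEuclideanLin, Matrix.toLpLin_eq_toLin, LinearMap.det_toLin]
  have hder : ∀ x ∈ (univ : Set R3), HasFDerivWithinAt (fun z => u + L z) L univ x :=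
    fun x _ => (L.hasFDerivAt.const_add u).hasFDerivWithinAt
  have hbij : Function.Bijective L := by
    have : IsUnit (LinearMap.det (Matrix.toEuclideanLin C)) := by
      rw [Matrix.toEuclideanLin, Matrix.toLpLin_eq_toLin, LinearMap.det_toLin]; exact hC.isUnit
    exact (Module.End.isUnit_iff _).1 ((LinearMap.isUnit_iff_isUnit_det _).2 this)
  have hinj : InjOn (fun z => u + L z) univ :=
    ((add_right_injective u).comp hbij.1).injOn
  have himg : (fun z => u + L z) '' univ = univ := by
    rw [image_univ]; exact ((Equiv.addLeft u).surjective.comp hbij.2).range_eq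
  have hfun : ∀ z, |L.det| • (g (u + L z) * gaussian (C * Cᵀ) u (u + L z)) =
      g (u + Matrix.toEuclideanLin C z) * maxwellian z := fun z => by
    rw [← gaussian_comp hC u z, hdet, smul_eq_mul]
    change _ * (g (u + L z) * gaussian (C * Cᵀ) u (u + L z)) = g (u + L z) * (_ * gaussian _ u (u + L z))
    ring
  constructor
  · have := integrableOn_image_iff_integrableOn_abs_det_fderiv_smul volume MeasurableSet.univ hder
      hinj (fun v => g v * gaussian (C * Cᵀ) u v)
    rw [himg, integrableOn_univ, integrableOn_univ] at this
    rw [this]; simp only [hfun]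
  · have := integral_image_eq_integral_abs_det_fderiv_smul volume MeasurableSet.univ hder
      hinj (fun v => g v * gaussian (C * Cᵀ) u v)
    rw [himg, setIntegral_univ, setIntegral_univ] at this
    rw [this]; simp only [hfun]

lemma integrable_mul_maxwellian {g : R3 → ℝ} (hg : Continuous g) {c : ℝ}
    (hc : ∀ v, |g v| ≤ c * (1 + ‖v‖ ^ 2)) : Integrable fun v => g v * maxwellian v := by
  obtain ⟨C, _, h⟩ := exists_gaussian_le_weight 6 1 (k := 1 / 2) (by norm_num)
  have hc0 : 0 ≤ c := by have := (abs_nonneg _).trans (hc 0); simpa using this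
  refine ((integrable_inv_weight (β := 6) (by norm_num)).const_mul (c * C)).mono' (by fun_prop)
    (Filter.Eventually.of_forall fun v => ?_)
  rw [Real.norm_eq_abs, abs_mul, abs_of_pos (maxwellian_pos v), mul_assoc]
  have h1 := h v
  rw [pow_one] at h1
  calc |g v| * maxwellian v ≤ (c * (1 + ‖v‖ ^ 2)) * Real.exp (-(1 / 2 * ‖v‖ ^ 2)) :=
        mul_le_mul (hc v) (maxwellian_le_exp v) (maxwellian_pos v).le (by positivity)
    _ = c * ((1 + ‖v‖ ^ 2) * Real.exp (-(1 / 2 * ‖v‖ ^ 2))) := by ring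
    _ ≤ _ := by gcongr

lemma abs_coord_le (v : R3) (i : Fin 3) : |v i| ≤ ‖v‖ := by
  simpa using PiLp.norm_apply_le v i

lemma abs_coord_le_one_add_sq (v : R3) (i : Fin 3) : |v i| ≤ 1 * (1 + ‖v‖ ^ 2) := by
  nlinarith [abs_coord_le v i, sq_nonneg (‖v‖ - 1)]

lemma abs_coord_mul_coord_le (v : R3) (i j : Fin 3) : |v i * v j| ≤ 1 * (1 + ‖v‖ ^ 2) := by
  rw [abs_mul]
  nlinarith [mul_le_mul (abs_coord_le v i) (abs_coord_le v j) (abs_nonneg _) (norm_nonneg v)]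

lemma integrable_maxwellian : Integrable maxwellian := by
  simpa using integrable_mul_maxwellian (g := fun _ => 1) continuous_const (c := 1)
    (fun v => by rw [abs_one]; nlinarith [sq_nonneg ‖v‖])

/-- Zeroth, first and second centred moments of a Gaussian. -/
lemma gaussian_moments {S : Matrix (Fin 3) (Fin 3) ℝ} (hS : S.PosDef) (u : R3) :
    (Integrable (gaussian S u) ∧ ∫ v, gaussian S u v = 1) ∧
    (∀ i, Integrable (fun v : R3 => (v - u) i * gaussian S u v) ∧
      ∫ v : R3, (v - u) i * gaussian S u v = 0) ∧
    ∀ i j, Integrable (fun v : R3 => (v - u) i * (v - u) j * gaussian S u v) ∧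
      ∫ v : R3, (v - u) i * (v - u) j * gaussian S u v = S i j := by
  obtain ⟨C, rfl, hC⟩ := exists_sq_root hS
  have hcoord : ∀ z i, (u + Matrix.toEuclideanLin C z - u) i = ∑ k, C i k * z k := fun z i => by
    rw [add_sub_cancel_left]; rfl
  have hi1 : ∀ i, Integrable fun z : R3 => z i * maxwellian z := fun i =>
    integrable_mul_maxwellian (by fun_prop) (fun v => abs_coord_le_one_add_sq v i)
  have hi2 : ∀ i j, Integrable fun z : R3 => z i * z j * maxwellian z := fun i j =>
    integrable_mul_maxwellian (by fun_prop) (fun v => abs_coord_mul_coord_le v i j)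
  refine ⟨?_, fun i => ?_, fun i j => ?_⟩
  · have h := gaussian_change_of_variables hC u (fun _ => 1)
    simp only [one_mul] at h
    exact ⟨h.1.2 integrable_maxwellian, h.2.trans integral_maxwellian⟩
  · have h := gaussian_change_of_variables hC u (fun v => (v - u) i)
    simp only [hcoord, Finset.sum_mul, mul_assoc] at h
    refine ⟨h.1.2 (integrable_finsetSum _ fun k _ => (hi1 k).const_mul _), h.2.trans ?_⟩
    rw [integral_finsetSum _ fun k _ => (hi1 k).const_mul _]
    simp [integral_const_mul, integral_coord_maxwellian]
  · have h := gaussian_change_of_variables hC u (fun v => (v - u) i * (v - u) j)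
    have e : ∀ z : R3, (u + Matrix.toEuclideanLin C z - u) i * (u + Matrix.toEuclideanLin C z - u) j
        * maxwellian z = ∑ k, ∑ l, C i k * C j l * (z k * z l * maxwellian z) := fun z => by
      rw [hcoord, hcoord, Finset.sum_mul_sum, Finset.sum_mul]
      refine Finset.sum_congr rfl fun k _ => ?_
      rw [Finset.sum_mul]
      refine Finset.sum_congr rfl fun l _ => by ring
    simp only [e] at h
    have hi : ∀ k, Integrable fun z : R3 => ∑ l, C i k * C j l * (z k * z l * maxwellian z) :=
      fun k => integrable_finsetSum _ fun l _ => (hi2 k l).const_mul _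
    refine ⟨h.1.2 (integrable_finsetSum _ fun k _ => hi k), h.2.trans ?_⟩
    rw [integral_finsetSum _ fun k _ => hi k]
    simp_rw [integral_finsetSum _ fun l _ => (hi2 _ l).const_mul _, integral_const_mul,
      integral_coord_mul_coord_maxwellian]
    simp [Matrix.mul_apply]

lemma maxwellian_eq_gaussian (v : R3) : maxwellian v = gaussian 1 0 v := by
  have := gaussian_comp (C := 1) (by simp) 0 v
  simpa [Matrix.toEuclideanLin, Matrix.toLpLin_one] using this.symm

/-! ### Velocity moments -/

/-- Index set of the extended velocity `(1, v)`. -/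
abbrev Idx : Type := Option (Fin 3)

/-- The space of moment matrices `∫ (1, v) ⊗ (1, v) f dv`, with the Hilbert–Schmidt norm. -/
abbrev Mom : Type := EuclideanSpace ℝ (Idx × Idx)

/-- The extended velocity `(1, v)`. -/
def extVel (v : R3) : Idx → ℝ
  | none => 1
  | some i => v i

/-- The moment matrix `∫ (1, v) ⊗ (1, v) f dv` of a velocity profile. -/
def moments (f : R3 → ℝ) : Mom :=
  WithLp.toLp 2 fun p => ∫ v, extVel v p.1 * extVel v p.2 * f v

@[simp] lemma moments_apply (f : R3 → ℝ) (p : Idx × Idx) :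
    moments f p = ∫ v, extVel v p.1 * extVel v p.2 * f v := rfl

@[fun_prop]
lemma continuous_extVel (a : Idx) : Continuous fun v : R3 => extVel v a := by
  cases a <;> simp only [extVel] <;> fun_prop

@[fun_prop]
lemma measurable_extVel (a : Idx) : Measurable fun v : R3 => extVel v a :=
  (continuous_extVel a).measurable

lemma abs_extVel_mul_le (v : R3) (a b : Idx) : |extVel v a * extVel v b| ≤ 1 * (1 + ‖v‖ ^ 2) := by
  rcases a with _ | i <;> rcases b with _ | j <;> simp only [extVel]
  · rw [mul_one, abs_one]; nlinarith [sq_nonneg ‖v‖]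
  · rw [one_mul]; exact abs_coord_le_one_add_sq v j
  · rw [mul_one]; exact abs_coord_le_one_add_sq v i
  · exact abs_coord_mul_coord_le v i j

/-- Finite mass and energy. -/
def FiniteEnergy (f : R3 → ℝ) : Prop := Integrable fun v : R3 => (1 + ‖v‖ ^ 2) * f v

lemma FiniteEnergy.integrable_mul {f : R3 → ℝ} (hf : FiniteEnergy f) {g : R3 → ℝ}
    (hg : Continuous g) {c : ℝ} (hc : ∀ v, |g v| ≤ c * (1 + ‖v‖ ^ 2)) :
    Integrable fun v => g v * f v := by
  have h := Integrable.bdd_mul (c := c) hf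
    (f := fun v : R3 => g v / (1 + ‖v‖ ^ 2)) (Continuous.aestronglyMeasurable (by
      have : ∀ v : R3, 1 + ‖v‖ ^ 2 ≠ 0 := fun v => by positivity
      fun_prop (disch := assumption)))
    (Filter.Eventually.of_forall fun v => by
      have : 0 < 1 + ‖v‖ ^ 2 := by positivity
      rw [Real.norm_eq_abs, abs_div, abs_of_pos this, div_le_iff₀ this]; exact hc v)
  refine h.congr (Filter.Eventually.of_forall fun v => ?_)
  have : 1 + ‖v‖ ^ 2 ≠ 0 := by positivity
  simp only; field_simp

lemma FiniteEnergy.integrable_extVel {f : R3 → ℝ} (hf : FiniteEnergy f) (a b : Idx) :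
    Integrable fun v => extVel v a * extVel v b * f v :=
  hf.integrable_mul (by fun_prop) (fun v => abs_extVel_mul_le v a b)

lemma FiniteEnergy.integrable {f : R3 → ℝ} (hf : FiniteEnergy f) : Integrable f := by
  simpa [extVel] using hf.integrable_extVel none none

lemma finiteEnergy_maxwellian : FiniteEnergy maxwellian :=
  integrable_mul_maxwellian (c := 1) (by fun_prop) fun v => by
    rw [abs_of_nonneg (by positivity), one_mul]

lemma FiniteEnergy.sub {f g : R3 → ℝ} (hf : FiniteEnergy f) (hg : FiniteEnergy g) :
    FiniteEnergy fun v => f v - g v := by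
  unfold FiniteEnergy
  simp only [mul_sub]
  exact Integrable.sub hf hg

lemma FiniteEnergy.moments_sub {f g : R3 → ℝ} (hf : FiniteEnergy f) (hg : FiniteEnergy g) :
    moments (fun v => f v - g v) = moments f - moments g := by
  ext p
  simp only [moments_apply, PiLp.sub_apply, mul_sub]
  exact integral_sub (hf.integrable_extVel _ _) (hg.integrable_extVel _ _)

lemma norm_le_sum_abs {ι : Type*} [Fintype ι] (m : EuclideanSpace ℝ ι) : ‖m‖ ≤ ∑ p, |m p| := by
  rw [EuclideanSpace.norm_eq]
  refine Real.sqrt_le_iff.2 ⟨Finset.sum_nonneg fun _ _ => abs_nonneg _, ?_⟩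
  exact Finset.sum_sq_le_sq_sum_of_nonneg fun _ _ => abs_nonneg _

lemma abs_apply_le_norm {ι : Type*} [Fintype ι] (m : EuclideanSpace ℝ ι) (p : ι) : |m p| ≤ ‖m‖ := by
  simpa using PiLp.norm_apply_le m p

/-- The moment matrix is bounded by the total mass and energy. -/
lemma norm_moments_le {f g : R3 → ℝ} (hg : Integrable g)
    (h : ∀ᵐ v, (1 + ‖v‖ ^ 2) * |f v| ≤ g v) : ‖moments f‖ ≤ 16 * ∫ v, g v := by
  refine (norm_le_sum_abs _).trans ?_
  have : ∀ p, |moments f p| ≤ ∫ v, g v := fun p => by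
    rw [moments_apply, ← Real.norm_eq_abs]
    refine norm_integral_le_of_norm_le hg ?_
    filter_upwards [h] with v hv
    rw [Real.norm_eq_abs, abs_mul]
    refine le_trans ?_ hv
    have := abs_extVel_mul_le v p.1 p.2
    rw [one_mul] at this
    gcongr
  calc ∑ p, |moments f p| ≤ ∑ _p : Idx × Idx, ∫ v, g v := Finset.sum_le_sum fun p _ => this p
    _ = _ := by simp

/-- Density of a moment matrix. -/
def momDensity (m : Mom) : ℝ := m (none, none)

/-- Bulk velocity of a moment matrix. -/
def momVel (m : Mom) : R3 := (momDensity m)⁻¹ • WithLp.toLp 2 fun i => m (none, some i)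

/-- Stress tensor of a moment matrix. -/
def momStress (m : Mom) : Matrix (Fin 3) (Fin 3) ℝ :=
  Matrix.of fun i j => (momDensity m)⁻¹ * m (some i, some j) - momVel m i * momVel m j

/-- Temperature of a moment matrix. -/
def momTemp (m : Mom) : ℝ := (∑ i, momStress m i i) / 3

/-- Temperature tensor of a moment matrix. -/
def momTensor (ν : ℝ) (m : Mom) : Matrix (Fin 3) (Fin 3) ℝ :=
  ((1 - ν) * momTemp m) • (1 : Matrix (Fin 3) (Fin 3) ℝ) + ν • momStress m

/-- Collision frequency of a moment matrix. -/
def momFreq (ν : ℝ) (m : Mom) : ℝ := momDensity m * momTemp m / (1 - ν)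

/-- Anisotropic Gaussian of a moment matrix. -/
def momGauss (ν : ℝ) (m : Mom) (v : R3) : ℝ :=
  momDensity m * gaussian (momTensor ν m) (momVel m) v

lemma density_eq (f : R3 → ℝ) : density f = momDensity (moments f) := by
  simp [density, momDensity, extVel]

lemma coord_integral {f : R3 → ℝ} (hf : FiniteEnergy f) (i : Fin 3) :
    (∫ v : R3, f v • v) i = ∫ v : R3, v i * f v := by
  have hint : Integrable fun v : R3 => f v • v := by
    have h : Integrable fun v : R3 => ∑ i : Fin 3, (v i * f v) • EuclideanSpace.single i (1 : ℝ) :=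
      integrable_finsetSum _ fun i _ => (by
        simpa [extVel] using hf.integrable_extVel none (some i) :
          Integrable fun v : R3 => v i * f v).smul_const _
    refine h.congr (Filter.Eventually.of_forall fun v => ?_)
    ext j
    fin_cases j <;> simp [Fin.sum_univ_three, mul_comm]
  have : ∫ v : R3, (f v • v) i = (∫ v : R3, f v • v) i :=
    (EuclideanSpace.proj (𝕜 := ℝ) i).integral_comp_comm hint
  rw [← this]
  simp [mul_comm]

lemma bulkVelocity_eq {f : R3 → ℝ} (hf : FiniteEnergy f) :
    bulkVelocity f = momVel (moments f) := by
  ext i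
  simp only [bulkVelocity, momVel, density_eq, PiLp.smul_apply, coord_integral hf, moments_apply,
    extVel, one_mul]

lemma FiniteEnergy.integral_quadratic {f : R3 → ℝ} (hf : FiniteEnergy f) (u : R3) (i j : Fin 3) :
    Integrable (fun v : R3 => (v - u) i * (v - u) j * f v) ∧
    ∫ v : R3, (v - u) i * (v - u) j * f v = moments f (some i, some j)
      - u i * moments f (none, some j) - u j * moments f (none, some i)
      + u i * u j * moments f (none, none) := by
  have h1 := hf.integrable_extVel (some i) (some j)
  have h2 := (hf.integrable_extVel none (some j)).const_mul (u i)
  have h3 := (hf.integrable_extVel none (some i)).const_mul (u j)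
  have h4 := (hf.integrable_extVel none none).const_mul (u i * u j)
  have e : (fun v : R3 => (v - u) i * (v - u) j * f v) = fun v =>
      extVel v (some i) * extVel v (some j) * f v - u i * (extVel v none * extVel v (some j) * f v)
        - u j * (extVel v none * extVel v (some i) * f v)
        + u i * u j * (extVel v none * extVel v none * f v) := by
    ext v; simp only [extVel, PiLp.sub_apply]; ring
  rw [e]
  refine ⟨((h1.sub h2).sub h3).add h4, ?_⟩
  have e1 := integral_add ((h1.sub h2).sub h3) h4
  have e2 := integral_sub (h1.sub h2) h3
  have e3 := integral_sub h1 h2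
  simp only [Pi.sub_apply] at e1 e2 e3
  rw [e1, e2, e3]
  simp only [integral_const_mul, moments_apply]

lemma stressTensor_eq {f : R3 → ℝ} (hf : FiniteEnergy f) (h0 : momDensity (moments f) ≠ 0) :
    stressTensor f = momStress (moments f) := by
  ext i j
  simp only [stressTensor, Matrix.of_apply, momStress, density_eq, bulkVelocity_eq hf]
  rw [(hf.integral_quadratic _ i j).2]
  simp only [momVel, PiLp.smul_apply, smul_eq_mul, momDensity] at *
  field_simp
  ring

lemma norm_sq_eq_sum (v : R3) : ‖v‖ ^ 2 = ∑ i, v i * v i := by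
  rw [EuclideanSpace.norm_sq_eq]; simp [sq]

lemma temperature_eq_trace {f : R3 → ℝ} (hf : FiniteEnergy f) :
    temperature f = (∑ i, stressTensor f i i) / 3 := by
  simp only [temperature, stressTensor, Matrix.of_apply, norm_sq_eq_sum, Finset.sum_mul]
  rw [integral_finsetSum _ fun i _ => (hf.integral_quadratic _ i i).1, ← Finset.mul_sum, mul_inv]
  ring

lemma temperature_eq {f : R3 → ℝ} (hf : FiniteEnergy f) (h0 : momDensity (moments f) ≠ 0) :
    temperature f = momTemp (moments f) := by
  rw [temperature_eq_trace hf, stressTensor_eq hf h0, momTemp]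

lemma temperatureTensor_eq {f : R3 → ℝ} (hf : FiniteEnergy f) (h0 : momDensity (moments f) ≠ 0)
    (ν : ℝ) : temperatureTensor ν f = momTensor ν (moments f) := by
  rw [temperatureTensor, momTensor, temperature_eq hf h0, stressTensor_eq hf h0]

lemma collisionFrequency_eq {f : R3 → ℝ} (hf : FiniteEnergy f) (h0 : momDensity (moments f) ≠ 0)
    (ν : ℝ) : collisionFrequency ν f = momFreq ν (moments f) := by
  rw [collisionFrequency, momFreq, temperature_eq hf h0, density_eq]

lemma anisotropicGaussian_eq {f : R3 → ℝ} (hf : FiniteEnergy f)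
    (h0 : momDensity (moments f) ≠ 0) (ν : ℝ) (v : R3) :
    anisotropicGaussian ν f v = momGauss ν (moments f) v := by
  rw [anisotropicGaussian, momGauss, gaussian, temperatureTensor_eq hf h0, density_eq,
    bulkVelocity_eq hf, div_eq_mul_inv, mul_assoc]

/-! ### Entropy inequality for the relaxation operator -/

lemma det_le_det_of_diagonal {ν : ℝ} (hν : -1 / 2 < ν) (hν' : ν < 1) {a b c : ℝ} (ha : 0 < a)
    (hb : 0 < b) (hc : 0 < c) :
    a * b * c ≤ ((1 - ν) * ((a + b + c) / 3) + ν * a) * ((1 - ν) * ((a + b + c) / 3) + ν * b) *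
      ((1 - ν) * ((a + b + c) / 3) + ν * c) := by
  set p := (1 + 2 * ν) / 3 with hp
  set q := (1 - ν) / 3 with hq
  have hp0 : 0 ≤ p := by rw [hp]; linarith
  have hq0 : 0 ≤ q := by rw [hq]; linarith
  have hpq : p + q + q = 1 := by rw [hp, hq]; ring
  have h1 := Real.geom_mean_le_arith_mean3_weighted hp0 hq0 hq0 ha.le hb.le hc.le hpq
  have h2 := Real.geom_mean_le_arith_mean3_weighted hp0 hq0 hq0 hb.le hc.le ha.le hpq
  have h3 := Real.geom_mean_le_arith_mean3_weighted hp0 hq0 hq0 hc.le ha.le hb.le hpq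
  have e : a * b * c = (a ^ p * b ^ q * c ^ q) * (b ^ p * c ^ q * a ^ q) *
      (c ^ p * a ^ q * b ^ q) := by
    have h : ∀ x : ℝ, 0 < x → x ^ p * x ^ q * x ^ q = x := fun x hx => by
      rw [← Real.rpow_add hx, ← Real.rpow_add hx, hpq, Real.rpow_one]
    nth_rewrite 1 [← h a ha, ← h b hb, ← h c hc]
    ring
  rw [e]
  have e1 : (1 - ν) * ((a + b + c) / 3) + ν * a = p * a + q * b + q * c := by rw [hp, hq]; ring
  have e2 : (1 - ν) * ((a + b + c) / 3) + ν * b = p * b + q * c + q * a := by rw [hp, hq]; ring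
  have e3 : (1 - ν) * ((a + b + c) / 3) + ν * c = p * c + q * a + q * b := by rw [hp, hq]; ring
  rw [e1, e2, e3]
  gcongr

/-- The temperature tensor has a larger determinant than the stress tensor: its eigenvalues are
averages, with nonnegative weights `(1 + 2ν) / 3, (1 - ν) / 3, (1 - ν) / 3`, of those of the stress
tensor. -/
lemma det_stress_le {ν : ℝ} (hν : -1 / 2 < ν) (hν' : ν < 1) {S : Matrix (Fin 3) (Fin 3) ℝ}
    (hS : S.PosDef) :
    S.det ≤ (((1 - ν) * (S.trace / 3)) • (1 : Matrix (Fin 3) (Fin 3) ℝ) + ν • S).det := by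
  obtain ⟨U, l, hU, hl, rfl⟩ := exists_diagonalization hS
  have hU' : Uᵀ * U = 1 := mul_eq_one_comm.1 hU
  have hdet : ∀ d : Fin 3 → ℝ, (U * Matrix.diagonal d * Uᵀ).det = ∏ i, d i := fun d => by
    rw [Matrix.det_mul, Matrix.det_mul, Matrix.det_diagonal, mul_right_comm, ← Matrix.det_mul, hU,
      Matrix.det_one, one_mul]
  have htr : (U * Matrix.diagonal l * Uᵀ).trace = ∑ i, l i := by
    rw [Matrix.trace_mul_comm, ← Matrix.mul_assoc, hU', Matrix.one_mul, Matrix.trace_diagonal]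
  have e : ((1 - ν) * ((∑ i, l i) / 3)) • (1 : Matrix (Fin 3) (Fin 3) ℝ) +
      ν • (U * Matrix.diagonal l * Uᵀ) =
      U * Matrix.diagonal (fun i => (1 - ν) * ((∑ i, l i) / 3) + ν * l i) * Uᵀ := by
    have : Matrix.diagonal (fun i => (1 - ν) * ((∑ i, l i) / 3) + ν * l i) =
        ((1 - ν) * ((∑ i, l i) / 3)) • (1 : Matrix (Fin 3) (Fin 3) ℝ) + ν • Matrix.diagonal l := by
      ext i j
      by_cases h : i = j <;> simp [h]
    rw [this, Matrix.mul_add, Matrix.add_mul, Matrix.mul_smul, Matrix.smul_mul, Matrix.mul_one, hU,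
      Matrix.mul_smul, Matrix.smul_mul]
  rw [htr, e, hdet, hdet, Fin.prod_univ_three, Fin.prod_univ_three, Fin.sum_univ_three]
  exact det_le_det_of_diagonal hν hν' (hl 0) (hl 1) (hl 2)

/-- `h` has density `ρ`, bulk velocity `u` and stress tensor `S`. -/
structure HasFields (h : R3 → ℝ) (ρ : ℝ) (u : R3) (S : Matrix (Fin 3) (Fin 3) ℝ) : Prop where
  finiteEnergy : FiniteEnergy h
  zeroth : ∫ v, h v = ρ
  first : ∀ i, ∫ v : R3, (v - u) i * h v = 0
  second : ∀ i j, ∫ v : R3, (v - u) i * (v - u) j * h v = ρ * S i j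

lemma log_gaussian {S : Matrix (Fin 3) (Fin 3) ℝ} (hS : S.PosDef) (u v : R3) :
    Real.log (gaussian S u v) = -(3 / 2 * Real.log (2 * Real.pi)) - 1 / 2 * Real.log S.det
      - 1 / 2 * ∑ i, ∑ j, S⁻¹ i j * ((v - u) i * (v - u) j) := by
  have hdet := hS.det_pos
  have h1 : ((2 * Real.pi) • S).det = (2 * Real.pi) ^ 3 * S.det := by
    rw [Matrix.det_smul, Fintype.card_fin]
  have h2 : 0 < ((2 * Real.pi) • S).det := by rw [h1]; positivity
  rw [gaussian, Real.log_mul (by positivity) (Real.exp_pos _).ne', Real.log_exp, Real.log_inv,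
    Real.log_sqrt h2.le, h1, Real.log_mul (by positivity) hdet.ne', Real.log_pow]
  have : (v - u).ofLp ⬝ᵥ (S⁻¹ *ᵥ (v - u).ofLp) =
      ∑ i, ∑ j, S⁻¹ i j * ((v - u) i * (v - u) j) := by
    simp only [dotProduct, Matrix.mulVec, Finset.mul_sum]
    refine Finset.sum_congr rfl fun i _ => Finset.sum_congr rfl fun j _ => by ring
  rw [this]; push_cast; ring

lemma gaussian_pos {S : Matrix (Fin 3) (Fin 3) ℝ} (hS : S.PosDef) (u v : R3) :
    0 < gaussian S u v := by
  have hdet := hS.det_pos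
  have h1 : 0 < ((2 * Real.pi) • S).det := by rw [Matrix.det_smul]; positivity
  unfold gaussian; positivity

lemma HasFields.integral_log {h : R3 → ℝ} {ρ : ℝ} {u : R3} {S : Matrix (Fin 3) (Fin 3) ℝ}
    (hh : HasFields h ρ u S) (hS : S.PosDef) (hρ : 0 < ρ) :
    Integrable (fun v => (Real.log (ρ * gaussian S u v) - Real.log (maxwellian v)) * h v) ∧
    ∫ v, (Real.log (ρ * gaussian S u v) - Real.log (maxwellian v)) * h v =
      ρ * (Real.log ρ - 1 / 2 * Real.log S.det - 3 / 2 + 1 / 2 * S.trace + 1 / 2 * ‖u‖ ^ 2) := by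
  have hsym : ∀ i j, S i j = S j i := fun i j => by simpa using (hS.1.apply i j).symm
  have e : ∀ v, (Real.log (ρ * gaussian S u v) - Real.log (maxwellian v)) * h v =
      (Real.log ρ - 1 / 2 * Real.log S.det + 1 / 2 * ‖u‖ ^ 2) * h v
      + ∑ i, u i * ((v - u) i * h v)
      + ∑ i, ∑ j, (1 / 2 * (if i = j then 1 else 0) - 1 / 2 * S⁻¹ i j) *
        ((v - u) i * (v - u) j * h v) := fun v => by
    rw [Real.log_mul hρ.ne' (gaussian_pos hS u v).ne', log_gaussian hS, log_maxwellian]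
    have h1 : ‖v‖ ^ 2 = ‖u‖ ^ 2 + 2 * ∑ i, u i * (v - u) i + ∑ i, (v - u) i * (v - u) i := by
      rw [norm_sq_eq_sum, norm_sq_eq_sum]
      simp only [Fin.sum_univ_three, PiLp.sub_apply]; ring
    rw [h1]
    simp only [Fin.sum_univ_three]
    simp
    ring
  have i0 := hh.finiteEnergy.integrable
  have i2 := fun i j => (hh.finiteEnergy.integral_quadratic u i j).1
  have i1 : ∀ i, Integrable fun v : R3 => (v - u) i * h v := fun i => by
    have := ((hh.finiteEnergy.integrable_extVel none (some i))).sub (i0.const_mul (u i))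
    refine this.congr (Filter.Eventually.of_forall fun v => ?_)
    simp only [Pi.sub_apply, extVel, PiLp.sub_apply]; ring
  have j1 : Integrable fun v : R3 => ∑ i, u i * ((v - u) i * h v) :=
    integrable_finsetSum _ fun i _ => (i1 i).const_mul _
  have j2' : ∀ i, Integrable fun v : R3 => ∑ j, (1 / 2 * (if i = j then 1 else 0)
      - 1 / 2 * S⁻¹ i j) * ((v - u) i * (v - u) j * h v) := fun i =>
    integrable_finsetSum _ fun j _ => (i2 i j).const_mul _
  have j2 : Integrable fun v : R3 => ∑ i, ∑ j, (1 / 2 * (if i = j then 1 else 0)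
      - 1 / 2 * S⁻¹ i j) * ((v - u) i * (v - u) j * h v) :=
    integrable_finsetSum _ fun i _ => j2' i
  simp only [e]
  refine ⟨((i0.const_mul _).add j1).add j2, ?_⟩
  have hinv : S⁻¹ * S = 1 := Matrix.nonsing_inv_mul _ hS.det_pos.ne'.isUnit
  have htr : ∑ i, ∑ j, S⁻¹ i j * S i j = 3 := by
    have := congrArg Matrix.trace hinv
    simp only [Matrix.trace, Matrix.diag_apply, Matrix.mul_apply, Matrix.one_apply_eq] at this
    simp only [fun i j => hsym i j] at this ⊢
    simpa using this
  have k0 := i0.const_mul (Real.log ρ - 1 / 2 * Real.log S.det + 1 / 2 * ‖u‖ ^ 2)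
  have s1 := integral_add (k0.add j1) j2
  have s2 := integral_add k0 j1
  simp only [Pi.add_apply] at s1 s2
  rw [s1, s2, integral_const_mul, integral_finsetSum _ fun i _ => (i1 i).const_mul _,
    integral_finsetSum _ fun i _ => j2' i]
  simp_rw [integral_finsetSum _ fun j _ => (i2 _ j).const_mul _, integral_const_mul, hh.first,
    hh.second, hh.zeroth]
  simp only [Matrix.trace, Matrix.diag_apply]
  simp only [Fin.sum_univ_three] at htr ⊢
  simp
  linear_combination (-(1 / 2) * ρ) * htr

/-- A profile with stress tensor `S` has at least the relative entropy of the Gaussian with the same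
fields, and hence of any Gaussian with the same mass, mean and trace and a covariance of larger
determinant. -/
lemma HasFields.entropy_le {h : R3 → ℝ} {ρ : ℝ} {u : R3} {S S' : Matrix (Fin 3) (Fin 3) ℝ}
    (hh : HasFields h ρ u S) (hS : S.PosDef) (hS' : S'.PosDef) (hρ : 0 < ρ)
    (htr : S'.trace = S.trace) (hdet : S.det ≤ S'.det) (h0 : ∀ᵐ v, 0 ≤ h v)
    (hent : Integrable fun v => relEnt (h v) (maxwellian v)) :
    Integrable (fun v => relEnt (ρ * gaussian S' u v) (maxwellian v)) ∧
    ∫ v, relEnt (ρ * gaussian S' u v) (maxwellian v) ≤ ∫ v, relEnt (h v) (maxwellian v) := by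
  have hfields : ∀ {R : Matrix (Fin 3) (Fin 3) ℝ}, R.PosDef →
      HasFields (fun v => ρ * gaussian R u v) ρ u R := fun {R} hR => by
    obtain ⟨⟨g0, g0'⟩, g1, g2⟩ := gaussian_moments hR u
    have hfe : FiniteEnergy fun v => ρ * gaussian R u v := by
      have e : (fun v : R3 => (1 + ‖v‖ ^ 2) * (ρ * gaussian R u v)) = fun v =>
          ((1 + ‖u‖ ^ 2) * ρ) * gaussian R u v
          + ∑ i, (2 * u i * ρ) * ((v - u) i * gaussian R u v)
          + ∑ i, ρ * ((v - u) i * (v - u) i * gaussian R u v) := by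
        ext v
        rw [norm_sq_eq_sum, norm_sq_eq_sum]
        simp only [Fin.sum_univ_three, PiLp.sub_apply]; ring
      rw [FiniteEnergy, e]
      exact ((g0.const_mul _).add (integrable_finsetSum _ fun i _ => (g1 i).1.const_mul _)).add
        (integrable_finsetSum _ fun i _ => (g2 i i).1.const_mul _)
    refine ⟨hfe, ?_, fun i => ?_, fun i j => ?_⟩
    · rw [integral_const_mul, g0', mul_one]
    · simp_rw [mul_left_comm _ ρ]; rw [integral_const_mul, (g1 i).2, mul_zero]
    · simp_rw [mul_left_comm _ ρ]; rw [integral_const_mul, (g2 i j).2]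
  have f1 := hh.integral_log hS hρ
  have f2 := (hfields hS').integral_log hS' hρ
  have k1 := (hfields hS).finiteEnergy.integrable
  have k2 := (hfields hS').finiteEnergy.integrable
  have km := integrable_maxwellian
  have e2 : ∀ v, relEnt (ρ * gaussian S' u v) (maxwellian v) =
      (Real.log (ρ * gaussian S' u v) - Real.log (maxwellian v)) * (ρ * gaussian S' u v)
        - ρ * gaussian S' u v + maxwellian v := fun v => by rw [relEnt]; ring
  simp only [e2]
  refine ⟨(f2.1.sub k2).add km, ?_⟩
  have hle : ∀ᵐ v, (Real.log (ρ * gaussian S u v) - Real.log (maxwellian v)) * h v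
      - ρ * gaussian S u v + maxwellian v ≤ relEnt (h v) (maxwellian v) := by
    filter_upwards [h0] with v hv
    have hm := maxwellian_pos v
    have hg := gaussian_pos hS u v
    have := fenchel hv hm (Real.log (ρ * gaussian S u v) - Real.log (maxwellian v))
    rw [Real.exp_sub, Real.exp_log (by positivity), Real.exp_log hm] at this
    refine le_trans (le_of_eq ?_) this
    field_simp; ring
  refine le_trans ?_ (integral_mono_ae ((f1.1.sub k1).add km) hent hle)
  have s1 := integral_add (f1.1.sub k1) km
  have s2 := integral_add (f2.1.sub k2) km
  have s3 := integral_sub f1.1 k1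
  have s4 := integral_sub f2.1 k2
  simp only [Pi.sub_apply, Pi.add_apply] at s1 s2 s3 s4 ⊢
  rw [s1, s2, s3, s4, f1.2, f2.2, (hfields hS).zeroth, (hfields hS').zeroth, htr]
  have := Real.log_le_log hS.det_pos hdet
  nlinarith

/-! ### The truncated relaxation law -/

/-- Metric projection onto a nonempty closed convex set, as a nonexpansive retraction. -/
lemma exists_nonexpansive_retraction {E : Type*} [NormedAddCommGroup E] [InnerProductSpace ℝ E]
    [CompleteSpace E] {K : Set E} (hne : K.Nonempty) (hcl : IsClosed K) (hK : Convex ℝ K) :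
    ∃ P : E → E, (∀ x, P x ∈ K) ∧ (∀ x ∈ K, P x = x) ∧ ∀ x y, ‖P x - P y‖ ≤ ‖x - y‖ := by
  choose P hP hmin using fun u => exists_norm_eq_iInf_of_complete_convex hne hcl.isComplete hK u
  have hvar : ∀ u, ∀ w ∈ K, inner ℝ (u - P u) (w - P u) ≤ 0 := fun u =>
    (norm_eq_iInf_iff_real_inner_le_zero hK (hP u)).1 (hmin u)
  have hlip : ∀ x y, ‖P x - P y‖ ≤ ‖x - y‖ := fun x y => by
    have h1 := hvar x (P y) (hP y)
    have h2 := hvar y (P x) (hP x)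
    have h3 : ‖P x - P y‖ ^ 2 ≤ inner ℝ (x - y) (P x - P y) := by
      rw [← real_inner_self_eq_norm_sq]
      simp only [inner_sub_left, inner_sub_right] at h1 h2 ⊢
      linarith
    have h4 := real_inner_le_norm (x - y) (P x - P y)
    rcases (norm_nonneg (P x - P y)).eq_or_lt with h | h
    · rw [← h]; exact norm_nonneg _
    · nlinarith
  refine ⟨P, hP, fun x hx => ?_, hlip⟩
  have h := hvar x x hx
  rw [real_inner_self_eq_norm_sq] at h
  have : ‖x - P x‖ = 0 := by nlinarith [norm_nonneg (x - P x)]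
  exact (sub_eq_zero.1 (norm_eq_zero.1 this)).symm

/-- Second moments about the point `b`. -/
def centred (m : Mom) (b : R3) (i j : Fin 3) : ℝ :=
  m (some i, some j) - b i * m (none, some j) - b j * m (none, some i) + b i * b j * m (none, none)

/-- The compact convex set of moment matrices with density at least `c`, norm at most `B` and
energy about every point at least `κ`. All constraints besides the norm bound are linear. -/
structure MomBox (c B κ : ℝ) (m : Mom) : Prop where
  norm_le : ‖m‖ ≤ B
  density_ge : c ≤ momDensity m
  symm : ∀ i j : Fin 3, m (some i, some j) = m (some j, some i)
  energy_ge : ∀ b, κ ≤ ∑ i, centred m b i i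
  quad_nonneg : ∀ b x : R3, 0 ≤ ∑ i, ∑ j, x i * x j * centred m b i j
  quad_le : ∀ b x : R3, ∑ i, ∑ j, x i * x j * centred m b i j ≤ ‖x‖ ^ 2 * ∑ i, centred m b i i

lemma centred_comb (m m' : Mom) (s t : ℝ) (b : R3) (i j : Fin 3) :
    centred (s • m + t • m') b i j = s * centred m b i j + t * centred m' b i j := by
  simp only [centred, PiLp.add_apply, PiLp.smul_apply, smul_eq_mul]; ring

lemma convex_momBox (c B κ : ℝ) : Convex ℝ {m | MomBox c B κ m} := by
  intro m hm m' hm' s t hs ht hst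
  have hq : ∀ b x : R3, ∑ i, ∑ j, x i * x j * centred (s • m + t • m') b i j =
      s * (∑ i, ∑ j, x i * x j * centred m b i j) + t * ∑ i, ∑ j, x i * x j * centred m' b i j := by
    intro b x
    simp only [centred_comb, Fin.sum_univ_three]; ring
  have he : ∀ b : R3, ∑ i, centred (s • m + t • m') b i i =
      s * (∑ i, centred m b i i) + t * ∑ i, centred m' b i i := by
    intro b
    simp only [centred_comb, Fin.sum_univ_three]; ring
  refine ⟨?_, ?_, fun i j => ?_, fun b => ?_, fun b x => ?_, fun b x => ?_⟩
  · have := (convex_closedBall (0 : Mom) B) (mem_closedBall_zero_iff.2 hm.norm_le)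
      (mem_closedBall_zero_iff.2 hm'.norm_le) hs ht hst
    exact mem_closedBall_zero_iff.1 this
  · have : momDensity (s • m + t • m') = s * momDensity m + t * momDensity m' := rfl
    rw [this]
    calc c = s * c + t * c := by rw [← add_mul, hst, one_mul]
      _ ≤ _ := by gcongr; exacts [hm.density_ge, hm'.density_ge]
  · simp only [PiLp.add_apply, PiLp.smul_apply]; rw [hm.symm i j, hm'.symm i j]
  · rw [he]
    calc κ = s * κ + t * κ := by rw [← add_mul, hst, one_mul]
      _ ≤ _ := by gcongr; exacts [hm.energy_ge b, hm'.energy_ge b]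
  · rw [hq]
    exact add_nonneg (mul_nonneg hs (hm.quad_nonneg b x)) (mul_nonneg ht (hm'.quad_nonneg b x))
  · rw [hq, he, mul_add, mul_left_comm _ s, mul_left_comm _ t]
    gcongr
    exacts [hm.quad_le b x, hm'.quad_le b x]

lemma isClosed_momBox (c B κ : ℝ) : IsClosed {m | MomBox c B κ m} := by
  have hc : ∀ b i j, Continuous fun m : Mom => centred m b i j := fun b i j => by
    unfold centred; fun_prop
  have : {m | MomBox c B κ m} = {m | ‖m‖ ≤ B} ∩ {m | c ≤ momDensity m} ∩
      (⋂ i : Fin 3, ⋂ j : Fin 3, {m : Mom | m (some i, some j) = m (some j, some i)}) ∩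
      (⋂ b : R3, {m | κ ≤ ∑ i, centred m b i i}) ∩
      (⋂ b : R3, ⋂ x : R3, {m | 0 ≤ ∑ i, ∑ j, x i * x j * centred m b i j}) ∩
      (⋂ b : R3, ⋂ x : R3, {m | ∑ i, ∑ j, x i * x j * centred m b i j ≤
        ‖x‖ ^ 2 * ∑ i, centred m b i i}) := by
    ext m
    simp only [mem_inter_iff, mem_iInter, mem_ofPred_eq]
    exact ⟨fun h => ⟨⟨⟨⟨⟨h.1, h.2⟩, h.3⟩, h.4⟩, h.5⟩, h.6⟩,
      fun ⟨⟨⟨⟨⟨h1, h2⟩, h3⟩, h4⟩, h5⟩, h6⟩ => ⟨h1, h2, h3, h4, h5, h6⟩⟩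
  rw [this]
  have hd : Continuous momDensity := by unfold momDensity; fun_prop
  refine ((((IsClosed.inter ?_ ?_).inter ?_).inter ?_).inter ?_).inter ?_
  · exact isClosed_le continuous_norm continuous_const
  · exact isClosed_le continuous_const hd
  · exact isClosed_iInter fun i => isClosed_iInter fun j => isClosed_eq (by fun_prop) (by fun_prop)
  · exact isClosed_iInter fun b => isClosed_le continuous_const (by fun_prop)
  · exact isClosed_iInter fun b => isClosed_iInter fun x =>
      isClosed_le continuous_const (by fun_prop)
  · exact isClosed_iInter fun b => isClosed_iInter fun x => isClosed_le (by fun_prop) (by fun_prop)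

lemma isCompact_momBox (c B κ : ℝ) : IsCompact {m | MomBox c B κ m} :=
  (isCompact_closedBall (0 : Mom) B).of_isClosed_subset (isClosed_momBox c B κ)
    fun _ hm => mem_closedBall_zero_iff.2 hm.norm_le

section MomBox

variable {c B κ ν : ℝ} {m : Mom}

lemma centred_momVel (h0 : momDensity m ≠ 0) (i j : Fin 3) :
    centred m (momVel m) i j = momDensity m * momStress m i j := by
  simp only [centred, momStress, Matrix.of_apply, momVel, PiLp.smul_apply, smul_eq_mul]
  simp only [momDensity] at *
  field_simp
  ring

lemma MomBox.density_pos (hm : MomBox c B κ m) (hc : 0 < c) : 0 < momDensity m :=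
  hc.trans_le hm.density_ge

lemma MomBox.energy (hm : MomBox c B κ m) (hc : 0 < c) : κ ≤ 3 * (momDensity m * momTemp m) := by
  have := hm.energy_ge (momVel m)
  simp only [centred_momVel (hm.density_pos hc).ne', ← Finset.mul_sum] at this
  rw [momTemp]; linarith

lemma MomBox.temp_pos (hm : MomBox c B κ m) (hc : 0 < c) (hκ : 0 < κ) : 0 < momTemp m := by
  have h1 := hm.energy hc
  have h2 := hm.density_pos hc
  by_contra h
  nlinarith

lemma MomBox.stress_quad (hm : MomBox c B κ m) (hc : 0 < c) (x : R3) :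
    0 ≤ ∑ i, ∑ j, x i * x j * momStress m i j ∧
    ∑ i, ∑ j, x i * x j * momStress m i j ≤ 3 * momTemp m * ‖x‖ ^ 2 := by
  have h0 := hm.density_pos hc
  have h1 := hm.quad_nonneg (momVel m) x
  have h2 := hm.quad_le (momVel m) x
  simp only [centred_momVel h0.ne'] at h1 h2
  have e : ∑ i, ∑ j, x i * x j * (momDensity m * momStress m i j) =
      momDensity m * ∑ i, ∑ j, x i * x j * momStress m i j := by
    simp only [Fin.sum_univ_three]; ring
  have e2 : ∑ i, momDensity m * momStress m i i = momDensity m * (3 * momTemp m) := by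
    rw [momTemp, ← Finset.mul_sum]; ring
  rw [e] at h1 h2
  rw [e2] at h2
  exact ⟨nonneg_of_mul_nonneg_right h1 h0, by
    have : momDensity m * (∑ i, ∑ j, x i * x j * momStress m i j) ≤
      momDensity m * (3 * momTemp m * ‖x‖ ^ 2) := by linarith
    exact le_of_mul_le_mul_left this h0⟩

lemma momTensor_quad (ν : ℝ) (m : Mom) (x : R3) :
    ∑ i, ∑ j, x i * x j * momTensor ν m i j =
      (1 - ν) * momTemp m * ‖x‖ ^ 2 + ν * ∑ i, ∑ j, x i * x j * momStress m i j := by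
  rw [norm_sq_eq_sum]
  simp only [momTensor, Matrix.add_apply, Matrix.smul_apply, smul_eq_mul, Fin.sum_univ_three,
    Matrix.one_apply]
  simp
  ring

lemma dotProduct_mulVec_eq (S : Matrix (Fin 3) (Fin 3) ℝ) (x : Fin 3 → ℝ) :
    x ⬝ᵥ (S *ᵥ x) = ∑ i, ∑ j, x i * x j * S i j := by
  simp only [dotProduct, Matrix.mulVec, Finset.mul_sum]
  exact Finset.sum_congr rfl fun i _ => Finset.sum_congr rfl fun j _ => by ring

lemma MomBox.stress_symm (hm : MomBox c B κ m) (i j : Fin 3) :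
    momStress m i j = momStress m j i := by
  simp only [momStress, Matrix.of_apply, hm.symm i j]; ring

lemma MomBox.tensor_posDef (hm : MomBox c B κ m) (hc : 0 < c) (hκ : 0 < κ) (hν : -1 / 2 < ν)
    (hν' : ν < 1) : (momTensor ν m).PosDef := by
  refine Matrix.PosDef.of_dotProduct_mulVec_pos ?_ fun x hx => ?_
  · ext i j
    simp only [Matrix.conjTranspose_apply, star_trivial, momTensor, Matrix.add_apply,
      Matrix.smul_apply, hm.stress_symm i j, Matrix.one_apply, eq_comm (a := i)]
  · have h := momTensor_quad ν m (WithLp.toLp 2 x)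
    obtain ⟨h1, h2⟩ := hm.stress_quad hc (WithLp.toLp 2 x)
    have hT := hm.temp_pos hc hκ
    have hx' : 0 < ‖(WithLp.toLp 2 x : R3)‖ ^ 2 := by
      have : (WithLp.toLp 2 x : R3) ≠ 0 := fun h => hx (by simpa using congrArg WithLp.ofLp h)
      positivity
    rw [star_trivial, dotProduct_mulVec_eq]
    simp only at h h1 h2
    rw [h]
    set q := ∑ i, ∑ j, x i * x j * momStress m i j
    set n := ‖(WithLp.toLp 2 x : R3)‖ ^ 2
    have hTn : 0 < momTemp m * n := mul_pos hT hx'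
    rcases le_total 0 ν with h0 | h0
    · nlinarith [mul_nonneg h0 h1]
    · nlinarith [mul_le_mul_of_nonneg_left h2 (neg_nonneg.2 h0)]

lemma MomBox.tensor_quad_le (hm : MomBox c B κ m) (hc : 0 < c) (hκ : 0 < κ) (hν : -1 / 2 < ν)
    (hν' : ν < 1) (x : R3) :
    ∑ i, ∑ j, x i * x j * momTensor ν m i j ≤ 6 * momTemp m * ‖x‖ ^ 2 := by
  rw [momTensor_quad]
  obtain ⟨h1, h2⟩ := hm.stress_quad hc x
  have hT := hm.temp_pos hc hκ
  have hTn : 0 ≤ momTemp m * ‖x‖ ^ 2 := by positivity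
  rcases le_total 0 ν with h0 | h0
  · nlinarith
  · nlinarith

/-- If `S ≤ Λ` then `S⁻¹ ≥ Λ⁻¹`, as quadratic forms. -/
lemma inv_quad_ge {S : Matrix (Fin 3) (Fin 3) ℝ} (hS : S.PosDef) {Λ : ℝ} (hΛ : 0 < Λ)
    (h : ∀ x : Fin 3 → ℝ, x ⬝ᵥ (S *ᵥ x) ≤ Λ * (x ⬝ᵥ x)) (x : Fin 3 → ℝ) :
    Λ⁻¹ * (x ⬝ᵥ x) ≤ x ⬝ᵥ (S⁻¹ *ᵥ x) := by
  have hu : IsUnit S.det := hS.det_pos.ne'.isUnit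
  have hsym : Sᵀ = S := by simpa using hS.1.eq
  set y := S⁻¹ *ᵥ x with hy
  have hSy : S *ᵥ y = x := by
    rw [hy, Matrix.mulVec_mulVec, Matrix.mul_nonsing_inv _ hu, Matrix.one_mulVec]
  have h0 : 0 ≤ (y - Λ⁻¹ • x) ⬝ᵥ (S *ᵥ (y - Λ⁻¹ • x)) := by
    simpa using hS.posSemidef.dotProduct_mulVec_nonneg (y - Λ⁻¹ • x)
  have e1 : y ⬝ᵥ (S *ᵥ x) = x ⬝ᵥ x := by
    rw [Matrix.dotProduct_mulVec, ← Matrix.mulVec_transpose, hsym, hSy]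
  have e2 : (y - Λ⁻¹ • x) ⬝ᵥ (S *ᵥ (y - Λ⁻¹ • x)) =
      x ⬝ᵥ y - 2 * Λ⁻¹ * (x ⬝ᵥ x) + Λ⁻¹ ^ 2 * (x ⬝ᵥ (S *ᵥ x)) := by
    rw [Matrix.mulVec_sub, Matrix.mulVec_smul, hSy]
    simp only [sub_dotProduct, dotProduct_sub, smul_dotProduct, dotProduct_smul, smul_eq_mul, e1]
    rw [dotProduct_comm y x]; ring
  have h2 : Λ⁻¹ ^ 2 * (x ⬝ᵥ (S *ᵥ x)) ≤ Λ⁻¹ * (x ⬝ᵥ x) := by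
    calc _ ≤ Λ⁻¹ ^ 2 * (Λ * (x ⬝ᵥ x)) := by gcongr; exact h x
      _ = _ := by field_simp
  rw [e2] at h0
  linarith

/-! ### Smoothness of the macroscopic fields -/

lemma contDiffAt_coord (p : Idx × Idx) (m : Mom) : ContDiffAt ℝ 1 (fun m : Mom => m p) m :=
  ((EuclideanSpace.proj (𝕜 := ℝ) p).contDiff).contDiffAt

lemma contDiffAt_momVel (h0 : momDensity m ≠ 0) (i : Fin 3) :
    ContDiffAt ℝ 1 (fun m => momVel m i) m := by
  simp only [momVel, PiLp.smul_apply, smul_eq_mul]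
  exact ((contDiffAt_coord _ m).inv h0).mul (contDiffAt_coord _ m)

lemma contDiffAt_momStress (h0 : momDensity m ≠ 0) (i j : Fin 3) :
    ContDiffAt ℝ 1 (fun m => momStress m i j) m := by
  simp only [momStress, Matrix.of_apply]
  exact (((contDiffAt_coord _ m).inv h0).mul (contDiffAt_coord _ m)).sub
    ((contDiffAt_momVel h0 i).mul (contDiffAt_momVel h0 j))

lemma contDiffAt_momTemp (h0 : momDensity m ≠ 0) : ContDiffAt ℝ 1 momTemp m := by
  unfold momTemp
  exact (ContDiffAt.sum fun i _ => contDiffAt_momStress h0 i i).div_const _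

lemma contDiffAt_momTensor (h0 : momDensity m ≠ 0) (i j : Fin 3) :
    ContDiffAt ℝ 1 (fun m => momTensor ν m i j) m := by
  simp only [momTensor, Matrix.add_apply, Matrix.smul_apply, smul_eq_mul]
  exact ((contDiffAt_const.mul (contDiffAt_momTemp h0)).mul contDiffAt_const).add
    (contDiffAt_const.mul (contDiffAt_momStress h0 i j))

lemma contDiffAt_det {f : Mom → Matrix (Fin 3) (Fin 3) ℝ}
    (hf : ∀ i j, ContDiffAt ℝ 1 (fun m => f m i j) m) : ContDiffAt ℝ 1 (fun m => (f m).det) m := by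
  simp only [Matrix.det_apply']
  exact ContDiffAt.sum fun σ _ => contDiffAt_const.mul (contDiffAt_prod fun i _ => hf _ _)

lemma contDiffAt_inv {f : Mom → Matrix (Fin 3) (Fin 3) ℝ}
    (hf : ∀ i j, ContDiffAt ℝ 1 (fun m => f m i j) m) (h0 : (f m).det ≠ 0) (i j : Fin 3) :
    ContDiffAt ℝ 1 (fun m => (f m)⁻¹ i j) m := by
  simp only [Matrix.inv_def, Matrix.smul_apply, smul_eq_mul, Ring.inverse_eq_inv',
    Matrix.adjugate_apply]
  refine ((contDiffAt_det hf).inv h0).mul (contDiffAt_det fun k l => ?_)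
  by_cases h : k = j
  · subst h; simp only [Matrix.updateRow_self]; exact contDiffAt_const
  · simp only [Matrix.updateRow_ne h]; exact hf k l

/-- Coefficients of the quadratic polynomial `log M_ν` in the extended velocity. -/
def logCoef (ν : ℝ) (m : Mom) : Idx × Idx → ℝ
  | (none, none) => Real.log (momDensity m) - 3 / 2 * Real.log (2 * Real.pi)
      - 1 / 2 * Real.log (momTensor ν m).det
      - 1 / 2 * ∑ i, ∑ j, (momTensor ν m)⁻¹ i j * (momVel m i * momVel m j)
  | (none, some i) => 1 / 2 * ∑ j, ((momTensor ν m)⁻¹ i j + (momTensor ν m)⁻¹ j i) * momVel m j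
  | (some _, none) => 0
  | (some i, some j) => -(1 / 2) * (momTensor ν m)⁻¹ i j

lemma contDiffAt_logCoef (h0 : momDensity m ≠ 0) (h1 : (momTensor ν m).det ≠ 0) :
    ContDiffAt ℝ 1 (logCoef ν) m := by
  have hT := fun i j => contDiffAt_momTensor (ν := ν) h0 i j
  have hI := fun i j => contDiffAt_inv hT h1 i j
  have hV := fun i => contDiffAt_momVel h0 i
  refine contDiffAt_pi.2 fun p => ?_
  rcases p with ⟨_ | i, _ | j⟩ <;> simp only [logCoef]
  · exact ((((contDiffAt_coord _ m).log h0).sub contDiffAt_const).sub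
      (contDiffAt_const.mul ((contDiffAt_det hT).log h1))).sub (contDiffAt_const.mul
        (ContDiffAt.sum fun i _ => ContDiffAt.sum fun j _ => (hI i j).mul ((hV i).mul (hV j))))
  · exact contDiffAt_const.mul (ContDiffAt.sum fun j _ => ((hI _ _).add (hI _ _)).mul (hV j))
  · exact contDiffAt_const
  · exact contDiffAt_const.mul (hI i j)

/-- Evaluation of a quadratic polynomial in the extended velocity. -/
def quadPoly (q : Idx × Idx → ℝ) (v : R3) : ℝ := ∑ p, q p * (extVel v p.1 * extVel v p.2)

lemma momGauss_eq_exp (h0 : 0 < momDensity m) (hT : (momTensor ν m).PosDef) (v : R3) :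
    momGauss ν m v = Real.exp (quadPoly (logCoef ν m) v) := by
  have hpos : 0 < momGauss ν m v := mul_pos h0 (gaussian_pos hT _ _)
  rw [← Real.exp_log hpos, momGauss, Real.log_mul h0.ne' (gaussian_pos hT _ _).ne', log_gaussian hT]
  congr 1
  simp only [quadPoly, Fintype.sum_prod_type, Fintype.sum_option, logCoef, extVel,
    Fin.sum_univ_three, PiLp.sub_apply]
  ring

lemma quadPoly_sub_le {q q' : Idx × Idx → ℝ} {d : ℝ} (hd : ∀ p, |q p - q' p| ≤ d) (v : R3) :
    |quadPoly q v - quadPoly q' v| ≤ 16 * d * (1 + ‖v‖ ^ 2) := by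
  rw [quadPoly, quadPoly, ← Finset.sum_sub_distrib]
  refine (Finset.abs_sum_le_sum_abs _ _).trans ?_
  have h0 : 0 ≤ d := (abs_nonneg _).trans (hd (none, none))
  calc _ ≤ ∑ _p : Idx × Idx, d * (1 + ‖v‖ ^ 2) := Finset.sum_le_sum fun p _ => by
        rw [← sub_mul, abs_mul]
        have := abs_extVel_mul_le v p.1 p.2
        rw [one_mul] at this
        exact mul_le_mul (hd p) this (abs_nonneg _) h0
    _ = _ := by simp; ring

end MomBox

/-- The moment matrix of the global Maxwellian. -/
def mom₀ : Mom := moments maxwellian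

lemma mom₀_apply (p : Idx × Idx) : mom₀ p = if p.1 = p.2 then 1 else 0 := by
  rcases p with ⟨_ | i, _ | j⟩ <;> simp only [mom₀, moments_apply, extVel]
  · simp [integral_maxwellian]
  · simpa using integral_coord_maxwellian j
  · simpa using integral_coord_maxwellian i
  · simpa using integral_coord_mul_coord_maxwellian i j

lemma momDensity_mom₀ : momDensity mom₀ = 1 := by simp [momDensity, mom₀_apply]

lemma momVel_mom₀ : momVel mom₀ = 0 := by
  ext i; simp [momVel, mom₀_apply]

lemma momStress_mom₀ : momStress mom₀ = 1 := by
  ext i j; simp [momStress, momDensity_mom₀, momVel_mom₀, mom₀_apply, Matrix.one_apply]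

lemma momTemp_mom₀ : momTemp mom₀ = 1 := by
  simp [momTemp, momStress_mom₀]

lemma momTensor_mom₀ (ν : ℝ) : momTensor ν mom₀ = 1 := by
  rw [momTensor, momStress_mom₀, momTemp_mom₀, mul_one, ← add_smul]; simp

lemma momFreq_mom₀ (ν : ℝ) : momFreq ν mom₀ = (1 - ν)⁻¹ := by
  rw [momFreq, momDensity_mom₀, momTemp_mom₀]; simp

lemma momGauss_mom₀ (ν : ℝ) (v : R3) : momGauss ν mom₀ v = maxwellian v := by
  rw [momGauss, momDensity_mom₀, momTensor_mom₀, momVel_mom₀, one_mul, maxwellian_eq_gaussian]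

/-- A relaxation law `m ↦ (a(m), M(m))` depending on the moments in a bounded and Lipschitz way,
with weighted bounds in velocity, and with `μ` as an equilibrium. Such laws arise by truncating the
collision frequency and the anisotropic Gaussian of the ES-BGK operator. A single constant `Λ`
serves in all the bounds. -/
structure RelaxLaw (ν β : ℝ) where
  freq : Mom → ℝ
  equil : Mom → R3 → ℝ
  Λ : ℝ
  one_le : 1 ≤ Λ
  measurable_freq : Measurable freq
  measurable_equil : Measurable fun p : Mom × R3 => equil p.1 p.2
  freq_nonneg : ∀ m, 0 ≤ freq m
  freq_le : ∀ m, freq m ≤ Λ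
  equil_pos : ∀ m v, 0 < equil m v
  equil_le : ∀ m v, equil m v ≤ Λ * (weight β v)⁻¹
  freq_lip : ∀ m m', |freq m - freq m'| ≤ Λ * ‖m - m'‖
  equil_lip : ∀ m m' v, |equil m v - equil m' v| ≤ Λ * ‖m - m'‖ * (weight β v)⁻¹
  freq_zero : freq mom₀ = (1 - ν)⁻¹
  equil_zero : ∀ v, equil mom₀ v = maxwellian v
  relEnt_le : ∀ m v,
    relEnt (equil m v) (maxwellian v) ≤ Λ * ‖m - mom₀‖ ^ 2 * (weight β v)⁻¹

lemma abs_exp_sub_exp_le (x y : ℝ) :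
    |Real.exp x - Real.exp y| ≤ |x - y| * (Real.exp x + Real.exp y) := by
  have hx := Real.exp_pos x
  have hy := Real.exp_pos y
  have h1 : Real.exp x - Real.exp y ≤ (x - y) * Real.exp x := by
    have := mul_le_mul_of_nonneg_left (Real.add_one_le_exp (y - x)) hx.le
    rw [← Real.exp_add, add_sub_cancel] at this
    linarith
  have h2 : Real.exp y - Real.exp x ≤ (y - x) * Real.exp y := by
    have := mul_le_mul_of_nonneg_left (Real.add_one_le_exp (x - y)) hy.le
    rw [← Real.exp_add, add_sub_cancel] at this
    linarith
  have h3 := le_abs_self (x - y)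
  have h4 := neg_abs_le (x - y)
  have h5 := abs_nonneg (x - y)
  rw [abs_le]
  constructor <;> nlinarith [mul_nonneg h5 hx.le, mul_nonneg h5 hy.le]

/-- Gaussian upper bound for the anisotropic Gaussians of a box of moments. -/
lemma exists_momGauss_le {c B κ ν : ℝ} (hc : 0 < c) (hκ : 0 < κ) (hν : -1 / 2 < ν) (hν' : ν < 1) :
    ∃ C k : ℝ, 0 < C ∧ 0 < k ∧ ∀ m, MomBox c B κ m → ∀ v,
      momGauss ν m v ≤ C * Real.exp (-(k * ‖v‖ ^ 2)) := by
  have hcpt := isCompact_momBox c B κ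
  have hd : ∀ m ∈ {m | MomBox c B κ m}, momDensity m ≠ 0 := fun m hm => (hm.density_pos hc).ne'
  have cT : ContinuousOn momTemp {m | MomBox c B κ m} := fun m hm =>
    (contDiffAt_momTemp (hd m hm)).continuousAt.continuousWithinAt
  have cU : ContinuousOn (fun m => ‖momVel m‖ ^ 2) {m | MomBox c B κ m} := fun m hm => by
    simp only [norm_sq_eq_sum]
    exact (ContDiffAt.sum fun i _ => (contDiffAt_momVel (hd m hm) i).mul
      (contDiffAt_momVel (hd m hm) i)).continuousAt.continuousWithinAt
  have cN : ContinuousOn (fun m => momDensity m * (√((2 * Real.pi) • momTensor ν m).det)⁻¹)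
      {m | MomBox c B κ m} := fun m hm => by
    have hdet := (hm.tensor_posDef hc hκ hν hν').det_pos
    simp only [Matrix.det_smul]
    have h1 := (contDiffAt_det fun i j => contDiffAt_momTensor (ν := ν) (hd m hm) i j).continuousAt
    have h2 : ContinuousAt momDensity m := (contDiffAt_coord _ m).continuousAt
    refine (h2.mul ((Real.continuous_sqrt.continuousAt.comp (h1.const_mul _)).inv₀ ?_)).continuousWithinAt
    have : 0 < (2 * Real.pi) ^ Fintype.card (Fin 3) * (momTensor ν m).det := by positivity
    exact (Real.sqrt_pos.2 this).ne'
  obtain ⟨T, hT⟩ := hcpt.exists_bound_of_continuousOn cT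
  obtain ⟨U, hU⟩ := hcpt.exists_bound_of_continuousOn cU
  obtain ⟨N, hN⟩ := hcpt.exists_bound_of_continuousOn cN
  set Λ := 6 * (|T| + 1) with hΛ
  have hΛ0 : 0 < Λ := by positivity
  refine ⟨(|N| + 1) * Real.exp (|U| / (2 * Λ)), 1 / (4 * Λ), by positivity, by positivity,
    fun m hm v => ?_⟩
  have hP := hm.tensor_posDef hc hκ hν hν'
  have hquad := inv_quad_ge hP hΛ0 (fun x => by
    have h1 := hm.tensor_quad_le hc hκ hν hν' (WithLp.toLp 2 x)
    rw [dotProduct_mulVec_eq]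
    have h2 : ‖(WithLp.toLp 2 x : R3)‖ ^ 2 = x ⬝ᵥ x := by rw [norm_sq_eq_sum]; rfl
    rw [h2] at h1
    refine h1.trans ?_
    have h3 : 0 ≤ x ⬝ᵥ x := by rw [← h2]; positivity
    have h4 : momTemp m ≤ |T| + 1 := by
      have := hT m hm; rw [Real.norm_eq_abs] at this
      linarith [le_abs_self (momTemp m), le_abs_self T]
    rw [hΛ]; gcongr) (v - momVel m).ofLp
  have h2 : (v - momVel m).ofLp ⬝ᵥ (v - momVel m).ofLp = ‖v - momVel m‖ ^ 2 := by
    rw [norm_sq_eq_sum]; rfl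
  rw [h2] at hquad
  have h3 : ‖v‖ ^ 2 / 2 - |U| ≤ ‖v - momVel m‖ ^ 2 := by
    have := hU m hm
    rw [Real.norm_eq_abs, abs_of_nonneg (by positivity)] at this
    have h5 : ‖v‖ ≤ ‖v - momVel m‖ + ‖momVel m‖ := norm_le_norm_sub_add v (momVel m)
    nlinarith [le_abs_self U, norm_nonneg v, sq_nonneg (‖v - momVel m‖ - ‖momVel m‖),
      norm_nonneg (v - momVel m), norm_nonneg (momVel m)]
  have h4 : momDensity m * (√((2 * Real.pi) • momTensor ν m).det)⁻¹ ≤ |N| + 1 := by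
    have := hN m hm; rw [Real.norm_eq_abs] at this
    linarith [le_abs_self (momDensity m * (√((2 * Real.pi) • momTensor ν m).det)⁻¹), le_abs_self N]
  rw [momGauss, gaussian, ← mul_assoc, mul_assoc (|N| + 1), ← Real.exp_add]
  have h6 : Λ⁻¹ * (‖v‖ ^ 2 / 2 - |U|) ≤ Λ⁻¹ * ‖v - momVel m‖ ^ 2 := by gcongr
  have h7 : -(1 / 2) * ((v - momVel m).ofLp ⬝ᵥ ((momTensor ν m)⁻¹ *ᵥ (v - momVel m).ofLp)) ≤
      |U| / (2 * Λ) + -(1 / (4 * Λ) * ‖v‖ ^ 2) := by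
    have e : |U| / (2 * Λ) + -(1 / (4 * Λ) * ‖v‖ ^ 2) =
        -(1 / 2) * (Λ⁻¹ * (‖v‖ ^ 2 / 2 - |U|)) := by field_simp; ring
    rw [e]; linarith
  gcongr

theorem exists_relaxLaw {c B κ ν : ℝ} (β : ℝ) (hc : 0 < c) (hκ : 0 < κ) (hν : -1 / 2 < ν)
    (hν' : ν < 1) (h₀ : MomBox c B κ mom₀) :
    ∃ L : RelaxLaw ν β, ∀ m, MomBox c B κ m →
      L.freq m = momFreq ν m ∧ ∀ v, L.equil m v = momGauss ν m v := by
  have hcpt := isCompact_momBox c B κ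
  have hconv := convex_momBox c B κ
  have hd : ∀ m ∈ {m | MomBox c B κ m}, momDensity m ≠ 0 := fun m hm => (hm.density_pos hc).ne'
  obtain ⟨P, hP, hPid, hPlip⟩ := exists_nonexpansive_retraction ⟨mom₀, h₀⟩
    (isClosed_momBox c B κ) hconv
  have hPlip' : LipschitzWith 1 P := LipschitzWith.of_dist_le_mul fun x y => by
    simpa [dist_eq_norm] using hPlip x y
  have sF : ContDiffOn ℝ 1 (momFreq ν) {m | MomBox c B κ m} := fun m hm => by
    have : ContDiffAt ℝ 1 (momFreq ν) m :=
      ((contDiffAt_coord _ m).mul (contDiffAt_momTemp (hd m hm))).div_const _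
    exact this.contDiffWithinAt
  have sL : ContDiffOn ℝ 1 (logCoef ν) {m | MomBox c B κ m} := fun m hm =>
    (contDiffAt_logCoef (hd m hm)
      (hm.tensor_posDef hc hκ hν hν').det_pos.ne').contDiffWithinAt
  obtain ⟨KF, hKF⟩ := sF.exists_lipschitzOnWith (by decide) hconv hcpt
  obtain ⟨KL, hKL⟩ := sL.exists_lipschitzOnWith (by decide) hconv hcpt
  obtain ⟨F, hF⟩ := hcpt.exists_bound_of_continuousOn sF.continuousOn
  obtain ⟨C, k, hC, hk, hG⟩ := exists_momGauss_le (B := B) hc hκ hν hν'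
  obtain ⟨D, hD, hDw⟩ := exists_gaussian_le_weight β 2 hk
  have hpow : ∀ (n : ℕ) (v : R3), n ≤ 2 →
      (1 + ‖v‖ ^ 2) ^ n * Real.exp (-(k * ‖v‖ ^ 2)) ≤ D * (weight β v)⁻¹ := fun n v hn => by
    refine le_trans ?_ (hDw v)
    gcongr
    nlinarith [sq_nonneg ‖v‖]
  have hexp : ∀ m v, momGauss ν (P m) v = Real.exp (quadPoly (logCoef ν (P m)) v) := fun m v =>
    momGauss_eq_exp ((hP m).density_pos hc) ((hP m).tensor_posDef hc hκ hν hν') v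
  have hlog : ∀ m m' v, |quadPoly (logCoef ν (P m)) v - quadPoly (logCoef ν (P m')) v| ≤
      16 * (KL * ‖m - m'‖) * (1 + ‖v‖ ^ 2) := fun m m' v => by
    refine quadPoly_sub_le (fun p => ?_) v
    have h1 := hKL.dist_le_mul _ (hP m) _ (hP m')
    rw [dist_eq_norm, dist_eq_norm] at h1
    have h2 := norm_le_pi_norm (logCoef ν (P m) - logCoef ν (P m')) p
    rw [Pi.sub_apply, Real.norm_eq_abs] at h2
    refine (h2.trans h1).trans ?_
    gcongr
    exact hPlip m m'
  have hmeasF : Measurable fun m => momFreq ν (P m) :=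
    (sF.continuousOn.comp_continuous hPlip'.continuous hP).measurable
  have hmeasG : Measurable fun p : Mom × R3 => momGauss ν (P p.1) p.2 := by
    simp only [hexp]
    have h1 : Continuous fun m => logCoef ν (P m) :=
      sL.continuousOn.comp_continuous hPlip'.continuous hP
    have h2 : Continuous fun p : Mom × R3 => quadPoly (logCoef ν (P p.1)) p.2 := by
      unfold quadPoly
      refine continuous_finsetSum _ fun q _ => ?_
      have h3 : Continuous fun p : Mom × R3 => logCoef ν (P p.1) q :=
        (continuous_apply q).comp (h1.comp continuous_fst)
      exact h3.mul (((continuous_extVel q.1).comp continuous_snd).mul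
        ((continuous_extVel q.2).comp continuous_snd))
    exact (Real.continuous_exp.comp h2).measurable
  set Λ : ℝ := 1 + |F| + KF + C * D + 16 * KL * (2 * C * D) + (16 * KL) ^ 2 * (2 * C * D) with hΛ
  have hw : ∀ v, 0 < (weight β v)⁻¹ := fun v => inv_pos.2 (weight_pos β v)
  have hsum : ∀ m m' (n : ℕ) v, n ≤ 2 → (1 + ‖v‖ ^ 2) ^ n *
      (momGauss ν (P m) v + momGauss ν (P m') v) ≤ 2 * C * D * (weight β v)⁻¹ := fun m m' n v hn => by
    calc _ ≤ (1 + ‖v‖ ^ 2) ^ n * (C * Real.exp (-(k * ‖v‖ ^ 2)) + C * Real.exp (-(k * ‖v‖ ^ 2))) := by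
          gcongr
          exacts [hG _ (hP m) v, hG _ (hP m') v]
      _ = 2 * C * ((1 + ‖v‖ ^ 2) ^ n * Real.exp (-(k * ‖v‖ ^ 2))) := by ring
      _ ≤ 2 * C * (D * (weight β v)⁻¹) := mul_le_mul_of_nonneg_left (hpow n v hn) (by positivity)
      _ = _ := by ring
  have t1 : 0 ≤ |F| := abs_nonneg F
  have t2 : (0 : ℝ) ≤ KF := KF.2
  have t3 : 0 ≤ C * D := by positivity
  have t4 : 0 ≤ 16 * (KL : ℝ) * (2 * C * D) := by positivity
  have t5 : 0 ≤ (16 * (KL : ℝ)) ^ 2 * (2 * C * D) := by positivity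
  have hmax : ∀ v, momGauss ν (P mom₀) v = maxwellian v := fun v => by
    rw [hPid _ h₀, momGauss_mom₀]
  refine ⟨{
    freq := fun m => momFreq ν (P m)
    equil := fun m => momGauss ν (P m)
    Λ := Λ
    one_le := by linarith
    measurable_freq := hmeasF
    measurable_equil := hmeasG
    freq_nonneg := fun m => ?_
    freq_le := fun m => ?_
    equil_pos := fun m v => by rw [hexp]; exact Real.exp_pos _
    equil_le := fun m v => ?_
    freq_lip := fun m m' => ?_
    equil_lip := fun m m' v => ?_
    freq_zero := by rw [hPid _ h₀, momFreq_mom₀]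
    equil_zero := hmax
    relEnt_le := fun m v => ?_ }, fun m hm => ⟨by simp only [hPid m hm], fun v => by
      simp only [hPid m hm]⟩⟩
  · have h1 := (hP m).density_pos hc
    have h2 := (hP m).temp_pos hc hκ
    have h3 : 0 < 1 - ν := by linarith
    unfold momFreq; positivity
  · have := hF _ (hP m)
    rw [Real.norm_eq_abs] at this
    linarith [le_abs_self (momFreq ν (P m)), le_abs_self F]
  · calc momGauss ν (P m) v ≤ C * Real.exp (-(k * ‖v‖ ^ 2)) := hG _ (hP m) v
      _ ≤ C * (D * (weight β v)⁻¹) := by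
          gcongr; simpa using hpow 0 v (by norm_num)
      _ = C * D * (weight β v)⁻¹ := by ring
      _ ≤ Λ * (weight β v)⁻¹ := by gcongr; exacts [(hw v).le, by linarith]
  · have h1 := hKF.dist_le_mul _ (hP m) _ (hP m')
    rw [Real.dist_eq, dist_eq_norm] at h1
    refine h1.trans ?_
    calc (KF : ℝ) * ‖P m - P m'‖ ≤ KF * ‖m - m'‖ := by gcongr; exact hPlip m m'
      _ ≤ Λ * ‖m - m'‖ := by gcongr; linarith
  · rw [hexp, hexp]
    refine (abs_exp_sub_exp_le _ _).trans ?_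
    rw [← hexp, ← hexp]
    have h1 := hsum m m' 1 v (by norm_num)
    rw [pow_one] at h1
    have hpos : 0 ≤ momGauss ν (P m) v + momGauss ν (P m') v := by
      rw [hexp, hexp]; positivity
    calc _ ≤ (16 * (KL * ‖m - m'‖) * (1 + ‖v‖ ^ 2)) *
          (momGauss ν (P m) v + momGauss ν (P m') v) := by gcongr; exact hlog m m' v
      _ = 16 * KL * ‖m - m'‖ * ((1 + ‖v‖ ^ 2) *
          (momGauss ν (P m) v + momGauss ν (P m') v)) := by ring
      _ ≤ 16 * KL * ‖m - m'‖ * (2 * C * D * (weight β v)⁻¹) := by gcongr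
      _ = (16 * KL * (2 * C * D)) * ‖m - m'‖ * (weight β v)⁻¹ := by ring
      _ ≤ Λ * ‖m - m'‖ * (weight β v)⁻¹ := by gcongr; exacts [(hw v).le, by linarith]
  · have hpos : 0 < momGauss ν (P m) v := by rw [hexp]; exact Real.exp_pos _
    refine (relEnt_le_sq hpos (maxwellian_pos v)).trans ?_
    rw [← hmax v, hexp m, hexp mom₀, Real.log_exp, Real.log_exp, ← hexp, ← hexp]
    have h1 := hsum m mom₀ 2 v (by norm_num)
    have h2 : (quadPoly (logCoef ν (P m)) v - quadPoly (logCoef ν (P mom₀)) v) ^ 2 ≤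
        (16 * (KL * ‖m - mom₀‖) * (1 + ‖v‖ ^ 2)) ^ 2 := by
      rw [← sq_abs]
      exact pow_le_pow_left₀ (abs_nonneg _) (hlog m mom₀ v) 2
    have hpos : 0 ≤ momGauss ν (P m) v + momGauss ν (P mom₀) v := by
      rw [hexp, hexp]; positivity
    calc _ ≤ (16 * (KL * ‖m - mom₀‖) * (1 + ‖v‖ ^ 2)) ^ 2 *
          (momGauss ν (P m) v + momGauss ν (P mom₀) v) := by gcongr
      _ = (16 * KL) ^ 2 * ‖m - mom₀‖ ^ 2 * ((1 + ‖v‖ ^ 2) ^ 2 *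
          (momGauss ν (P m) v + momGauss ν (P mom₀) v)) := by ring
      _ ≤ (16 * KL) ^ 2 * ‖m - mom₀‖ ^ 2 * (2 * C * D * (weight β v)⁻¹) := by gcongr
      _ = ((16 * KL) ^ 2 * (2 * C * D)) * ‖m - mom₀‖ ^ 2 * (weight β v)⁻¹ := by ring
      _ ≤ Λ * ‖m - mom₀‖ ^ 2 * (weight β v)⁻¹ := by gcongr; exacts [(hw v).le, by linarith]

/-! ### Profiles with bounded weighted norm -/

/-- A nonnegative velocity profile with weighted bound `N`. -/
structure Profile (β N : ℝ) (f : R3 → ℝ) : Prop where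
  meas : AEStronglyMeasurable f volume
  nonneg : ∀ᵐ v, 0 ≤ f v
  le : ∀ᵐ v, f v ≤ N * (weight β v)⁻¹

/-- The mass and energy `∫ (1 + |v|²) / w dv` of the reciprocal weight. -/
def weightMass (β : ℝ) : ℝ := ∫ v : R3, (1 + ‖v‖ ^ 2) / weight β v

lemma weightMass_nonneg (β : ℝ) : 0 ≤ weightMass β :=
  integral_nonneg fun v => div_nonneg (by positivity) (weight_pos β v).le

section

variable {β N : ℝ} {f : R3 → ℝ}

lemma Profile.energy_le (hf : Profile β N f) :
    ∀ᵐ v, (1 + ‖v‖ ^ 2) * |f v| ≤ N * ((1 + ‖v‖ ^ 2) / weight β v) := by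
  filter_upwards [hf.nonneg, hf.le] with v h1 h2
  rw [abs_of_nonneg h1, mul_div_assoc', mul_comm N, mul_div_assoc, div_eq_mul_inv]
  gcongr

lemma Profile.finiteEnergy (hf : Profile β N f) (hβ : 5 < β) : FiniteEnergy f := by
  refine ((integrable_one_add_sq_div_weight hβ).const_mul N).mono'
    (AEStronglyMeasurable.mul (by fun_prop) hf.meas) ?_
  filter_upwards [hf.energy_le] with v hv
  rwa [Real.norm_eq_abs, abs_mul, abs_of_nonneg (by positivity : (0 : ℝ) ≤ 1 + ‖v‖ ^ 2)]

lemma Profile.norm_moments_le (hf : Profile β N f) (hβ : 5 < β) :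
    ‖moments f‖ ≤ 16 * (N * weightMass β) := by
  have := ESBGK.norm_moments_le ((integrable_one_add_sq_div_weight hβ).const_mul N) hf.energy_le
  rwa [integral_const_mul] at this

lemma centred_moments (hf : FiniteEnergy f) (b : R3) (i j : Fin 3) :
    centred (moments f) b i j = ∫ v : R3, (v - b) i * (v - b) j * f v :=
  (hf.integral_quadratic b i j).2.symm

lemma quad_centred_moments (hf : FiniteEnergy f) (b x : R3) :
    Integrable (fun v : R3 => (∑ i, x i * (v - b) i) ^ 2 * f v) ∧
    ∑ i, ∑ j, x i * x j * centred (moments f) b i j =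
      ∫ v : R3, (∑ i, x i * (v - b) i) ^ 2 * f v := by
  have i2 := fun i j => (hf.integral_quadratic b i j).1
  have e : ∀ v : R3, (∑ i, x i * (v - b) i) ^ 2 * f v =
      ∑ i, ∑ j, x i * x j * ((v - b) i * (v - b) j * f v) := fun v => by
    simp only [Fin.sum_univ_three]; ring
  simp only [e]
  have j2 : ∀ i, Integrable fun v : R3 => ∑ j, x i * x j * ((v - b) i * (v - b) j * f v) :=
    fun i => integrable_finsetSum _ fun j _ => (i2 i j).const_mul _
  refine ⟨integrable_finsetSum _ fun i _ => j2 i, ?_⟩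
  rw [integral_finsetSum _ fun i _ => j2 i]
  simp_rw [integral_finsetSum _ fun j _ => (i2 _ j).const_mul _, integral_const_mul,
    centred_moments hf]

lemma sum_centred_moments (hf : FiniteEnergy f) (b : R3) :
    Integrable (fun v : R3 => ‖v - b‖ ^ 2 * f v) ∧
    ∑ i, centred (moments f) b i i = ∫ v : R3, ‖v - b‖ ^ 2 * f v := by
  have i2 := fun i => (hf.integral_quadratic b i i).1
  simp only [norm_sq_eq_sum, Finset.sum_mul, centred_moments hf]
  exact ⟨integrable_finsetSum _ fun i _ => i2 i, (integral_finsetSum _ fun i _ => i2 i).symm⟩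

lemma momBox_moments {c B κ : ℝ} (hf : FiniteEnergy f) (h0 : ∀ᵐ v, 0 ≤ f v)
    (hB : ‖moments f‖ ≤ B) (hc : c ≤ momDensity (moments f))
    (hκ : ∀ b, κ ≤ ∑ i, centred (moments f) b i i) : MomBox c B κ (moments f) := by
  refine ⟨hB, hc, fun i j => ?_, hκ, fun b x => ?_, fun b x => ?_⟩
  · simp only [moments_apply]; congr 1; ext v; ring
  · rw [(quad_centred_moments hf b x).2]
    refine integral_nonneg_of_ae ?_
    filter_upwards [h0] with v hv
    exact mul_nonneg (sq_nonneg _) hv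
  · rw [(quad_centred_moments hf b x).2, (sum_centred_moments hf b).2, ← integral_const_mul]
    refine integral_mono_ae (quad_centred_moments hf b x).1
      ((sum_centred_moments hf b).1.const_mul _) ?_
    filter_upwards [h0] with v hv
    rw [← mul_assoc]
    gcongr
    have h1 := abs_real_inner_le_norm x (v - b)
    have h2 : inner ℝ x (v - b) = ∑ i, x i * (v - b) i := by
      simp [PiLp.inner_apply, mul_comm]
    rw [h2] at h1
    rw [← sq_abs, ← mul_pow]
    gcongr

/-- A bounded profile with mass at least `c` is not concentrated, so that its energy about every
point is bounded below. -/
lemma exists_momBox (β : ℝ) (hβ : 5 < β) (N : ℝ) {c : ℝ} (hc : 0 < c) :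
    ∃ κ > 0, ∀ f, Profile β N f → c ≤ momDensity (moments f) →
      ∀ b, κ ≤ ∑ i, centred (moments f) b i i := by
  obtain ⟨r, hr, hrN⟩ : ∃ r > 0, |N| * volume.real (Metric.closedBall (0 : R3) r) ≤ c / 2 := by
    have h1 : Filter.Tendsto (fun r : ℝ => |N| * (r ^ 3 * volume.real (Metric.ball (0 : R3) 1)))
        (nhdsWithin 0 (Ioi 0)) (nhds (|N| * (0 ^ 3 * volume.real (Metric.ball (0 : R3) 1)))) := by
      refine Filter.Tendsto.mono_left (Continuous.tendsto (by fun_prop) 0) nhdsWithin_le_nhds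
    simp only [ne_eq, OfNat.ofNat_ne_zero, not_false_eq_true, zero_pow, zero_mul, mul_zero] at h1
    obtain ⟨r, hr, hr'⟩ := ((h1.eventually_lt_const (half_pos hc)).and self_mem_nhdsWithin).exists
    refine ⟨r, hr', ?_⟩
    have := Measure.addHaar_real_closedBall (volume : Measure R3) 0 (le_of_lt hr')
    rw [finrank_euclideanSpace, Fintype.card_fin] at this
    rw [this]; exact hr.le
  refine ⟨r ^ 2 * (c / 2), by positivity, fun f hf hρ b => ?_⟩
  have hfe := hf.finiteEnergy hβ
  rw [(sum_centred_moments hfe b).2]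
  rw [← density_eq, density] at hρ
  have hI := (sum_centred_moments hfe b).1
  have hball : Integrable ((Metric.closedBall b r).indicator fun _ => |N|) volume :=
    (integrable_indicator_iff measurableSet_closedBall).2
      (integrableOn_const (measure_closedBall_lt_top.ne))
  have h1 : ∀ᵐ v, f v ≤ (r ^ 2)⁻¹ * (‖v - b‖ ^ 2 * f v) +
      (Metric.closedBall b r).indicator (fun _ => |N|) v := by
    filter_upwards [hf.nonneg, hf.le] with v h0 hle
    by_cases hv : v ∈ Metric.closedBall b r
    · rw [indicator_of_mem hv]
      have h2 : f v ≤ |N| := by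
        refine hle.trans ?_
        have h3 : (weight β v)⁻¹ ≤ 1 := inv_le_one_of_one_le₀ (one_le_weight (by linarith) v)
        have h4 : 0 < (weight β v)⁻¹ := inv_pos.2 (weight_pos β v)
        nlinarith [le_abs_self N, abs_nonneg N]
      have : 0 ≤ (r ^ 2)⁻¹ * (‖v - b‖ ^ 2 * f v) := by positivity
      linarith
    · rw [indicator_of_notMem hv, add_zero]
      rw [Metric.mem_closedBall, dist_eq_norm, not_le] at hv
      have h2 : 1 ≤ (r ^ 2)⁻¹ * ‖v - b‖ ^ 2 := by
        rw [← div_eq_inv_mul, one_le_div (by positivity)]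
        gcongr
      rw [← mul_assoc]
      exact le_mul_of_one_le_left h0 h2
  have h2 := integral_mono_ae hfe.integrable ((hI.const_mul _).add hball) h1
  simp only [Pi.add_apply] at h2
  rw [integral_add (hI.const_mul _) hball, integral_const_mul,
    integral_indicator measurableSet_closedBall, setIntegral_const, smul_eq_mul,
    Measure.addHaar_real_closedBall_center, mul_comm (volume.real _)] at h2
  have h3 : c / 2 ≤ (r ^ 2)⁻¹ * ∫ v : R3, ‖v - b‖ ^ 2 * f v := by linarith
  rw [← div_eq_inv_mul, le_div_iff₀ (by positivity)] at h3
  linarith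

/-- Moments close to those of `μ` lie in every box that leaves some room. -/
lemma momBox_of_near {c B κ : ℝ} (hf : FiniteEnergy f) (h0 : ∀ᵐ v, 0 ≤ f v)
    (hnear : ‖moments f - mom₀‖ ≤ 1 / 4) (hc : c ≤ 1 / 2) (hB : ‖mom₀‖ + 1 ≤ B) (hκ : κ ≤ 1) :
    MomBox c B κ (moments f) := by
  have hcoord : ∀ p, |moments f p - mom₀ p| ≤ 1 / 4 := fun p =>
    (abs_apply_le_norm (moments f - mom₀) p).trans hnear
  have hd := hcoord (none, none)
  rw [mom₀_apply, if_pos rfl, abs_le] at hd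
  refine momBox_moments hf h0 ?_ ?_ fun b => ?_
  · have := norm_le_norm_add_norm_sub' (moments f) mom₀
    linarith
  · have : momDensity (moments f) = moments f (none, none) := rfl
    linarith
  · have h : ∀ i, 1 / 2 ≤ centred (moments f) b i i := fun i => by
      have h1 := hcoord (some i, some i)
      have h2 := hcoord (none, some i)
      rw [mom₀_apply, if_pos rfl, abs_le] at h1
      rw [mom₀_apply, if_neg (by simp), abs_le, sub_zero] at h2
      simp only [centred]
      nlinarith [sq_nonneg (b i - 1), sq_nonneg (b i + 1), sq_nonneg (b i)]
    calc κ ≤ ∑ _i : Fin 3, (1 / 2 : ℝ) := by simp; linarith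
      _ ≤ _ := Finset.sum_le_sum fun i _ => h i

lemma momBox_mom₀ {c B κ : ℝ} (hc : c ≤ 1 / 2) (hB : ‖mom₀‖ + 1 ≤ B) (hκ : κ ≤ 1) :
    MomBox c B κ mom₀ :=
  momBox_of_near finiteEnergy_maxwellian (Filter.Eventually.of_forall fun v => (maxwellian_pos v).le)
    (by simp [mom₀]) hc hB hκ

/-! ### Entropy of bounded profiles -/

lemma Profile.integrable_relEnt (hf : Profile β N f) (hβ : 5 < β) :
    Integrable fun v => relEnt (f v) (maxwellian v) := by
  set A := Real.log (|N| + 1) + 3 / 2 * Real.log (2 * Real.pi) + 1 with hA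
  have hlN : 0 ≤ Real.log (|N| + 1) := Real.log_nonneg (by linarith [abs_nonneg N])
  have hl2 : 0 ≤ Real.log (2 * Real.pi) := Real.log_nonneg (by nlinarith [Real.pi_gt_three])
  refine (((hf.finiteEnergy hβ).const_mul A).add integrable_maxwellian).mono' ?_ ?_
  · have h1 : AEStronglyMeasurable (fun v => f v * Real.log (f v)) volume :=
      Real.continuous_mul_log.comp_aestronglyMeasurable hf.meas
    have h2 : AEStronglyMeasurable (fun v => Real.log (maxwellian v)) volume :=
      Measurable.aestronglyMeasurable (by fun_prop)
    exact ((h1.sub (hf.meas.mul h2)).sub hf.meas).add (by fun_prop)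
  · filter_upwards [hf.nonneg, hf.le] with v h0 hle
    rw [Real.norm_eq_abs, abs_of_nonneg (relEnt_nonneg h0 (maxwellian_pos v)), relEnt,
      log_maxwellian]
    simp only [Pi.add_apply]
    have h1 : f v ≤ |N| + 1 := by
      refine hle.trans ?_
      have h3 : (weight β v)⁻¹ ≤ 1 := inv_le_one_of_one_le₀ (one_le_weight (by linarith) v)
      have h4 : 0 < (weight β v)⁻¹ := inv_pos.2 (weight_pos β v)
      nlinarith [le_abs_self N, abs_nonneg N]
    have h2 : f v * Real.log (f v) ≤ f v * Real.log (|N| + 1) := by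
      rcases h0.eq_or_lt with h | h
      · rw [← h]; simp
      · gcongr
    have h5 : 0 ≤ ‖v‖ ^ 2 * f v := by positivity
    rw [hA]
    nlinarith [mul_nonneg hlN h5, mul_nonneg hl2 h5]

/-- The relative entropy of a velocity profile with respect to `μ`. -/
def velEntropy (f : R3 → ℝ) : ℝ := ∫ v, relEnt (f v) (maxwellian v)

lemma Profile.velEntropy_nonneg (hf : Profile β N f) : 0 ≤ velEntropy f :=
  integral_nonneg_of_ae <| by
    filter_upwards [hf.nonneg] with v h0
    exact relEnt_nonneg h0 (maxwellian_pos v)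

lemma Profile.ofReal_velEntropy (hf : Profile β N f) (hβ : 5 < β) :
    ENNReal.ofReal (velEntropy f) = ∫⁻ v, ENNReal.ofReal (relEnt (f v) (maxwellian v)) :=
  ofReal_integral_eq_lintegral_ofReal (hf.integrable_relEnt hβ) <| by
    filter_upwards [hf.nonneg] with v h0
    exact relEnt_nonneg h0 (maxwellian_pos v)

/-- The mass of the kernel `entKernel`. -/
def entMass : ℝ := ∫ v, entKernel v

lemma entMass_nonneg : 0 ≤ entMass := integral_nonneg entKernel_nonneg

/-- Deviations of the moments from equilibrium are controlled by the relative entropy. -/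
lemma Profile.moments_sub_le (hf : Profile β N f) (hβ : 5 < β) {l : ℝ} (hl : 0 < l)
    (hl' : l ≤ 1 / 4) :
    ‖moments f - mom₀‖ ≤ 16 * (l⁻¹ * velEntropy f + l * entMass) := by
  rw [mom₀, ← (hf.finiteEnergy hβ).moments_sub finiteEnergy_maxwellian]
  have h := ESBGK.norm_moments_le (f := fun v => f v - maxwellian v)
    (((hf.integrable_relEnt hβ).const_mul l⁻¹).add (integrable_entKernel.const_mul l)) (by
      filter_upwards [hf.nonneg] with v h0
      exact moment_le_relEnt h0 v hl hl')
  simp only [Pi.add_apply] at h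
  rwa [integral_add ((hf.integrable_relEnt hβ).const_mul l⁻¹) (integrable_entKernel.const_mul l),
    integral_const_mul, integral_const_mul] at h

/-- A Csiszár–Kullback inequality with quadratic weights, for bounded profiles. -/
lemma exists_moments_sub_sq_le (β : ℝ) (hβ : 5 < β) (N : ℝ) :
    ∃ C : ℝ, 0 < C ∧ ∀ f, Profile β N f → ‖moments f - mom₀‖ ^ 2 ≤ C * velEntropy f := by
  set D := 16 * (N * weightMass β) + ‖mom₀‖ with hD
  have hE := entMass_nonneg
  refine ⟨16 * D ^ 2 + 256 * (1 + entMass) ^ 2, by positivity, fun f hf => ?_⟩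
  have he := hf.velEntropy_nonneg
  set e := velEntropy f with hedef
  set d := ‖moments f - mom₀‖ with hd
  have hd0 : 0 ≤ d := norm_nonneg _
  by_cases h1 : e ≤ 1 / 16
  · suffices h : d ^ 2 ≤ 256 * (1 + entMass) ^ 2 * e by nlinarith [sq_nonneg D]
    rcases he.eq_or_lt with h0 | h0
    · have : d ≤ 0 := by
        refine le_of_forall_pos_le_add fun ε hε => ?_
        have hl : 0 < min (1 / 4) (ε / (16 * (entMass + 1))) := by positivity
        have := hf.moments_sub_le hβ hl (min_le_left _ _)
        rw [← hedef, ← h0, mul_zero, zero_add] at this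
        refine this.trans ?_
        rw [zero_add]
        calc 16 * (min (1 / 4) (ε / (16 * (entMass + 1))) * entMass)
            ≤ 16 * ((ε / (16 * (entMass + 1))) * (entMass + 1)) := by
              gcongr
              · exact min_le_right _ _
              · linarith
          _ = ε := by field_simp
      rw [← h0, le_antisymm this hd0]; simp
    · have hs : 0 < √e := Real.sqrt_pos.2 h0
      have hs' : √e ≤ 1 / 4 := by
        rw [Real.sqrt_le_left (by norm_num)]; norm_num; exact h1
      have h2 := hf.moments_sub_le hβ hs hs'
      rw [← hedef, ← hd] at h2
      have h3 : (√e)⁻¹ * e = √e := by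
        rw [inv_mul_eq_div, Real.div_sqrt]
      rw [h3] at h2
      have h4 : d ≤ 16 * (1 + entMass) * √e := by linarith
      calc d ^ 2 ≤ (16 * (1 + entMass) * √e) ^ 2 := by gcongr
        _ = 256 * (1 + entMass) ^ 2 * √e ^ 2 := by ring
        _ = _ := by rw [Real.sq_sqrt he]
  · have h2 : d ≤ D := (norm_sub_le _ _).trans (by
      rw [hD]; gcongr; exact hf.norm_moments_le hβ)
    have h3 : d ^ 2 ≤ D ^ 2 := by gcongr
    push Not at h1
    nlinarith [sq_nonneg D, sq_nonneg (1 + entMass)]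

lemma Profile.stress_posDef (hf : Profile β N f) (hβ : 5 < β) {c B κ : ℝ} (hc : 0 < c)
    (hbox : MomBox c B κ (moments f)) : (momStress (moments f)).PosDef := by
  have hfe := hf.finiteEnergy hβ
  have hρ := hbox.density_pos hc
  set u := momVel (moments f) with hu
  refine Matrix.PosDef.of_dotProduct_mulVec_pos ?_ fun x hx => ?_
  · ext i j
    simp only [Matrix.conjTranspose_apply, star_trivial]
    exact hbox.stress_symm j i
  · have h := quad_centred_moments hfe u (WithLp.toLp 2 x)
    have e : ∑ i, ∑ j, x i * x j * centred (moments f) u i j =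
        momDensity (moments f) * ∑ i, ∑ j, x i * x j * momStress (moments f) i j := by
      simp only [hu, centred_momVel hρ.ne', Fin.sum_univ_three]; ring
    rw [star_trivial, dotProduct_mulVec_eq]
    have h2 := h.2
    simp only at h2
    rw [e] at h2
    refine pos_of_mul_pos_right (?_ : 0 < momDensity (moments f) * _) hρ.le
    rw [h2]
    have hnn : 0 ≤ᵐ[volume] fun v : R3 => (∑ i, x i * (v - u) i) ^ 2 * f v := by
      filter_upwards [hf.nonneg] with v h0
      exact mul_nonneg (sq_nonneg _) h0
    refine lt_of_le_of_ne (integral_nonneg_of_ae hnn) fun h0 => ?_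
    have h3 := (integral_eq_zero_iff_of_nonneg_ae hnn h.1).1 h0.symm
    have hplane : ∀ᵐ v : R3, ∑ i, x i * (v - u) i ≠ 0 := by
      set φ : R3 →ₗ[ℝ] ℝ := (innerₛₗ ℝ (WithLp.toLp 2 x : R3)) with hφ
      have hφe : ∀ v : R3, φ v = ∑ i, x i * v i := fun v => by
        simp [hφ, PiLp.inner_apply, mul_comm]
      have hne : (LinearMap.ker φ) ≠ ⊤ := fun htop => by
        have : (WithLp.toLp 2 x : R3) ∈ LinearMap.ker φ := by rw [htop]; trivial
        rw [LinearMap.mem_ker] at this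
        have h5 : (WithLp.toLp 2 x : R3) = 0 := by
          simpa [hφ] using this
        exact hx (by simpa using congrArg WithLp.ofLp h5)
      have h5 := Measure.addHaar_submodule (volume : Measure R3) _ hne
      have h6 : volume ((fun v : R3 => v - u) ⁻¹' (LinearMap.ker φ : Set R3)) = 0 :=
        (measurePreserving_sub_right volume u).quasiMeasurePreserving.preimage_null h5
      rw [ae_iff]
      refine measure_mono_null (fun v hv => ?_) h6
      simp only [ne_eq, not_not, mem_ofPred_eq] at hv
      simp only [mem_preimage, SetLike.mem_coe, LinearMap.mem_ker, hφe]
      exact hv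
    have hf0 : ∀ᵐ v, f v = 0 := by
      filter_upwards [h3, hplane] with v h4 h5
      simp only [Pi.zero_apply] at h4
      exact (mul_eq_zero.1 h4).resolve_left (pow_ne_zero 2 h5)
    have : momDensity (moments f) = 0 := by
      rw [← density_eq, density, integral_eq_zero_of_ae hf0]
    exact hρ.ne' this

/-- The entropy inequality for the ES-BGK relaxation: the anisotropic Gaussian has at most the
relative entropy of the profile it is built from. -/
lemma Profile.velEntropy_momGauss_le (hf : Profile β N f) (hβ : 5 < β) {ν c B κ : ℝ}
    (hν : -1 / 2 < ν) (hν' : ν < 1) (hc : 0 < c) (hκ : 0 < κ)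
    (hbox : MomBox c B κ (moments f)) :
    velEntropy (momGauss ν (moments f)) ≤ velEntropy f := by
  have hfe := hf.finiteEnergy hβ
  have hρ := hbox.density_pos hc
  have hS := hf.stress_posDef hβ hc hbox
  have hT := hbox.tensor_posDef (ν := ν) hc hκ hν hν'
  have hfields : HasFields f (momDensity (moments f)) (momVel (moments f))
      (momStress (moments f)) := by
    refine ⟨hfe, ?_, fun i => ?_, fun i j => ?_⟩
    · rw [← density_eq, density]
    · have i0 := hfe.integrable
      have i1 := hfe.integrable_extVel none (some i)
      simp only [extVel, one_mul] at i1
      simp only [PiLp.sub_apply, sub_mul]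
      rw [integral_sub i1 (i0.const_mul _), integral_const_mul]
      have e1 : ∫ v, f v = momDensity (moments f) := by rw [← density_eq, density]
      have e2 : ∫ v : R3, v i * f v = moments f (none, some i) := by simp [extVel]
      rw [e1, e2]
      simp only [momVel, PiLp.smul_apply, smul_eq_mul]
      field_simp; ring
    · rw [← centred_moments hfe, centred_momVel hρ.ne']
  have htr : (momTensor ν (moments f)).trace = (momStress (moments f)).trace := by
    rw [momTensor, Matrix.trace_add, Matrix.trace_smul, Matrix.trace_smul, Matrix.trace_one]
    have : momTemp (moments f) = (momStress (moments f)).trace / 3 := rfl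
    rw [this]; simp; ring
  exact (hfields.entropy_le hS hT hρ htr (det_stress_le hν hν' hS) hf.nonneg
    (hf.integrable_relEnt hβ)).2

end

/-! ### Transport and the truncated mild formulation -/

lemma measurable_intervalIntegral {α : Type*} [MeasurableSpace α] {f : α → ℝ → ℝ}
    (hf : Measurable fun p : α × ℝ => f p.1 p.2) {a b : α → ℝ} (ha : Measurable a)
    (hb : Measurable b) : Measurable fun p => ∫ τ in a p..b p, f p τ := by
  have key : ∀ {a b : α → ℝ}, Measurable a → Measurable b →
      Measurable fun p => ∫ τ in Ioc (a p) (b p), f p τ := fun {a b} ha hb => by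
    have hS : MeasurableSet {p : α × ℝ | a p.1 < p.2 ∧ p.2 ≤ b p.1} :=
      (measurableSet_lt (ha.comp measurable_fst) measurable_snd).inter
        (measurableSet_le measurable_snd (hb.comp measurable_fst))
    have h1 := ((hf.indicator hS).stronglyMeasurable.integral_prod_right'
      (ν := (volume : Measure ℝ))).measurable
    have e : (fun p => ∫ τ in Ioc (a p) (b p), f p τ) = fun p => ∫ τ,
        {p : α × ℝ | a p.1 < p.2 ∧ p.2 ≤ b p.1}.indicator (fun p => f p.1 p.2) (p, τ) := by
      ext p
      rw [← integral_indicator measurableSet_Ioc]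
      congr 1
    rw [e]; exact h1
  exact (key ha hb).sub (key hb ha)

section Transport

variable {Ω : Type} [AddCommGroup Ω] [MeasureSpace Ω]

/-- The properties of a position space `Ω` and of the map `pr : ℝ³ → Ω` turning displacements into
translations that the argument uses: translations are measurable and preserve volume, `pr` is a
measurable homomorphism, and the free flow during a time bounded below spreads bounded sets of
velocities over `Ω` with bounded density. -/
structure IsCover (pr : R3 → Ω) : Prop where
  measurable_sub : Measurable fun p : Ω × Ω => p.1 - p.2
  measurable_pr : Measurable pr
  map_add : ∀ a b, pr (a + b) = pr a + pr b
  shift : ∀ c : Ω, MeasurePreserving (fun x : Ω => x - c) volume volume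
  spread : ∀ δ R : ℝ, 0 < δ → ∃ C : ℝ≥0, ∀ θ, δ ≤ θ → ∀ x : Ω, ∀ g : Ω → ℝ≥0∞, Measurable g →
    ∫⁻ v in Metric.closedBall (0 : R3) R, g (x - pr (θ • v)) ≤ C * ∫⁻ y, g y

namespace IsCover

variable {pr : R3 → Ω}

@[fun_prop]
lemma measurable_shift (hp : IsCover pr) {α : Type*} [MeasurableSpace α] {f : α → Ω} {g : α → R3}
    (hf : Measurable f) (hg : Measurable g) : Measurable fun a => f a - pr (g a) :=
  hp.measurable_sub.comp (hf.prodMk (hp.measurable_pr.comp hg))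

lemma sub_sub (hp : IsCover pr) (x : Ω) (v : R3) (s t r : ℝ) :
    x - pr ((t - s) • v) - pr ((s - r) • v) = x - pr ((t - r) • v) := by
  rw [_root_.sub_sub, ← hp.map_add, ← add_smul]
  congr 3; ring

/-- Free transport preserves the volume of phase space. -/
lemma measurePreserving_flow (hp : IsCover pr) [SigmaFinite (volume : Measure Ω)] (θ : ℝ) :
    MeasurePreserving (fun p : Ω × R3 => (p.1 - pr (θ • p.2), p.2)) volume volume := by
  have h1 : MeasurePreserving (fun q : R3 × Ω => (q.1, q.2 - pr (θ • q.1)))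
      ((volume : Measure R3).prod volume) ((volume : Measure R3).prod volume) :=
    (MeasurePreserving.id volume).skew_product (g := fun v y => y - pr (θ • v))
      (hp.measurable_shift measurable_snd (by fun_prop))
      (Filter.Eventually.of_forall fun v => (hp.shift _).map_eq)
  exact Measure.measurePreserving_swap.comp (h1.comp Measure.measurePreserving_swap)

end IsCover

/-- A measurable phase-space density with `0 ≤ F₀ ≤ N / w` everywhere. -/
structure Datum (β N : ℝ) (F₀ : Ω → R3 → ℝ) : Prop where
  meas : Measurable fun p : Ω × R3 => F₀ p.1 p.2
  nonneg : ∀ x v, 0 ≤ F₀ x v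
  le : ∀ x v, F₀ x v ≤ N * (weight β v)⁻¹

variable {ν β : ℝ}

/-- The relaxation frequency along the characteristic through `(t, x, v)`. -/
def charFreq (L : RelaxLaw ν β) (pr : R3 → Ω) (m : ℝ → Ω → Mom) (t : ℝ) (x : Ω) (v : R3) (s : ℝ) :
    ℝ := L.freq (m s (x - pr ((t - s) • v)))

/-- The equilibrium along the characteristic through `(t, x, v)`. -/
def charEquil (L : RelaxLaw ν β) (pr : R3 → Ω) (m : ℝ → Ω → Mom) (t : ℝ) (x : Ω) (v : R3) (s : ℝ) :
    ℝ := L.equil (m s (x - pr ((t - s) • v))) v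

/-- The mild solution of the transport-relaxation equation with given moment field `m`. -/
def flow (L : RelaxLaw ν β) (pr : R3 → Ω) (F₀ : Ω → R3 → ℝ) (m : ℝ → Ω → Mom) (t : ℝ) (x : Ω)
    (v : R3) : ℝ :=
  relax (charFreq L pr m t x v) (charEquil L pr m t x v) (F₀ (x - pr (t • v)) v) t

variable {L : RelaxLaw ν β} {pr : R3 → Ω} {F₀ : Ω → R3 → ℝ} {m m' : ℝ → Ω → Mom} {N : ℝ}

lemma measurable_charFreq (hp : IsCover pr) (hm : Measurable fun q : ℝ × Ω => m q.1 q.2) :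
    Measurable fun q : (ℝ × Ω × R3) × ℝ => charFreq L pr m q.1.1 q.1.2.1 q.1.2.2 q.2 := by
  unfold charFreq
  exact L.measurable_freq.comp (hm.comp (measurable_snd.prodMk
    (hp.measurable_shift (by fun_prop) (by fun_prop))))

lemma measurable_charEquil (hp : IsCover pr) (hm : Measurable fun q : ℝ × Ω => m q.1 q.2) :
    Measurable fun q : (ℝ × Ω × R3) × ℝ => charEquil L pr m q.1.1 q.1.2.1 q.1.2.2 q.2 := by
  unfold charEquil
  exact L.measurable_equil.comp ((hm.comp (measurable_snd.prodMk
    (hp.measurable_shift (by fun_prop) (by fun_prop)))).prodMk (by fun_prop))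

lemma bddMeas_charFreq (hp : IsCover pr) (hm : Measurable fun q : ℝ × Ω => m q.1 q.2)
    (t : ℝ) (x : Ω) (v : R3) : BddMeas (charFreq L pr m t x v) :=
  .of_bound ((measurable_charFreq hp hm).comp (f := fun s => ((t, x, v), s)) (by fun_prop))
    (C := L.Λ) fun s => by
      rw [charFreq, abs_of_nonneg (L.freq_nonneg _)]; exact L.freq_le _

lemma bddMeas_charEquil (hp : IsCover pr) (hm : Measurable fun q : ℝ × Ω => m q.1 q.2)
    (t : ℝ) (x : Ω) (v : R3) : BddMeas (charEquil L pr m t x v) :=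
  .of_bound ((measurable_charEquil hp hm).comp (f := fun s => ((t, x, v), s)) (by fun_prop))
    (C := L.Λ * (weight β v)⁻¹) fun s => by
      rw [charEquil, abs_of_pos (L.equil_pos _ _)]; exact L.equil_le _ _

lemma measurable_flow (hp : IsCover pr) (hF : Datum β N F₀)
    (hm : Measurable fun q : ℝ × Ω => m q.1 q.2) :
    Measurable fun q : ℝ × Ω × R3 => flow L pr F₀ m q.1 q.2.1 q.2.2 := by
  have h1 := measurable_charFreq (L := L) hp hm
  have h2 := measurable_charEquil (L := L) hp hm
  unfold flow relax linearSol
  refine ((hF.meas.comp ((hp.measurable_shift (by fun_prop) (by fun_prop)).prodMk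
    (by fun_prop))).mul (Real.measurable_exp.comp (measurable_intervalIntegral h1
      measurable_const measurable_fst).neg)).add ?_
  refine measurable_intervalIntegral (f := fun (q : ℝ × Ω × R3) s =>
    Real.exp (-∫ τ in s..q.1, charFreq L pr m q.1 q.2.1 q.2.2 τ) *
      (charFreq L pr m q.1 q.2.1 q.2.2 s * charEquil L pr m q.1 q.2.1 q.2.2 s)) ?_
    measurable_const measurable_fst
  refine (Real.measurable_exp.comp (Measurable.neg ?_)).mul (h1.mul h2)
  exact measurable_intervalIntegral (f := fun (q : (ℝ × Ω × R3) × ℝ) τ =>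
    charFreq L pr m q.1.1 q.1.2.1 q.1.2.2 τ)
    (h1.comp (f := fun p : ((ℝ × Ω × R3) × ℝ) × ℝ => (p.1.1, p.2)) (by fun_prop))
    measurable_snd (by fun_prop)

lemma flow_nonneg (hp : IsCover pr) (hF : Datum β N F₀)
    (hm : Measurable fun q : ℝ × Ω => m q.1 q.2) {t : ℝ} (ht : 0 ≤ t) (x : Ω) (v : R3) :
    0 ≤ flow L pr F₀ m t x v :=
  relax_nonneg (bddMeas_charFreq hp hm t x v) (bddMeas_charEquil hp hm t x v) ht
    (fun _ _ => L.freq_nonneg _) (hF.nonneg _ _) (fun _ _ => (L.equil_pos _ _).le)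

lemma flow_le (hp : IsCover pr) (hF : Datum β N F₀) (hN : L.Λ ≤ N)
    (hm : Measurable fun q : ℝ × Ω => m q.1 q.2) {t : ℝ} (ht : 0 ≤ t) (x : Ω) (v : R3) :
    flow L pr F₀ m t x v ≤ N * (weight β v)⁻¹ :=
  relax_le (bddMeas_charFreq hp hm t x v) (bddMeas_charEquil hp hm t x v) ht
    (fun _ _ => L.freq_nonneg _) (hF.le _ _) fun _ _ => (L.equil_le _ _).trans (by
      have := inv_pos.2 (weight_pos β v); gcongr)

lemma profile_flow (hp : IsCover pr) (hF : Datum β N F₀) (hN : L.Λ ≤ N)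
    (hm : Measurable fun q : ℝ × Ω => m q.1 q.2) {t : ℝ} (ht : 0 ≤ t) (x : Ω) :
    Profile β N (flow L pr F₀ m t x) where
  meas := ((measurable_flow hp hF hm).comp (f := fun v => (t, x, v))
    (by fun_prop)).aestronglyMeasurable
  nonneg := .of_forall fun v => flow_nonneg hp hF hm ht x v
  le := .of_forall fun v => flow_le hp hF hN hm ht x v

/-- At an earlier time of the same characteristic, the mild solution is the value at that time of
the same relaxation equation. -/
lemma flow_along (hp : IsCover pr) (t s : ℝ) (x : Ω) (v : R3) :
    flow L pr F₀ m s (x - pr ((t - s) • v)) v =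
      relax (charFreq L pr m t x v) (charEquil L pr m t x v) (F₀ (x - pr (t • v)) v) s := by
  have e1 : charFreq L pr m s (x - pr ((t - s) • v)) v = charFreq L pr m t x v := by
    ext r; simp only [charFreq, hp.sub_sub]
  have e2 : charEquil L pr m s (x - pr ((t - s) • v)) v = charEquil L pr m t x v := by
    ext r; simp only [charEquil, hp.sub_sub]
  have e3 : x - pr ((t - s) • v) - pr (s • v) = x - pr (t • v) := by
    have := hp.sub_sub x v s t 0
    simpa using this
  rw [flow, e1, e2, e3]

lemma abs_linearSol_le {b h e : ℝ → ℝ} {t : ℝ} (ht : 0 ≤ t)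
    (hb0 : ∀ s, 0 ≤ b s) (he : IntervalIntegrable e volume 0 t)
    (hle : ∀ᵐ s, s ∈ Ioc 0 t → |h s| ≤ e s) :
    |linearSol b h 0 t| ≤ ∫ s in (0 : ℝ)..t, e s := by
  rw [linearSol, zero_mul, zero_add, ← Real.norm_eq_abs]
  refine intervalIntegral.norm_integral_le_of_norm_le ht ?_ he
  filter_upwards [hle] with s hs hst
  rw [Real.norm_eq_abs, abs_mul, abs_of_pos (Real.exp_pos _)]
  have h1 : Real.exp (-∫ τ in s..t, b τ) ≤ 1 := by
    rw [Real.exp_le_one_iff, neg_nonpos]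
    exact intervalIntegral.integral_nonneg hst.2 fun τ _ => hb0 τ
  have := hs hst
  nlinarith [abs_nonneg (h s)]

/-- Lipschitz dependence of the mild solution on the moment field. -/
lemma abs_flow_sub_le (hp : IsCover pr) (hF : Datum β N F₀) (hN : L.Λ ≤ N)
    (hm : Measurable fun q : ℝ × Ω => m q.1 q.2) (hm' : Measurable fun q : ℝ × Ω => m' q.1 q.2)
    {t : ℝ} (ht : 0 ≤ t) (x : Ω) (v : R3) {e : ℝ → ℝ} (he : IntervalIntegrable e volume 0 t)
    (hle : ∀ᵐ s, s ∈ Ioc 0 t →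
      ‖m s (x - pr ((t - s) • v)) - m' s (x - pr ((t - s) • v))‖ ≤ e s) :
    |flow L pr F₀ m t x v - flow L pr F₀ m' t x v| ≤
      (L.Λ * (N + L.Λ) * ∫ s in (0 : ℝ)..t, e s) * (weight β v)⁻¹ := by
  have hw := inv_pos.2 (weight_pos β v)
  have hΛ : 0 < L.Λ := zero_lt_one.trans_le L.one_le
  have hb : ∀ {m : ℝ → Ω → Mom}, Measurable (fun q : ℝ × Ω => m q.1 q.2) → ∀ s, 0 ≤ s →
      0 ≤ relax (charFreq L pr m t x v) (charEquil L pr m t x v) (F₀ (x - pr (t • v)) v) s ∧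
      relax (charFreq L pr m t x v) (charEquil L pr m t x v) (F₀ (x - pr (t • v)) v) s ≤
        N * (weight β v)⁻¹ := fun {m} hm s hs => by
    rw [← flow_along hp]
    exact ⟨flow_nonneg hp hF hm hs _ _, flow_le hp hF hN hm hs _ _⟩
  have hbd : ∀ {m : ℝ → Ω → Mom}, Measurable (fun q : ℝ × Ω => m q.1 q.2) → ∃ C, ∀ s, 0 ≤ s →
      |relax (charFreq L pr m t x v) (charEquil L pr m t x v) (F₀ (x - pr (t • v)) v) s| ≤ C :=
    fun hm => ⟨_, fun s hs => by
      rw [abs_of_nonneg (hb hm s hs).1]; exact (hb hm s hs).2⟩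
  rw [flow, flow, relax_sub (bddMeas_charFreq hp hm t x v) (bddMeas_charEquil hp hm t x v)
    (bddMeas_charFreq hp hm' t x v) (bddMeas_charEquil hp hm' t x v) _ _ ht (hbd hm') (hbd hm),
    sub_self]
  rw [← intervalIntegral.integral_const_mul, ← intervalIntegral.integral_mul_const]
  refine abs_linearSol_le ht (fun s => L.freq_nonneg _)
    ((he.const_mul _).mul_const _) ?_
  filter_upwards [hle] with s hs hst
  have hd := hs hst
  rw [max_eq_left hst.1.le]
  obtain ⟨y0, yN⟩ := hb hm' s hst.1.le
  set y := relax (charFreq L pr m' t x v) (charEquil L pr m' t x v) (F₀ (x - pr (t • v)) v) s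
  have h1 : |charFreq L pr m t x v s - charFreq L pr m' t x v s| ≤ L.Λ * e s :=
    (L.freq_lip _ _).trans (by gcongr)
  have h2 : |charEquil L pr m' t x v s - y| ≤ N * (weight β v)⁻¹ := by
    have h3 := L.equil_pos (m' s (x - pr ((t - s) • v))) v
    have h4 := L.equil_le (m' s (x - pr ((t - s) • v))) v
    have h5 : L.Λ * (weight β v)⁻¹ ≤ N * (weight β v)⁻¹ := by gcongr
    rw [abs_le, charEquil]
    constructor <;> linarith
  have h3 : |charEquil L pr m t x v s - charEquil L pr m' t x v s| ≤
      L.Λ * e s * (weight β v)⁻¹ :=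
    (L.equil_lip _ _ _).trans (by gcongr)
  have h4 : |charFreq L pr m t x v s| ≤ L.Λ := by
    rw [charFreq, abs_of_nonneg (L.freq_nonneg _)]; exact L.freq_le _
  have he0 : 0 ≤ e s := (norm_nonneg _).trans hd
  refine (abs_add_le _ _).trans ?_
  rw [abs_mul, abs_mul]
  calc _ ≤ (L.Λ * e s) * (N * (weight β v)⁻¹) + L.Λ * (L.Λ * e s * (weight β v)⁻¹) := by
        gcongr
    _ = _ := by ring

/-! ### Global solution of the truncated problem -/

/-- The moments of the mild solution with given moment field. -/
def flowMom (L : RelaxLaw ν β) (pr : R3 → Ω) (F₀ : Ω → R3 → ℝ) (m : ℝ → Ω → Mom) (t : ℝ) (x : Ω) :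
    Mom := moments (flow L pr F₀ m t x)

lemma measurable_moments {α : Type*} [MeasurableSpace α] {F : α → R3 → ℝ}
    (hF : Measurable fun p : α × R3 => F p.1 p.2) : Measurable fun a => moments (F a) := by
  unfold moments
  refine (WithLp.measurable_toLp 2 _).comp (measurable_pi_lambda _ fun p => ?_)
  exact (Measurable.stronglyMeasurable (f := fun q : α × R3 =>
    extVel q.2 p.1 * extVel q.2 p.2 * F q.1 q.2) (by fun_prop)).integral_prod_right'.measurable

lemma measurable_flowMom (hp : IsCover pr) (hF : Datum β N F₀)
    (hm : Measurable fun q : ℝ × Ω => m q.1 q.2) :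
    Measurable fun q : ℝ × Ω => flowMom L pr F₀ m q.1 q.2 :=
  measurable_moments ((measurable_flow hp hF hm).comp
    (f := fun p : (ℝ × Ω) × R3 => (p.1.1, p.1.2, p.2)) (by fun_prop))

lemma norm_moments_sub_le {f g : R3 → ℝ} (hβ : 5 < β) (hf : FiniteEnergy f) (hg : FiniteEnergy g)
    {d : ℝ} (h : ∀ᵐ v, |f v - g v| ≤ d * (weight β v)⁻¹) :
    ‖moments f - moments g‖ ≤ 16 * weightMass β * d := by
  rw [← hf.moments_sub hg]
  have := norm_moments_le (f := fun v => f v - g v)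
    ((integrable_one_add_sq_div_weight hβ).const_mul d) (by
      filter_upwards [h] with v hv
      rw [mul_div_assoc', mul_comm d, mul_div_assoc, div_eq_mul_inv]
      gcongr)
  rw [integral_const_mul] at this
  calc _ ≤ 16 * (d * weightMass β) := this
    _ = _ := by ring

/-- The Lipschitz constant of the map from moment fields to moment fields, per unit of time. -/
def lipConst (L : RelaxLaw ν β) (N : ℝ) : ℝ := 16 * weightMass β * (L.Λ * (N + L.Λ))

lemma lipConst_nonneg (hN : L.Λ ≤ N) : 0 ≤ lipConst L N := by
  have h1 := L.one_le
  have h2 := weightMass_nonneg β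
  have h3 : 0 ≤ N := by linarith
  unfold lipConst
  have : 0 ≤ L.Λ := by linarith
  positivity

lemma flowMom_lip (hp : IsCover pr) (hβ : 5 < β) (hF : Datum β N F₀) (hN : L.Λ ≤ N)
    (hm : Measurable fun q : ℝ × Ω => m q.1 q.2) (hm' : Measurable fun q : ℝ × Ω => m' q.1 q.2)
    {t : ℝ} (ht : 0 ≤ t) (x : Ω) {e : ℝ → ℝ} (he : IntervalIntegrable e volume 0 t)
    (hle : ∀ s, s ∈ Ioc 0 t → ∀ y, ‖m s y - m' s y‖ ≤ e s) :
    ‖flowMom L pr F₀ m t x - flowMom L pr F₀ m' t x‖ ≤ lipConst L N * ∫ s in (0 : ℝ)..t, e s := by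
  have := norm_moments_sub_le hβ ((profile_flow hp hF hN hm ht x).finiteEnergy hβ)
    ((profile_flow hp hF hN hm' ht x).finiteEnergy hβ)
    (.of_forall fun v => abs_flow_sub_le hp hF hN hm hm' ht x v he
      (.of_forall fun s hs => hle s hs _))
  unfold flowMom lipConst
  refine this.trans (le_of_eq ?_)
  ring

/-- The Picard iterates, started from the moments of `μ`. -/
def picard (L : RelaxLaw ν β) (pr : R3 → Ω) (F₀ : Ω → R3 → ℝ) : ℕ → ℝ → Ω → Mom
  | 0 => fun _ _ => mom₀
  | n + 1 => fun t x => flowMom L pr F₀ (picard L pr F₀ n) (max t 0) x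

lemma measurable_picard (hp : IsCover pr) (hF : Datum β N F₀) (n : ℕ) :
    Measurable fun q : ℝ × Ω => picard L pr F₀ n q.1 q.2 := by
  induction n with
  | zero => exact measurable_const
  | succ n ih =>
    exact (measurable_flowMom hp hF ih).comp (f := fun q : ℝ × Ω => (max q.1 0, q.2))
      (by fun_prop)

lemma integral_exp_le {l : ℝ} (hl : 0 < l) (t : ℝ) :
    ∫ s in (0 : ℝ)..t, Real.exp (l * s) ≤ l⁻¹ * Real.exp (l * t) := by
  rw [intervalIntegral.integral_comp_mul_left (fun s => Real.exp s) hl.ne', integral_exp, mul_zero,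
    smul_eq_mul, Real.exp_zero]
  have : 0 < l⁻¹ := inv_pos.2 hl
  nlinarith

/-- One step of the iteration halves the distance, measured with an exponential weight in time. -/
lemma flowMom_contraction (hp : IsCover pr) (hβ : 5 < β) (hF : Datum β N F₀) (hN : L.Λ ≤ N)
    (hm : Measurable fun q : ℝ × Ω => m q.1 q.2) (hm' : Measurable fun q : ℝ × Ω => m' q.1 q.2)
    {t : ℝ} (ht : 0 ≤ t) (x : Ω) {d : ℝ} (hd : 0 ≤ d)
    (hle : ∀ s, s ∈ Ioc 0 t → ∀ y,
      ‖m s y - m' s y‖ ≤ d * Real.exp (2 * (lipConst L N + 1) * s)) :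
    ‖flowMom L pr F₀ m t x - flowMom L pr F₀ m' t x‖ ≤
      d / 2 * Real.exp (2 * (lipConst L N + 1) * t) := by
  have hl := lipConst_nonneg hN
  have h1 := flowMom_lip hp hβ hF hN hm hm' ht x
    (Continuous.intervalIntegrable (by fun_prop) _ _) hle
  refine h1.trans ?_
  rw [intervalIntegral.integral_const_mul]
  have h2 := integral_exp_le (l := 2 * (lipConst L N + 1)) (by linarith) t
  have h3 : lipConst L N * (2 * (lipConst L N + 1))⁻¹ ≤ 1 / 2 := by
    rw [← div_eq_mul_inv, div_le_div_iff₀ (by linarith) (by norm_num)]; linarith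
  calc lipConst L N * (d * ∫ s in (0 : ℝ)..t, Real.exp (2 * (lipConst L N + 1) * s))
      ≤ lipConst L N * (d * ((2 * (lipConst L N + 1))⁻¹ *
        Real.exp (2 * (lipConst L N + 1) * t))) := by gcongr
    _ = (lipConst L N * (2 * (lipConst L N + 1))⁻¹) *
        (d * Real.exp (2 * (lipConst L N + 1) * t)) := by ring
    _ ≤ 1 / 2 * (d * Real.exp (2 * (lipConst L N + 1) * t)) := by gcongr
    _ = _ := by ring

/-- The truncated problem is globally solvable: there is a field of moments that is reproduced by
the mild solution it drives, and the Picard iterates converge to it. -/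
lemma exists_fixedPoint (hp : IsCover pr) (hβ : 5 < β) (hF : Datum β N F₀) (hN : L.Λ ≤ N) :
    ∃ m : ℝ → Ω → Mom, Measurable (fun q : ℝ × Ω => m q.1 q.2) ∧
      (∀ t, 0 ≤ t → ∀ x, flowMom L pr F₀ m t x = m t x) ∧
      ∃ D, 0 ≤ D ∧ ∀ n t x, 0 ≤ t → ‖picard L pr F₀ n t x - m t x‖ ≤
        D * (1 / 2) ^ n * Real.exp (2 * (lipConst L N + 1) * t) := by
  have hl := lipConst_nonneg hN
  set l := 2 * (lipConst L N + 1) with hl'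
  have hl0 : 0 < l := by rw [hl']; linarith
  set D := 16 * (N * weightMass β) + ‖mom₀‖
  have hΛ := L.one_le
  have hw := weightMass_nonneg β
  have hN0 : 0 ≤ N := by linarith
  have hD : 0 ≤ D := by positivity
  have hP := fun n => measurable_picard (L := L) hp hF n
  have hbd : ∀ n t x, 0 ≤ t → ‖picard L pr F₀ (n + 1) t x - picard L pr F₀ n t x‖ ≤
      D * (1 / 2) ^ n * Real.exp (l * t) := by
    intro n
    induction n with
    | zero =>
      intro t x ht
      have h1 : ‖picard L pr F₀ 1 t x‖ ≤ 16 * (N * weightMass β) := by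
        simp only [picard]
        exact (profile_flow hp hF hN measurable_const (le_max_right _ _) x).norm_moments_le hβ
      have h2 : 1 ≤ Real.exp (l * t) := Real.one_le_exp (by positivity)
      calc _ ≤ ‖picard L pr F₀ 1 t x‖ + ‖picard L pr F₀ 0 t x‖ := norm_sub_le _ _
        _ ≤ D := add_le_add h1 le_rfl
        _ ≤ _ := by rw [pow_zero, mul_one]; exact le_mul_of_one_le_right hD h2
    | succ n ih =>
      intro t x ht
      have := flowMom_contraction hp hβ hF hN (hP (n + 1)) (hP n) ht x
        (d := D * (1 / 2) ^ n) (by positivity) fun s hs y => ih s y hs.1.le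
      change ‖flowMom L pr F₀ (picard L pr F₀ (n + 1)) (max t 0) x -
        flowMom L pr F₀ (picard L pr F₀ n) (max t 0) x‖ ≤ _
      rw [max_eq_left ht]
      refine this.trans (le_of_eq ?_)
      rw [pow_succ]; ring
  -- A negative time is replaced by `0`, so that the limit exists everywhere.
  have hgeo : ∀ t x n, dist (picard L pr F₀ n (max t 0) x) (picard L pr F₀ (n + 1) (max t 0) x) ≤
      2 * D * Real.exp (l * max t 0) / 2 / 2 ^ n := fun t x n => by
    rw [dist_comm, dist_eq_norm]
    refine (hbd n _ x (le_max_right _ _)).trans (le_of_eq ?_)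
    rw [one_div, inv_pow]; ring
  choose m hm using fun t x => cauchySeq_tendsto_of_complete
    (cauchySeq_of_le_geometric_two (hgeo t x))
  have hmm : Measurable fun q : ℝ × Ω => m q.1 q.2 :=
    measurable_of_tendsto_metrizable (fun n => (hP n).comp
      (f := fun q : ℝ × Ω => (max q.1 0, q.2)) (by fun_prop))
      (tendsto_pi_nhds.2 fun q => hm q.1 q.2)
  have hconv : ∀ n t x, 0 ≤ t → ‖picard L pr F₀ n t x - m t x‖ ≤
      2 * D * (1 / 2) ^ n * Real.exp (l * t) := fun n t x ht => by
    have := dist_le_of_le_geometric_two_of_tendsto (hgeo t x) (hm t x) n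
    rw [max_eq_left ht, dist_eq_norm] at this
    refine this.trans (le_of_eq ?_)
    rw [one_div, inv_pow]; ring
  refine ⟨m, hmm, fun t ht x => ?_, 2 * D, by positivity, hconv⟩
  have h1 : ∀ n, ‖picard L pr F₀ (n + 1) t x - flowMom L pr F₀ m t x‖ ≤
      2 * D * (1 / 2) ^ n / 2 * Real.exp (l * t) := fun n => by
    have := flowMom_contraction hp hβ hF hN (hP n) hmm ht x (d := 2 * D * (1 / 2) ^ n)
      (by positivity) fun s hs y => hconv n s y hs.1.le
    change ‖flowMom L pr F₀ (picard L pr F₀ n) (max t 0) x - _‖ ≤ _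
    rwa [max_eq_left ht]
  have h2 : Filter.Tendsto (fun n => picard L pr F₀ (n + 1) t x) Filter.atTop
      (nhds (flowMom L pr F₀ m t x)) := by
    rw [tendsto_iff_norm_sub_tendsto_zero]
    refine squeeze_zero (fun _ => norm_nonneg _) h1 ?_
    have := (tendsto_pow_atTop_nhds_zero_of_lt_one (r := (1 / 2 : ℝ)) (by norm_num)
      (by norm_num)).const_mul (2 * D / 2 * Real.exp (l * t))
    rw [mul_zero] at this
    refine this.congr fun n => ?_
    ring
  have h3 := (Filter.tendsto_add_atTop_iff_nat 1).2 (hm t x)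
  rw [max_eq_left ht] at h3
  exact tendsto_nhds_unique h2 h3

end Transport

/-! ### Entropy along the flow -/

section Entropy

variable {Ω : Type} [AddCommGroup Ω] [MeasureSpace Ω]

/-- The relative entropy of a phase-space density with respect to `μ`, possibly infinite. -/
def phaseEntropy {Ω : Type} [MeasureSpace Ω] (F : Ω → R3 → ℝ) : ℝ≥0∞ :=
  ∫⁻ p : Ω × R3, ENNReal.ofReal (relEnt (F p.1 p.2) (maxwellian p.2))

variable {ν β : ℝ} {L : RelaxLaw ν β} {pr : R3 → Ω} {F₀ : Ω → R3 → ℝ} {m : ℝ → Ω → Mom} {N : ℝ}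

/-- Free transport preserves the measure of phase space. -/
lemma IsCover.lintegral_flow [SigmaFinite (volume : Measure Ω)] (hp : IsCover pr) {t : ℝ}
    {G : ℝ → Ω → R3 → ℝ≥0∞} (hG : Measurable fun q : ℝ × Ω × R3 => G q.1 q.2.1 q.2.2) :
    ∫⁻ p : Ω × R3, ∫⁻ s in Ioc 0 t, G s (p.1 - pr ((t - s) • p.2)) p.2 =
      ∫⁻ s in Ioc 0 t, ∫⁻ p : Ω × R3, G s p.1 p.2 := by
  rw [lintegral_lintegral_swap]
  · refine lintegral_congr fun s => ?_
    exact (hp.measurePreserving_flow (t - s)).lintegral_comp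
      (f := fun p : Ω × R3 => G s p.1 p.2)
      (hG.comp (f := fun p : Ω × R3 => (s, p.1, p.2)) (by fun_prop))
  · refine Measurable.aemeasurable ?_
    exact hG.comp (f := fun q : (Ω × R3) × ℝ => (q.2, q.1.1 - pr ((t - q.2) • q.1.2), q.1.2))
      (measurable_snd.prodMk ((hp.measurable_shift (by fun_prop) (by fun_prop)).prodMk
        (by fun_prop)))

lemma measurable_relEnt_maxwellian {α : Type*} [MeasurableSpace α] {f : α → ℝ} {g : α → R3}
    (hf : Measurable f) (hg : Measurable g) :
    Measurable fun a => relEnt (f a) (maxwellian (g a)) :=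
  measurable_relEnt hf (measurable_maxwellian.comp hg)

lemma ofReal_intervalIntegral {f : ℝ → ℝ} {t : ℝ}
    (hf : IntervalIntegrable f volume 0 t) (ht : 0 ≤ t)
    (h0 : ∀ s ∈ Ioc 0 t, 0 ≤ f s) :
    ENNReal.ofReal (∫ s in (0 : ℝ)..t, f s) = ∫⁻ s in Ioc 0 t, ENNReal.ofReal (f s) := by
  rw [intervalIntegral.integral_of_le ht]
  exact ofReal_integral_eq_lintegral_ofReal
    ((intervalIntegrable_iff_integrableOn_Ioc_of_le ht).1 hf)
    ((ae_restrict_iff' measurableSet_Ioc).2 (.of_forall h0))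

/-- Along a characteristic, the entropy and its loss are controlled by the initial entropy and the
gain: this is Jensen's inequality for the mild formulation. -/
lemma relEnt_relax_add_le {a M : ℝ → ℝ} (ha : BddMeas a) (hM : BddMeas M) {y m t : ℝ} (hm : 0 < m)
    (ht : 0 ≤ t) (ha0 : ∀ s, 0 ≤ a s) (hy : 0 ≤ y) (hM0 : ∀ s, 0 ≤ M s) :
    ENNReal.ofReal (relEnt (relax a M y t) m) +
        ∫⁻ s in Ioc 0 t, ENNReal.ofReal (a s * relEnt (relax a M y s) m) ≤
      ENNReal.ofReal (relEnt y m) + ∫⁻ s in Ioc 0 t, ENNReal.ofReal (a s * relEnt (M s) m) := by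
  have hφ : BddMeas fun s => relEnt (M s) m := hM.relEnt m
  set Z := relax a (fun s => relEnt (M s) m) (relEnt y m) with hZ
  have hφ0 : ∀ s, 0 ≤ relEnt (M s) m := fun s => relEnt_nonneg (hM0 s) hm
  have hZ0 : ∀ s, 0 ≤ s → 0 ≤ Z s := fun s hs =>
    relax_nonneg ha hφ hs (fun s _ => ha0 s) (relEnt_nonneg hy hm) fun s _ => hφ0 s
  have hJ : ∀ s, 0 ≤ s → relEnt (relax a M y s) m ≤ Z s := fun s hs =>
    relEnt_relax_le ha hM hm hs (fun s _ => ha0 s) hy fun s _ => hM0 s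
  have hZb : IntervalIntegrable (fun s => a s * Z s) volume 0 t :=
    (ha.intervalIntegrable _ _).mul_continuousOn (relax_continuous ha hφ _).continuousOn
  have e := relax_integral_eq ha hφ (relEnt y m) ht
  rw [← hZ] at e
  have e2 : Z t + ∫ s in (0 : ℝ)..t, a s * Z s =
      relEnt y m + ∫ s in (0 : ℝ)..t, a s * relEnt (M s) m := by
    rw [e]
    simp only [mul_sub]
    rw [intervalIntegral.integral_sub ((ha.mul hφ).intervalIntegrable _ _)
      hZb]
    ring
  calc _ ≤ ENNReal.ofReal (Z t) + ∫⁻ s in Ioc 0 t, ENNReal.ofReal (a s * Z s) := by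
        refine add_le_add (ENNReal.ofReal_le_ofReal (hJ t ht)) ?_
        refine setLIntegral_mono' measurableSet_Ioc fun s hs => ?_
        exact ENNReal.ofReal_le_ofReal (mul_le_mul_of_nonneg_left (hJ s hs.1.le) (ha0 s))
    _ = _ := by
        rw [← ofReal_intervalIntegral hZb ht fun s hs =>
            mul_nonneg (ha0 s) (hZ0 s hs.1.le),
          ← ofReal_intervalIntegral ((ha.mul hφ).intervalIntegrable _ _) ht fun s hs => mul_nonneg (ha0 s) (hφ0 s),
          ← ENNReal.ofReal_add (hZ0 t ht) (intervalIntegral.integral_nonneg ht fun s hs =>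
            mul_nonneg (ha0 s) (hZ0 s hs.1)), e2,
          ENNReal.ofReal_add (relEnt_nonneg hy hm) (intervalIntegral.integral_nonneg ht fun s hs =>
            mul_nonneg (ha0 s) (hφ0 s))]

/-- The entropy balance of the truncated problem: entropy at time `t` plus its loss is at most the
initial entropy plus its gain. Both sides may be infinite. -/
lemma phaseEntropy_flow_add_le [SigmaFinite (volume : Measure Ω)] (hp : IsCover pr)
    (hF : Datum β N F₀) (hm : Measurable fun q : ℝ × Ω => m q.1 q.2) {t : ℝ} (ht : 0 ≤ t) :
    phaseEntropy (flow L pr F₀ m t) + ∫⁻ s in Ioc 0 t, ∫⁻ p : Ω × R3,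
        ENNReal.ofReal (L.freq (m s p.1) * relEnt (flow L pr F₀ m s p.1 p.2) (maxwellian p.2)) ≤
      phaseEntropy F₀ + ∫⁻ s in Ioc 0 t, ∫⁻ p : Ω × R3,
        ENNReal.ofReal (L.freq (m s p.1) * relEnt (L.equil (m s p.1) p.2) (maxwellian p.2)) := by
  have hflow := measurable_flow (L := L) hp hF hm
  have hfr : Measurable fun q : ℝ × Ω × R3 => L.freq (m q.1 q.2.1) :=
    L.measurable_freq.comp (hm.comp (f := fun q : ℝ × Ω × R3 => (q.1, q.2.1)) (by fun_prop))
  have heq : Measurable fun q : ℝ × Ω × R3 => L.equil (m q.1 q.2.1) q.2.2 :=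
    L.measurable_equil.comp ((hm.comp (f := fun q : ℝ × Ω × R3 => (q.1, q.2.1))
      (by fun_prop)).prodMk (by fun_prop))
  have hG1 : Measurable fun q : ℝ × Ω × R3 => ENNReal.ofReal
      (L.freq (m q.1 q.2.1) * relEnt (flow L pr F₀ m q.1 q.2.1 q.2.2) (maxwellian q.2.2)) :=
    (hfr.mul (measurable_relEnt_maxwellian hflow (by fun_prop))).ennreal_ofReal
  have hG2 : Measurable fun q : ℝ × Ω × R3 => ENNReal.ofReal
      (L.freq (m q.1 q.2.1) * relEnt (L.equil (m q.1 q.2.1) q.2.2) (maxwellian q.2.2)) :=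
    (hfr.mul (measurable_relEnt_maxwellian heq (by fun_prop))).ennreal_ofReal
  have hF1 : Measurable fun p : Ω × R3 =>
      ENNReal.ofReal (relEnt (F₀ p.1 p.2) (maxwellian p.2)) :=
    (measurable_relEnt_maxwellian hF.meas (by fun_prop)).ennreal_ofReal
  have h0 : phaseEntropy F₀ = ∫⁻ p : Ω × R3,
      ENNReal.ofReal (relEnt (F₀ (p.1 - pr (t • p.2)) p.2) (maxwellian p.2)) :=
    ((hp.measurePreserving_flow t).lintegral_comp hF1).symm
  have hF2 : Measurable fun p : Ω × R3 =>
      ENNReal.ofReal (relEnt (flow L pr F₀ m t p.1 p.2) (maxwellian p.2)) :=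
    (measurable_relEnt_maxwellian (hflow.comp (f := fun p : Ω × R3 => (t, p.1, p.2))
      (by fun_prop)) measurable_snd).ennreal_ofReal
  have hF3 : Measurable fun p : Ω × R3 =>
      ENNReal.ofReal (relEnt (F₀ (p.1 - pr (t • p.2)) p.2) (maxwellian p.2)) :=
    hF1.comp (hp.measurePreserving_flow t).measurable
  rw [← hp.lintegral_flow (G := fun s x v => ENNReal.ofReal
      (L.freq (m s x) * relEnt (flow L pr F₀ m s x v) (maxwellian v))) hG1,
    ← hp.lintegral_flow (G := fun s x v => ENNReal.ofReal
      (L.freq (m s x) * relEnt (L.equil (m s x) v) (maxwellian v))) hG2, h0, phaseEntropy, ← lintegral_add_left hF2,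
    ← lintegral_add_left hF3]
  refine lintegral_mono fun p => ?_
  have := relEnt_relax_add_le (bddMeas_charFreq (L := L) hp hm t p.1 p.2)
    (bddMeas_charEquil hp hm t p.1 p.2) (maxwellian_pos p.2) ht (fun s => L.freq_nonneg _)
    (hF.nonneg (p.1 - pr (t • p.2)) p.2) fun s => (L.equil_pos _ _).le
  simp only [flow_along hp]
  exact this

/-- The entropy gain at one time is quadratic in the deviation of the moments, since `φ` vanishes
to second order at `μ`. -/
lemma lintegral_relEnt_equil_le {Ω : Type} [MeasureSpace Ω] [SigmaFinite (volume : Measure Ω)] (hβ : 5 < β) {m : Ω → Mom}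
    (hm : Measurable m) :
    ∫⁻ p : Ω × R3, ENNReal.ofReal
        (L.freq (m p.1) * relEnt (L.equil (m p.1) p.2) (maxwellian p.2)) ≤
      ENNReal.ofReal (L.Λ ^ 2 * ∫ v, (weight β v)⁻¹) *
        ∫⁻ x, ENNReal.ofReal (‖m x - mom₀‖ ^ 2) := by
  have hΛ := L.one_le
  have hw := fun v => inv_pos.2 (weight_pos β v)
  have hww := (measurable_weight β).inv
  rw [ENNReal.ofReal_mul (by positivity), ofReal_integral_eq_lintegral_ofReal
    (integrable_inv_weight hβ) (.of_forall fun v => (hw v).le), mul_assoc,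
    mul_comm (∫⁻ v, _), ← lintegral_prod_mul (by fun_prop) (by fun_prop),
    ← lintegral_const_mul _ (by fun_prop), ← Measure.volume_eq_prod]
  refine lintegral_mono fun p => ?_
  rw [← ENNReal.ofReal_mul (by positivity), ← ENNReal.ofReal_mul (by positivity)]
  refine ENNReal.ofReal_le_ofReal ?_
  have h1 := L.relEnt_le (m p.1) p.2
  have h2 := L.freq_le (m p.1)
  have h3 := L.freq_nonneg (m p.1)
  have h4 := relEnt_nonneg (L.equil_pos (m p.1) p.2).le (maxwellian_pos p.2)
  calc _ ≤ L.Λ * (L.Λ * ‖m p.1 - mom₀‖ ^ 2 * (weight β p.2)⁻¹) := by gcongr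
    _ = _ := by ring

lemma phaseEntropy_eq {Ω : Type} [MeasureSpace Ω] [SigmaFinite (volume : Measure Ω)] (hβ : 5 < β) {F : Ω → R3 → ℝ}
    (hF : ∀ x, Profile β N (F x)) (hm : Measurable fun p : Ω × R3 => F p.1 p.2) :
    phaseEntropy F = ∫⁻ x, ENNReal.ofReal (velEntropy (F x)) := by
  rw [phaseEntropy, Measure.volume_eq_prod, lintegral_prod _
    (measurable_relEnt_maxwellian hm measurable_snd).ennreal_ofReal.aemeasurable]
  exact lintegral_congr fun x => ((hF x).ofReal_velEntropy hβ).symm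

lemma lintegral_exp_le {K : ℝ} (hK : 0 < K) {t : ℝ} (ht : 0 ≤ t) :
    1 + ∫⁻ s in Ioc 0 t, ENNReal.ofReal (K * Real.exp (K * s)) = ENNReal.ofReal (Real.exp (K * t)) := by
  have e : ∫ s in (0 : ℝ)..t, K * Real.exp (K * s) = Real.exp (K * t) - 1 := by
    rw [intervalIntegral.integral_const_mul, intervalIntegral.integral_comp_mul_left
      (fun s => Real.exp s) hK.ne', integral_exp, mul_zero, smul_eq_mul, Real.exp_zero,
      mul_inv_cancel_left₀ hK.ne']
  rw [← ofReal_intervalIntegral (Continuous.intervalIntegrable (by fun_prop) _ _) ht (fun s _ => by positivity), e,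
    ← ENNReal.ofReal_one, ← ENNReal.ofReal_add zero_le_one
      (by rw [sub_nonneg]; exact Real.one_le_exp (by positivity)), add_sub_cancel]

/-- The entropy of the Picard iterates grows at most exponentially. -/
lemma exists_phaseEntropy_picard_le (L : RelaxLaw ν β) [SigmaFinite (volume : Measure Ω)]
    (hp : IsCover pr) (hβ : 5 < β)
    (hF : Datum β N F₀) (hN : L.Λ ≤ N) : ∃ K : ℝ, 0 < K ∧ ∀ n t, 0 ≤ t →
      phaseEntropy (flow L pr F₀ (picard L pr F₀ n) t) ≤
        phaseEntropy F₀ * ENNReal.ofReal (Real.exp (K * t)) := by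
  obtain ⟨C, hC, hCs⟩ := exists_moments_sub_sq_le β hβ N
  have hP := fun n => measurable_picard (L := L) hp hF n
  have hW : 0 ≤ ∫ v, (weight β v)⁻¹ := integral_nonneg fun v => (inv_pos.2 (weight_pos β v)).le
  set W := L.Λ ^ 2 * ∫ v, (weight β v)⁻¹ with hWdef
  have hW0 : 0 ≤ W := by positivity
  refine ⟨W * C + 1, by positivity, fun n => ?_⟩
  set K := W * C + 1 with hK
  have hK0 : 0 < K := by positivity
  have hE : ∀ t, 0 ≤ t → phaseEntropy F₀ ≤
      phaseEntropy F₀ * ENNReal.ofReal (Real.exp (K * t)) := fun t ht =>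
    le_mul_of_one_le_right' (ENNReal.one_le_ofReal.2 (Real.one_le_exp (by positivity)))
  have hbal : ∀ n t, 0 ≤ t → phaseEntropy (flow L pr F₀ (picard L pr F₀ n) t) ≤
      phaseEntropy F₀ + ∫⁻ s in Ioc 0 t, ENNReal.ofReal W *
        ∫⁻ x, ENNReal.ofReal (‖picard L pr F₀ n s x - mom₀‖ ^ 2) := fun n t ht => by
    refine (le_self_add.trans (phaseEntropy_flow_add_le hp hF (hP n) ht)).trans ?_
    gcongr with s
    exact lintegral_relEnt_equil_le hβ
      ((hP n).comp (f := fun x => (s, x)) (by fun_prop))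
  induction n with
  | zero =>
    intro t ht
    refine (hbal 0 t ht).trans (le_trans (le_of_eq ?_) (hE t ht))
    simp [picard]
  | succ n ih =>
    intro t ht
    refine (hbal (n + 1) t ht).trans ?_
    have h1 : ∀ s ∈ Ioc 0 t, ENNReal.ofReal W *
        ∫⁻ x, ENNReal.ofReal (‖picard L pr F₀ (n + 1) s x - mom₀‖ ^ 2) ≤
        phaseEntropy F₀ * ENNReal.ofReal (K * Real.exp (K * s)) := fun s hs => by
      have h2 : ∫⁻ x, ENNReal.ofReal (‖picard L pr F₀ (n + 1) s x - mom₀‖ ^ 2) ≤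
          ENNReal.ofReal C * phaseEntropy (flow L pr F₀ (picard L pr F₀ n) s) := by
        rw [phaseEntropy_eq hβ (fun x => profile_flow hp hF hN (hP n) hs.1.le x)
          ((measurable_flow hp hF (hP n)).comp (f := fun p : Ω × R3 => (s, p.1, p.2))
            (by fun_prop)), ← lintegral_const_mul' _ _ ENNReal.ofReal_ne_top]
        refine lintegral_mono fun x => ?_
        rw [← ENNReal.ofReal_mul hC.le]
        refine ENNReal.ofReal_le_ofReal ?_
        simp only [picard]
        rw [max_eq_left hs.1.le]
        exact hCs _ (profile_flow hp hF hN (hP n) hs.1.le x)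
      calc _ ≤ ENNReal.ofReal W * (ENNReal.ofReal C *
            (phaseEntropy F₀ * ENNReal.ofReal (Real.exp (K * s)))) := by
            gcongr; exact h2.trans (by gcongr; exact ih s hs.1.le)
        _ = phaseEntropy F₀ * ENNReal.ofReal (W * C * Real.exp (K * s)) := by
            rw [ENNReal.ofReal_mul (mul_nonneg hW0 hC.le), ENNReal.ofReal_mul (p := W) hW0]; ring
        _ ≤ _ := by gcongr; rw [hK]; linarith
    calc _ ≤ phaseEntropy F₀ + ∫⁻ s in Ioc 0 t,
          phaseEntropy F₀ * ENNReal.ofReal (K * Real.exp (K * s)) := by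
          gcongr 1; exact setLIntegral_mono' measurableSet_Ioc h1
      _ = phaseEntropy F₀ * (1 + ∫⁻ s in Ioc 0 t, ENNReal.ofReal (K * Real.exp (K * s))) := by
          rw [lintegral_const_mul _ (by fun_prop), mul_add, mul_one]
      _ = _ := by rw [lintegral_exp_le hK0 ht]

/-- The entropy of the solution of the truncated problem is bounded on bounded time intervals. -/
lemma exists_phaseEntropy_flow_le [SigmaFinite (volume : Measure Ω)] (hp : IsCover pr) (hβ : 5 < β)
    (hF : Datum β N F₀) (hN : L.Λ ≤ N) (hm : Measurable fun q : ℝ × Ω => m q.1 q.2) {D : ℝ}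
    (hconv : ∀ n t x, 0 ≤ t → ‖picard L pr F₀ n t x - m t x‖ ≤
        D * (1 / 2) ^ n * Real.exp (2 * (lipConst L N + 1) * t)) :
    ∃ K : ℝ, 0 < K ∧ ∀ t, 0 ≤ t → phaseEntropy (flow L pr F₀ m t) ≤
        phaseEntropy F₀ * ENNReal.ofReal (Real.exp (K * t)) := by
  obtain ⟨K, hK, hKE⟩ := exists_phaseEntropy_picard_le L hp hβ hF hN
  refine ⟨K, hK, fun t ht => ?_⟩
  have hP := fun n => measurable_picard (L := L) hp hF n
  have hlim : ∀ x v, Filter.Tendsto (fun n => flow L pr F₀ (picard L pr F₀ n) t x v) Filter.atTop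
      (nhds (flow L pr F₀ m t x v)) := fun x v => by
    rw [tendsto_iff_norm_sub_tendsto_zero]
    refine squeeze_zero (fun _ => norm_nonneg _) (fun n => abs_flow_sub_le hp hF hN (hP n) hm ht x v
      (e := fun s => D * (1 / 2) ^ n * Real.exp (2 * (lipConst L N + 1) * s))
      (Continuous.intervalIntegrable (by fun_prop) _ _)
      (.of_forall fun s hs => hconv n s _ hs.1.le)) ?_
    simp only [intervalIntegral.integral_const_mul]
    have := (tendsto_pow_atTop_nhds_zero_of_lt_one (r := (1 / 2 : ℝ)) (by norm_num)
      (by norm_num)).const_mul ((L.Λ * (N + L.Λ) * (D *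
        ∫ s in (0 : ℝ)..t, Real.exp (2 * (lipConst L N + 1) * s))) * (weight β v)⁻¹)
    rw [mul_zero] at this
    refine this.congr fun n => ?_
    ring
  have hmeas : ∀ n, Measurable fun p : Ω × R3 =>
      ENNReal.ofReal (relEnt (flow L pr F₀ (picard L pr F₀ n) t p.1 p.2) (maxwellian p.2)) :=
    fun n => (measurable_relEnt_maxwellian ((measurable_flow hp hF (hP n)).comp
      (f := fun p : Ω × R3 => (t, p.1, p.2)) (by fun_prop)) measurable_snd).ennreal_ofReal
  calc phaseEntropy (flow L pr F₀ m t) = ∫⁻ p : Ω × R3, Filter.liminf (fun n =>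
        ENNReal.ofReal (relEnt (flow L pr F₀ (picard L pr F₀ n) t p.1 p.2) (maxwellian p.2)))
        Filter.atTop := by
        refine lintegral_congr fun p => ?_
        refine (Filter.Tendsto.liminf_eq ?_).symm
        exact (ENNReal.continuous_ofReal.tendsto _).comp
          (((continuous_relEnt _).tendsto _).comp (hlim p.1 p.2))
    _ ≤ Filter.liminf (fun n => phaseEntropy (flow L pr F₀ (picard L pr F₀ n) t)) Filter.atTop :=
        lintegral_liminf_le hmeas
    _ ≤ Filter.liminf (fun _ : ℕ => phaseEntropy F₀ * ENNReal.ofReal (Real.exp (K * t)))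
          Filter.atTop := Filter.liminf_le_liminf (.of_forall fun n => hKE n t ht)
    _ = _ := Filter.liminf_const _

/-- As long as the Gaussians have at most the entropy of the solution, the entropy of the solution
does not exceed its initial value. -/
lemma phaseEntropy_flow_le [SigmaFinite (volume : Measure Ω)] (hp : IsCover pr) (hβ : 5 < β)
    (hF : Datum β N F₀) (hN : L.Λ ≤ N) (hm : Measurable fun q : ℝ × Ω => m q.1 q.2) {K : ℝ}
    (hK : 0 ≤ K) (hfin : phaseEntropy F₀ ≠ ∞) (hE : ∀ t, 0 ≤ t → phaseEntropy (flow L pr F₀ m t) ≤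
        phaseEntropy F₀ * ENNReal.ofReal (Real.exp (K * t))) {t : ℝ} (ht : 0 ≤ t)
    (hH : ∀ s ∈ Ioc 0 t, ∀ᵐ x, velEntropy (L.equil (m s x)) ≤ velEntropy (flow L pr F₀ m s x)) :
    phaseEntropy (flow L pr F₀ m t) ≤ phaseEntropy F₀ := by
  have hΛ : 0 ≤ L.Λ := zero_le_one.trans L.one_le
  have hflow := measurable_flow (L := L) hp hF hm
  have hfr : ∀ s, Measurable fun x => L.freq (m s x) := fun s =>
    L.measurable_freq.comp (hm.comp (f := fun x => (s, x)) (by fun_prop))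
  have heq : ∀ s, Measurable fun q : Ω × R3 => L.equil (m s q.1) q.2 := fun s =>
    L.measurable_equil.comp ((hm.comp (f := fun q : Ω × R3 => (s, q.1))
      (by fun_prop)).prodMk (by fun_prop))
  set D : ℝ → ℝ≥0∞ := fun s => ∫⁻ p : Ω × R3,
    ENNReal.ofReal (L.freq (m s p.1) * relEnt (flow L pr F₀ m s p.1 p.2) (maxwellian p.2)) with hD
  have hprof : ∀ m, Profile β N (L.equil m) := fun m =>
    { meas := (L.measurable_equil.comp (f := fun v => (m, v)) (by fun_prop)).aestronglyMeasurable
      nonneg := .of_forall fun v => (L.equil_pos m v).le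
      le := .of_forall fun v => (L.equil_le m v).trans
        (mul_le_mul_of_nonneg_right hN (inv_pos.2 (weight_pos β v)).le) }
  have hgain : ∫⁻ s in Ioc 0 t, ∫⁻ p : Ω × R3,
      ENNReal.ofReal (L.freq (m s p.1) * relEnt (L.equil (m s p.1) p.2) (maxwellian p.2)) ≤
      ∫⁻ s in Ioc 0 t, D s := by
    refine setLIntegral_mono' measurableSet_Ioc fun s hs => ?_
    rw [hD]
    dsimp only
    have hm1 : Measurable fun p : Ω × R3 => ENNReal.ofReal
        (L.freq (m s p.1) * relEnt (L.equil (m s p.1) p.2) (maxwellian p.2)) :=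
      (((hfr s).comp measurable_fst).mul
        (measurable_relEnt_maxwellian (heq s) measurable_snd)).ennreal_ofReal
    have hm2 : Measurable fun p : Ω × R3 => ENNReal.ofReal
        (L.freq (m s p.1) * relEnt (flow L pr F₀ m s p.1 p.2) (maxwellian p.2)) :=
      (((hfr s).comp measurable_fst).mul
        (measurable_relEnt_maxwellian (hflow.comp (f := fun p : Ω × R3 => (s, p.1, p.2))
          (by fun_prop)) measurable_snd)).ennreal_ofReal
    rw [Measure.volume_eq_prod, lintegral_prod _ hm1.aemeasurable,
      lintegral_prod _ hm2.aemeasurable]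
    refine lintegral_mono_ae ?_
    filter_upwards [hH s hs] with x hx
    simp only [ENNReal.ofReal_mul (L.freq_nonneg _)]
    rw [lintegral_const_mul' _ _ ENNReal.ofReal_ne_top,
      lintegral_const_mul' _ _ ENNReal.ofReal_ne_top, ← (hprof _).ofReal_velEntropy hβ,
      ← (profile_flow hp hF hN hm hs.1.le x).ofReal_velEntropy hβ]
    gcongr
  have hDfin : ∫⁻ s in Ioc 0 t, D s ≠ ∞ := by
    refine ne_top_of_le_ne_top (b := ∫⁻ s in Ioc 0 t, ENNReal.ofReal L.Λ *
      (phaseEntropy F₀ * ENNReal.ofReal (Real.exp (K * t)))) ?_ ?_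
    · rw [setLIntegral_const, Real.volume_Ioc]
      exact ENNReal.mul_ne_top (ENNReal.mul_ne_top ENNReal.ofReal_ne_top
        (ENNReal.mul_ne_top hfin ENNReal.ofReal_ne_top)) ENNReal.ofReal_ne_top
    · refine setLIntegral_mono' measurableSet_Ioc fun s hs => ?_
      calc D s ≤ ∫⁻ p : Ω × R3, ENNReal.ofReal L.Λ *
            ENNReal.ofReal (relEnt (flow L pr F₀ m s p.1 p.2) (maxwellian p.2)) := by
            refine lintegral_mono fun p => ?_
            rw [ENNReal.ofReal_mul (L.freq_nonneg _)]
            gcongr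
            exact L.freq_le _
        _ = ENNReal.ofReal L.Λ * phaseEntropy (flow L pr F₀ m s) :=
            lintegral_const_mul' _ _ ENNReal.ofReal_ne_top
        _ ≤ _ := by
            gcongr
            refine (hE s hs.1.le).trans ?_
            have := hs.2
            gcongr
  refine (ENNReal.add_le_add_iff_right hDfin).1 ?_
  exact (phaseEntropy_flow_add_le hp hF hm ht).trans (by gcongr)

/-- The entropy of the statement is the relative entropy with respect to `μ`. -/
lemma entropy_eq {Ω : Type} [MeasureSpace Ω] {F₀ : Ω → R3 → ℝ} (hF : EntropyDefined F₀) (h0 : ∀ x v, 0 ≤ F₀ x v) :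
    0 ≤ entropy F₀ ∧ phaseEntropy F₀ = ENNReal.ofReal (entropy F₀) := by
  have e : ∀ p : Ω × R3, relEnt (F₀ p.1 p.2) (maxwellian p.2) = entropyDensity F₀ p +
      (3 / 2 * Real.log (2 * Real.pi) - 1) * (F₀ p.1 p.2 - maxwellian p.2) +
      1 / 2 * (‖p.2‖ ^ 2 * (F₀ p.1 p.2 - maxwellian p.2)) := fun p => by
    rw [relEnt, entropyDensity, log_maxwellian]; ring
  have hi1 := hF.mass.const_mul (3 / 2 * Real.log (2 * Real.pi) - 1)
  have hi2 := hF.energy.const_mul (1 / 2)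
  have hI : Integrable (fun p : Ω × R3 => relEnt (F₀ p.1 p.2) (maxwellian p.2)) volume :=
    ((hF.entropy.add hi1).add hi2).congr (.of_forall fun p => (e p).symm)
  have hE : entropy F₀ = ∫ p : Ω × R3, relEnt (F₀ p.1 p.2) (maxwellian p.2) := by
    have e1 := integral_add (hF.entropy.add hi1) hi2
    have e2 := integral_add hF.entropy hi1
    simp only [Pi.add_apply] at e1
    rw [integral_const_mul] at e1 e2
    simp only [e]
    rw [e1, e2, entropy, defectMass, defectEnergy]
  have hn : ∀ p : Ω × R3, 0 ≤ relEnt (F₀ p.1 p.2) (maxwellian p.2) := fun p =>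
    relEnt_nonneg (h0 _ _) (maxwellian_pos _)
  refine ⟨hE ▸ integral_nonneg hn, ?_⟩
  rw [hE, phaseEntropy, ofReal_integral_eq_lintegral_ofReal hI (.of_forall hn)]

end Entropy

/-! ### Small entropy forces the moments close to those of `μ` -/

lemma FiniteEnergy.const_mul {f : R3 → ℝ} (hf : FiniteEnergy f) (c : ℝ) :
    FiniteEnergy fun v => c * f v := by
  unfold FiniteEnergy
  simp only [mul_left_comm _ c]
  exact Integrable.const_mul hf c

lemma moments_const_mul (f : R3 → ℝ) (c : ℝ) :
    moments (fun v => c * f v) = c • moments f := by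
  ext p
  simp only [moments_apply, PiLp.smul_apply, smul_eq_mul, mul_left_comm _ c]
  exact integral_const_mul _ _

lemma exists_tail_lt {f : R3 → ℝ} (hf : Integrable f) {η : ℝ} (hη : 0 < η) :
    ∃ R : ℝ, ∫ v in (Metric.closedBall (0 : R3) R)ᶜ, f v < η := by
  have h := tendsto_setIntegral_of_antitone (μ := (volume : Measure R3)) (f := f)
    (s := fun n : ℕ => (Metric.closedBall (0 : R3) n)ᶜ)
    (fun n => Metric.isClosed_closedBall.measurableSet.compl)
    (fun a b hab => compl_subset_compl.2 (Metric.closedBall_subset_closedBall (by exact_mod_cast hab)))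
    ⟨0, hf.integrableOn⟩
  have e : ⋂ n : ℕ, (Metric.closedBall (0 : R3) n)ᶜ = ∅ := by
    refine eq_empty_of_forall_notMem fun v hv => ?_
    obtain ⟨n, hn⟩ := exists_nat_ge ‖v‖
    exact mem_iInter.1 hv n (by simpa using hn)
  rw [e, Measure.restrict_empty, integral_zero_measure] at h
  obtain ⟨n, hn⟩ := (h.eventually (gt_mem_nhds hη)).exists
  exact ⟨n, hn⟩

section Close

variable {Ω : Type} [AddCommGroup Ω] [MeasureSpace Ω]
  {ν β : ℝ} {L : RelaxLaw ν β} {pr : R3 → Ω} {F₀ : Ω → R3 → ℝ} {m : ℝ → Ω → Mom} {N : ℝ}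

/-- The deviation from `μ` relaxes at the constant rate `(1 - ν)⁻¹`, up to a remainder controlled by
the deviation of the moments along the characteristic. -/
lemma abs_flow_sub_maxwellian_le (hp : IsCover pr) (hF : Datum β N F₀) (hN : L.Λ ≤ N)
    (hm : Measurable fun q : ℝ × Ω => m q.1 q.2) {D : ℝ}
    (hD : ∀ s, 0 ≤ s → ∀ y, ‖m s y - mom₀‖ ≤ D) {t : ℝ} (ht : 0 ≤ t) (x : Ω) (v : R3) :
    |flow L pr F₀ m t x v - maxwellian v -
        Real.exp (-((1 - ν)⁻¹ * t)) * (F₀ (x - pr (t • v)) v - maxwellian v)| ≤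
      (L.Λ * (N + L.Λ) * ∫ s in (0 : ℝ)..t, Real.exp (-((1 - ν)⁻¹ * (t - s))) *
        ‖m s (x - pr ((t - s) • v)) - mom₀‖) * (weight β v)⁻¹ := by
  have hw := inv_pos.2 (weight_pos β v)
  have hΛ : 0 < L.Λ := zero_lt_one.trans_le L.one_le
  have hb : ∀ s, 0 ≤ s →
      0 ≤ relax (charFreq L pr m t x v) (charEquil L pr m t x v) (F₀ (x - pr (t • v)) v) s ∧
      relax (charFreq L pr m t x v) (charEquil L pr m t x v) (F₀ (x - pr (t • v)) v) s ≤
        N * (weight β v)⁻¹ := fun s hs => by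
    rw [← flow_along hp]
    exact ⟨flow_nonneg hp hF hm hs _ _, flow_le hp hF hN hm hs _ _⟩
  have hdm : Measurable fun s => ‖m s (x - pr ((t - s) • v)) - mom₀‖ :=
    ((hm.comp (f := fun s => (s, x - pr ((t - s) • v))) (measurable_id.prodMk
      (hp.measurable_shift measurable_const (by fun_prop)))).sub_const _).norm
  have hdi : IntervalIntegrable (fun s => ‖m s (x - pr ((t - s) • v)) - mom₀‖) volume 0 t := by
    rw [intervalIntegrable_iff_integrableOn_Ioc_of_le ht]
    refine Measure.integrableOn_of_bounded (M := D) (by simp) hdm.aestronglyMeasurable ?_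
    refine (ae_restrict_iff' measurableSet_Ioc).2 (.of_forall fun s hs => ?_)
    rw [norm_norm]; exact hD s hs.1.le _
  have ha := bddMeas_charFreq (L := L) hp hm t x v
  have hM := bddMeas_charEquil (L := L) hp hm t x v
  have e := relax_sub (.const (1 - ν)⁻¹) (.const (maxwellian v)) ha hM (maxwellian v)
    (F₀ (x - pr (t • v)) v) ht ⟨_, fun s hs => by
      rw [abs_of_nonneg (hb s hs).1]; exact (hb s hs).2⟩
    ⟨maxwellian v, fun s hs => by
      rw [relax_const (.const _) _ hs, abs_of_pos (maxwellian_pos v)]⟩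
  rw [relax_const (.const _) _ ht, linearSol] at e
  simp only [intervalIntegral.integral_const, smul_eq_mul, sub_zero] at e
  set h : ℝ → ℝ := fun s => ((1 - ν)⁻¹ - charFreq L pr m t x v s) * (charEquil L pr m t x v s -
      relax (charFreq L pr m t x v) (charEquil L pr m t x v) (F₀ (x - pr (t • v)) v) (max s 0)) +
      (1 - ν)⁻¹ * (maxwellian v - charEquil L pr m t x v s) with hh
  have e2 : flow L pr F₀ m t x v - maxwellian v -
        Real.exp (-((1 - ν)⁻¹ * t)) * (F₀ (x - pr (t • v)) v - maxwellian v) =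
      -∫ s in (0 : ℝ)..t, Real.exp (-((t - s) * (1 - ν)⁻¹)) * h s := by
    rw [flow, mul_comm (1 - ν)⁻¹ t]
    linarith
  rw [e2, abs_neg, ← Real.norm_eq_abs, ← intervalIntegral.integral_const_mul,
    ← intervalIntegral.integral_mul_const]
  refine intervalIntegral.norm_integral_le_of_norm_le ht (.of_forall fun s hs => ?_)
    (((hdi.continuousOn_mul (g := fun s => Real.exp (-((1 - ν)⁻¹ * (t - s))))
      (by fun_prop)).const_mul _).mul_const _)
  rw [norm_mul, Real.norm_of_nonneg (Real.exp_pos _).le, Real.norm_eq_abs,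
    mul_comm (t - s)]
  set d := ‖m s (x - pr ((t - s) • v)) - mom₀‖ with hd
  have hs0 := hs.1.le
  have hd0 : 0 ≤ d := norm_nonneg _
  have h1 : |(1 - ν)⁻¹ - charFreq L pr m t x v s| ≤ L.Λ * d := by
    rw [abs_sub_comm, charFreq, ← L.freq_zero]
    exact L.freq_lip _ _
  have h2 : |charEquil L pr m t x v s - relax (charFreq L pr m t x v) (charEquil L pr m t x v)
      (F₀ (x - pr (t • v)) v) (max s 0)| ≤ N * (weight β v)⁻¹ := by
    rw [max_eq_left hs0]
    obtain ⟨y0, yN⟩ := hb s hs0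
    have h3 := L.equil_pos (m s (x - pr ((t - s) • v))) v
    have h4 := L.equil_le (m s (x - pr ((t - s) • v))) v
    have h5 : L.Λ * (weight β v)⁻¹ ≤ N * (weight β v)⁻¹ := by gcongr
    rw [abs_le, charEquil]
    constructor <;> linarith
  have h3 : |maxwellian v - charEquil L pr m t x v s| ≤ L.Λ * d * (weight β v)⁻¹ := by
    rw [abs_sub_comm, charEquil, ← L.equil_zero]
    exact L.equil_lip _ _ _
  have h4 : |(1 - ν)⁻¹| ≤ L.Λ := by
    rw [← L.freq_zero, abs_of_nonneg (L.freq_nonneg _)]; exact L.freq_le _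
  have h5 : |h s| ≤ L.Λ * (N + L.Λ) * d * (weight β v)⁻¹ := by
    refine (abs_add_le _ _).trans ?_
    rw [abs_mul, abs_mul]
    calc _ ≤ (L.Λ * d) * (N * (weight β v)⁻¹) + L.Λ * (L.Λ * d * (weight β v)⁻¹) := by
          gcongr
      _ = _ := by ring
  calc _ ≤ Real.exp (-((1 - ν)⁻¹ * (t - s))) * (L.Λ * (N + L.Λ) * d * (weight β v)⁻¹) := by
        gcongr
    _ = _ := by ring

lemma ofReal_norm_moments_le {f : R3 → ℝ} (hf : FiniteEnergy f) :
    ENNReal.ofReal ‖moments f‖ ≤ 16 * ∫⁻ v, ENNReal.ofReal ((1 + ‖v‖ ^ 2) * |f v|) := by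
  have hi : Integrable fun v => (1 + ‖v‖ ^ 2) * |f v| := by
    refine hf.norm.congr (.of_forall fun v => ?_)
    dsimp only
    rw [Real.norm_eq_abs, abs_mul, abs_of_pos (by positivity)]
  have h := norm_moments_le hi (.of_forall fun v => le_rfl)
  rw [← ofReal_integral_eq_lintegral_ofReal hi (.of_forall fun v => by positivity)]
  refine (ENNReal.ofReal_le_ofReal h).trans (le_of_eq ?_)
  rw [ENNReal.ofReal_mul (by norm_num)]
  norm_num

/-- The moments of the solution, up to the freely transported part of the initial datum, in terms of
the deviation of the moments in the past. -/
lemma norm_flowMom_sub_le (hp : IsCover pr) (hβ : 5 < β) (hF : Datum β N F₀) (hN : L.Λ ≤ N)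
    (hm : Measurable fun q : ℝ × Ω => m q.1 q.2) {D : ℝ}
    (hD : ∀ s, 0 ≤ s → ∀ y, ‖m s y - mom₀‖ ≤ D) {t : ℝ} (ht : 0 ≤ t) (x : Ω) :
    ENNReal.ofReal ‖flowMom L pr F₀ m t x - mom₀ - Real.exp (-((1 - ν)⁻¹ * t)) •
        moments (fun v => F₀ (x - pr (t • v)) v - maxwellian v)‖ ≤
      ENNReal.ofReal (16 * (L.Λ * (N + L.Λ))) * ∫⁻ s in Ioc 0 t,
        ENNReal.ofReal (Real.exp (-((1 - ν)⁻¹ * (t - s)))) * ∫⁻ v,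
          ENNReal.ofReal ((1 + ‖v‖ ^ 2) / weight β v) *
            ENNReal.ofReal ‖m s (x - pr ((t - s) • v)) - mom₀‖ := by
  have hΛ : 0 < L.Λ := zero_lt_one.trans_le L.one_le
  have hN0 : 0 < N := hΛ.trans_le hN
  have hP0 : Profile β N fun v => F₀ (x - pr (t • v)) v :=
    { meas := (hF.meas.comp (f := fun v => (x - pr (t • v), v))
        ((hp.measurable_shift measurable_const (by fun_prop)).prodMk
          measurable_id)).aestronglyMeasurable
      nonneg := .of_forall fun v => hF.nonneg _ _
      le := .of_forall fun v => hF.le _ _ }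
  have f1 := ((profile_flow hp hF hN hm ht x).finiteEnergy hβ).sub finiteEnergy_maxwellian
  have f2 := (hP0.finiteEnergy hβ).sub finiteEnergy_maxwellian
  have e : flowMom L pr F₀ m t x - mom₀ - Real.exp (-((1 - ν)⁻¹ * t)) •
        moments (fun v => F₀ (x - pr (t • v)) v - maxwellian v) =
      moments fun v => flow L pr F₀ m t x v - maxwellian v -
        Real.exp (-((1 - ν)⁻¹ * t)) * (F₀ (x - pr (t • v)) v - maxwellian v) := by
    rw [f1.moments_sub (f2.const_mul _), moments_const_mul,
      ((profile_flow hp hF hN hm ht x).finiteEnergy hβ).moments_sub finiteEnergy_maxwellian]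
    rfl
  have hdm : Measurable fun q : R3 × ℝ =>
      ENNReal.ofReal ‖m q.2 (x - pr ((t - q.2) • q.1)) - mom₀‖ :=
    ((hm.comp (f := fun q : R3 × ℝ => (q.2, x - pr ((t - q.2) • q.1))) (measurable_snd.prodMk
      (hp.measurable_shift measurable_const (by fun_prop)))).sub_const _).norm.ennreal_ofReal
  have hwm := measurable_weight β
  rw [e]
  refine (ofReal_norm_moments_le (f1.sub (f2.const_mul _))).trans ?_
  have hpt : ∀ v, ENNReal.ofReal ((1 + ‖v‖ ^ 2) * |flow L pr F₀ m t x v - maxwellian v -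
        Real.exp (-((1 - ν)⁻¹ * t)) * (F₀ (x - pr (t • v)) v - maxwellian v)|) ≤
      ENNReal.ofReal (L.Λ * (N + L.Λ)) * ∫⁻ s in Ioc 0 t,
        ENNReal.ofReal ((1 + ‖v‖ ^ 2) / weight β v) *
        (ENNReal.ofReal (Real.exp (-((1 - ν)⁻¹ * (t - s)))) *
          ENNReal.ofReal ‖m s (x - pr ((t - s) • v)) - mom₀‖) := fun v => by
    have h1 := abs_flow_sub_maxwellian_le hp hF hN hm hD ht x v
    have hwv := weight_pos β v
    have hdi : IntervalIntegrable (fun s => Real.exp (-((1 - ν)⁻¹ * (t - s))) *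
        ‖m s (x - pr ((t - s) • v)) - mom₀‖) volume 0 t := by
      refine IntervalIntegrable.continuousOn_mul ?_ (by fun_prop)
      rw [intervalIntegrable_iff_integrableOn_Ioc_of_le ht]
      refine Measure.integrableOn_of_bounded (M := D) (by simp)
        (((hm.comp (f := fun s => (s, x - pr ((t - s) • v))) (measurable_id.prodMk
          (hp.measurable_shift measurable_const
            (by fun_prop)))).sub_const _).norm.aestronglyMeasurable) ?_
      refine (ae_restrict_iff' measurableSet_Ioc).2 (.of_forall fun s hs => ?_)
      rw [norm_norm]; exact hD s hs.1.le _
    have h0 : 0 ≤ ∫ s in (0 : ℝ)..t, Real.exp (-((1 - ν)⁻¹ * (t - s))) *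
        ‖m s (x - pr ((t - s) • v)) - mom₀‖ :=
      intervalIntegral.integral_nonneg ht fun s _ => by positivity
    rw [lintegral_const_mul' _ _ ENNReal.ofReal_ne_top]
    simp only [← ENNReal.ofReal_mul (Real.exp_pos _).le]
    rw [← ofReal_intervalIntegral hdi ht fun s _ => by positivity,
      ← ENNReal.ofReal_mul (by positivity), ← ENNReal.ofReal_mul (by positivity)]
    refine ENNReal.ofReal_le_ofReal ?_
    calc _ ≤ (1 + ‖v‖ ^ 2) * ((L.Λ * (N + L.Λ) * ∫ s in (0 : ℝ)..t,
          Real.exp (-((1 - ν)⁻¹ * (t - s))) * ‖m s (x - pr ((t - s) • v)) - mom₀‖) *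
          (weight β v)⁻¹) := by gcongr
      _ = _ := by rw [div_eq_mul_inv]; ring
  calc _ ≤ 16 * ∫⁻ v, ENNReal.ofReal (L.Λ * (N + L.Λ)) * ∫⁻ s in Ioc 0 t,
        ENNReal.ofReal ((1 + ‖v‖ ^ 2) / weight β v) *
        (ENNReal.ofReal (Real.exp (-((1 - ν)⁻¹ * (t - s)))) *
          ENNReal.ofReal ‖m s (x - pr ((t - s) • v)) - mom₀‖) := by
        gcongr with v; exact hpt v
    _ = ENNReal.ofReal (16 * (L.Λ * (N + L.Λ))) * ∫⁻ s in Ioc 0 t, ∫⁻ v,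
        ENNReal.ofReal ((1 + ‖v‖ ^ 2) / weight β v) *
        (ENNReal.ofReal (Real.exp (-((1 - ν)⁻¹ * (t - s)))) *
          ENNReal.ofReal ‖m s (x - pr ((t - s) • v)) - mom₀‖) := by
        rw [lintegral_const_mul' _ _ ENNReal.ofReal_ne_top, ← mul_assoc,
          ENNReal.ofReal_mul (p := 16) (by norm_num), lintegral_lintegral_swap]
        · norm_num
        · exact Measurable.aemeasurable (by fun_prop)
    _ = _ := by
        congr 1
        refine lintegral_congr fun s => ?_
        rw [← lintegral_const_mul' _ _ ENNReal.ofReal_ne_top]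
        exact lintegral_congr fun v => mul_left_comm _ _ _

/-- After a time `δ`, dispersion turns small total entropy into small deviation of the moments,
averaged over velocities. -/
lemma lintegral_deviation_le [SigmaFinite (volume : Measure Ω)] (hp : IsCover pr) (hβ : 5 < β)
    (hF : Datum β N F₀) (hN : L.Λ ≤ N) (hm : Measurable fun q : ℝ × Ω => m q.1 q.2) {s D : ℝ}
    (hs : 0 ≤ s) (hfix : ∀ y, flowMom L pr F₀ m s y = m s y) (hD : ∀ y, ‖m s y - mom₀‖ ≤ D)
    {R l : ℝ} (hl : 0 < l) (hl' : l ≤ 1 / 4) {C : ℝ≥0} {θ : ℝ} (x : Ω)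
    (hC : ∀ g : Ω → ℝ≥0∞, Measurable g →
      ∫⁻ v in Metric.closedBall (0 : R3) R, g (x - pr (θ • v)) ≤ C * ∫⁻ y, g y)
    {ε : ℝ} (hε : 0 ≤ ε) (hE : phaseEntropy (flow L pr F₀ m s) ≤ ENNReal.ofReal ε) :
    ∫⁻ v, ENNReal.ofReal ((1 + ‖v‖ ^ 2) / weight β v) *
        ENNReal.ofReal ‖m s (x - pr (θ • v)) - mom₀‖ ≤
      ENNReal.ofReal (16 * l⁻¹ * C * ε + 16 * l * entMass *
        (volume : Measure R3).real (Metric.closedBall 0 R) +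
        D * ∫ v in (Metric.closedBall (0 : R3) R)ᶜ, (1 + ‖v‖ ^ 2) / weight β v) := by
  have hD0 : 0 ≤ D := (norm_nonneg _).trans (hD x)
  have hψ0 : ∀ v : R3, 0 ≤ (1 + ‖v‖ ^ 2) / weight β v := fun v =>
    div_nonneg (by positivity) (weight_pos β v).le
  have hψ1 : ∀ v : R3, (1 + ‖v‖ ^ 2) / weight β v ≤ 1 := fun v => by
    rw [div_le_one (weight_pos β v), weight]
    calc (1 + ‖v‖ ^ 2) ≤ (1 + ‖v‖) ^ (2 : ℝ) := by
          rw [Real.rpow_two]; nlinarith [norm_nonneg v]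
      _ ≤ _ := Real.rpow_le_rpow_of_exponent_le (by linarith [norm_nonneg v]) (by linarith)
  have hent := entMass_nonneg
  have hprof := profile_flow hp hF hN hm hs
  have hg : Measurable fun y => ∫⁻ v, ENNReal.ofReal
      (relEnt (flow L pr F₀ m s y v) (maxwellian v)) :=
    (measurable_relEnt_maxwellian ((measurable_flow hp hF hm).comp
      (f := fun p : Ω × R3 => (s, p.1, p.2)) (by fun_prop))
      measurable_snd).ennreal_ofReal.lintegral_prod_right'
  simp only [← (hprof _).ofReal_velEntropy hβ] at hg
  have hball := Metric.isClosed_closedBall.measurableSet (s := Metric.closedBall (0 : R3) R)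
  have htail0 : 0 ≤ ∫ v in (Metric.closedBall (0 : R3) R)ᶜ, (1 + ‖v‖ ^ 2) / weight β v :=
    integral_nonneg fun v => hψ0 v
  have hV : 0 ≤ (volume : Measure R3).real (Metric.closedBall 0 R) := measureReal_nonneg
  rw [← lintegral_add_compl _ hball, ENNReal.ofReal_add (by positivity) (by positivity)]
  refine add_le_add ?_ ?_
  · calc _ ≤ ∫⁻ v in Metric.closedBall (0 : R3) R, (ENNReal.ofReal (16 * l⁻¹) *
          ENNReal.ofReal (velEntropy (flow L pr F₀ m s (x - pr (θ • v)))) +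
          ENNReal.ofReal (16 * l * entMass)) := by
          refine lintegral_mono fun v => ?_
          have h1 := (hprof (x - pr (θ • v))).moments_sub_le hβ hl hl'
          have h2 := (hprof (x - pr (θ • v))).velEntropy_nonneg
          rw [← ENNReal.ofReal_mul (p := 16 * l⁻¹) (by positivity), ← ENNReal.ofReal_mul (hψ0 v),
            ← ENNReal.ofReal_add (by positivity) (by positivity)]
          refine ENNReal.ofReal_le_ofReal ?_
          rw [← hfix]
          refine (mul_le_of_le_one_left (norm_nonneg _) (hψ1 v)).trans (h1.trans (le_of_eq ?_))
          ring
      _ = ENNReal.ofReal (16 * l⁻¹) * (∫⁻ v in Metric.closedBall (0 : R3) R,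
          ENNReal.ofReal (velEntropy (flow L pr F₀ m s (x - pr (θ • v))))) +
          ENNReal.ofReal (16 * l * entMass) * volume (Metric.closedBall (0 : R3) R) := by
          rw [lintegral_add_right _ measurable_const,
            lintegral_const_mul' _ _ ENNReal.ofReal_ne_top, setLIntegral_const]
      _ ≤ ENNReal.ofReal (16 * l⁻¹) * (C * ENNReal.ofReal ε) +
          ENNReal.ofReal (16 * l * entMass) * volume (Metric.closedBall (0 : R3) R) := by
          gcongr
          refine (hC _ hg).trans ?_
          gcongr
          rwa [← phaseEntropy_eq hβ hprof ((measurable_flow hp hF hm).comp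
            (f := fun p : Ω × R3 => (s, p.1, p.2)) (by fun_prop))]
      _ = _ := by
          rw [ENNReal.ofReal_add (by positivity) (by positivity),
            ENNReal.ofReal_mul (q := (volume : Measure R3).real _) (by positivity),
            ofReal_measureReal (by exact measure_closedBall_lt_top.ne),
            ENNReal.ofReal_mul (q := ε) (by positivity), ENNReal.ofReal_mul (q := (C : ℝ))
              (by positivity), ENNReal.ofReal_coe_nnreal, mul_assoc (ENNReal.ofReal (16 * l⁻¹))]
  · rw [ENNReal.ofReal_mul hD0, ofReal_integral_eq_lintegral_ofReal
      (integrable_one_add_sq_div_weight hβ).integrableOn (.of_forall hψ0),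
      ← lintegral_const_mul' _ _ ENNReal.ofReal_ne_top]
    refine lintegral_mono fun v => ?_
    rw [mul_comm]
    gcongr
    exact hD _

lemma lintegral_decay_le {a : ℝ} (ha : 0 < a) {t : ℝ} (ht : 0 ≤ t) :
    ∫⁻ s in Ioc 0 t, ENNReal.ofReal (Real.exp (-(a * (t - s)))) ≤ ENNReal.ofReal a⁻¹ := by
  rw [← ofReal_intervalIntegral (Continuous.intervalIntegrable (by fun_prop) _ _) ht
    fun s _ => by positivity]
  refine ENNReal.ofReal_le_ofReal ?_
  have e : ∀ s : ℝ, Real.exp (-(a * (t - s))) = Real.exp (-(a * t)) * Real.exp (a * s) := fun s => by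
    rw [← Real.exp_add]; ring_nf
  simp only [e]
  rw [intervalIntegral.integral_const_mul]
  calc _ ≤ Real.exp (-(a * t)) * (a⁻¹ * Real.exp (a * t)) := by
        gcongr; exact integral_exp_le ha t
    _ = a⁻¹ := by
        rw [mul_left_comm, ← Real.exp_add, neg_add_cancel, Real.exp_zero, mul_one]

lemma mul_div_add_one_le {K η : ℝ} (hK : 0 ≤ K) (hη : 0 ≤ η) : K * (η / (K + 1)) ≤ η := by
  rw [mul_div_assoc', div_le_iff₀ (by linarith)]; nlinarith

/-- If the entropy was small up to a fixed time `δ` ago, then the moments of the solution are close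
to those of `μ`, up to the contribution of the freely transported initial datum. -/
lemma exists_flowMom_close [SigmaFinite (volume : Measure Ω)] (L : RelaxLaw ν β) (hp : IsCover pr)
    (hν' : ν < 1) (hβ : 5 < β) (hN : L.Λ ≤ N) {η : ℝ} (hη : 0 < η) :
    ∃ ε δ : ℝ, 0 < ε ∧ 0 < δ ∧ ∀ (F₀ : Ω → R3 → ℝ) (m : ℝ → Ω → Mom), Datum β N F₀ →
      Measurable (fun q : ℝ × Ω => m q.1 q.2) →
      (∀ t, 0 ≤ t → ∀ x, flowMom L pr F₀ m t x = m t x) → ∀ t, 0 ≤ t →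
      (∀ s ∈ Ioc 0 t, δ ≤ t - s → phaseEntropy (flow L pr F₀ m s) ≤ ENNReal.ofReal ε) → ∀ x,
      ‖m t x - mom₀‖ ≤ Real.exp (-((1 - ν)⁻¹ * t)) *
        ‖moments (fun v => F₀ (x - pr (t • v)) v - maxwellian v)‖ + η := by
  have hΛ : 0 < L.Λ := zero_lt_one.trans_le L.one_le
  have hN0 : 0 < N := hΛ.trans_le hN
  have hΨ := weightMass_nonneg β
  have hent := entMass_nonneg
  have ha : 0 < (1 - ν)⁻¹ := inv_pos.2 (by linarith)
  have ha' : 0 < 1 - ν := by linarith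
  set D := 16 * (N * weightMass β) + ‖mom₀‖ with hDdef
  have hD0 : 0 ≤ D := by positivity
  set K := 16 * (L.Λ * (N + L.Λ)) with hK
  have hK0 : 0 < K := by positivity
  -- The remainder is `K (S (1 - ν) + D Ψ δ)`, with `S` the sum of the contributions of the entropy,
  -- of the remainder in the entropy inequality, and of the large velocities.
  set δ := η / 4 / (K * (D * weightMass β) + 1) with hδ
  have hδ0 : 0 < δ := by positivity
  obtain ⟨R, hR⟩ := exists_tail_lt (integrable_one_add_sq_div_weight hβ)
    (η := η / 4 / (K * (1 - ν) * D + 1)) (by positivity)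
  set tl := ∫ v in (Metric.closedBall (0 : R3) R)ᶜ, (1 + ‖v‖ ^ 2) / weight β v with htl
  have htl0 : 0 ≤ tl := integral_nonneg fun v => div_nonneg (by positivity) (weight_pos β v).le
  set V := (volume : Measure R3).real (Metric.closedBall 0 R) with hV
  have hV0 : 0 ≤ V := measureReal_nonneg
  set l := min (1 / 4) (η / 4 / (K * (1 - ν) * (16 * entMass * V) + 1)) with hl
  have hl0 : 0 < l := lt_min (by norm_num) (by positivity)
  obtain ⟨C, hC⟩ := hp.spread δ R hδ0
  have hC0 : (0 : ℝ) ≤ C := C.2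
  set ε := η / 4 / (K * (1 - ν) * (16 * l⁻¹ * C) + 1) with hε
  have hε0 : 0 < ε := by positivity
  refine ⟨ε, δ, hε0, hδ0, fun F₀ m hF hm hfix t ht hE x => ?_⟩
  have hD : ∀ s, 0 ≤ s → ∀ y, ‖m s y - mom₀‖ ≤ D := fun s hs y => by
    refine (norm_sub_le _ _).trans ?_
    rw [← hfix s hs]
    exact add_le_add ((profile_flow hp hF hN hm hs y).norm_moments_le hβ) le_rfl
  set S := 16 * l⁻¹ * C * ε + 16 * l * entMass * V + D * tl with hS
  have hS0 : 0 ≤ S := by positivity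
  have hKS : K * (S * (1 - ν) + D * weightMass β * δ) ≤ η := by
    have h1 := mul_div_add_one_le (K := K * (D * weightMass β)) (η := η / 4) (by positivity)
      (by positivity)
    have h2 := mul_div_add_one_le (K := K * (1 - ν) * (16 * l⁻¹ * C)) (η := η / 4) (by positivity)
      (by positivity)
    have h3 := mul_div_add_one_le (K := K * (1 - ν) * D) (η := η / 4) (by positivity)
      (by positivity)
    have h4 := mul_div_add_one_le (K := K * (1 - ν) * (16 * entMass * V)) (η := η / 4)
      (by positivity) (by positivity)
    have h5 : K * (1 - ν) * D * tl ≤ K * (1 - ν) * D * (η / 4 / (K * (1 - ν) * D + 1)) :=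
      mul_le_mul_of_nonneg_left hR.le (by positivity)
    have h6 : K * (1 - ν) * (16 * entMass * V) * l ≤ K * (1 - ν) * (16 * entMass * V) *
        (η / 4 / (K * (1 - ν) * (16 * entMass * V) + 1)) :=
      mul_le_mul_of_nonneg_left (min_le_right _ _) (by positivity)
    rw [← hδ] at h1
    rw [← hε] at h2
    calc K * (S * (1 - ν) + D * weightMass β * δ) = K * (1 - ν) * (16 * l⁻¹ * C) * ε +
          K * (1 - ν) * (16 * entMass * V) * l + K * (1 - ν) * D * tl +
          K * (D * weightMass β) * δ := by rw [hS]; ring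
      _ ≤ η := by linarith
  have hinner : ∀ s ∈ Ioc 0 t, ENNReal.ofReal (Real.exp (-((1 - ν)⁻¹ * (t - s)))) * ∫⁻ v,
      ENNReal.ofReal ((1 + ‖v‖ ^ 2) / weight β v) *
        ENNReal.ofReal ‖m s (x - pr ((t - s) • v)) - mom₀‖ ≤
      ENNReal.ofReal (Real.exp (-((1 - ν)⁻¹ * (t - s)))) * ENNReal.ofReal S +
        (Ioc (t - δ) t).indicator (fun _ => ENNReal.ofReal (D * weightMass β)) s := by
    intro s hs
    by_cases hsδ : δ ≤ t - s
    · refine le_add_right ?_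
      gcongr
      exact lintegral_deviation_le hp hβ hF hN hm hs.1.le (hfix s hs.1.le) (hD s hs.1.le) hl0
        (min_le_left _ _) x (fun g hg => hC (t - s) hsδ x g hg) hε0.le (hE s hs hsδ)
    · refine le_add_left ?_
      rw [indicator_of_mem (show s ∈ Ioc (t - δ) t from ⟨by linarith, hs.2⟩)]
      have h1 : ENNReal.ofReal (Real.exp (-((1 - ν)⁻¹ * (t - s)))) ≤ 1 := by
        rw [ENNReal.ofReal_le_one, Real.exp_le_one_iff, neg_nonpos]
        exact mul_nonneg ha.le (by linarith [hs.2])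
      refine (mul_le_of_le_one_left' h1).trans ?_
      rw [ENNReal.ofReal_mul hD0, weightMass, ofReal_integral_eq_lintegral_ofReal
        (integrable_one_add_sq_div_weight hβ) (.of_forall fun v =>
          div_nonneg (by positivity) (weight_pos β v).le),
        ← lintegral_const_mul' _ _ ENNReal.ofReal_ne_top]
      refine lintegral_mono fun v => ?_
      rw [mul_comm]
      gcongr
      exact hD s hs.1.le _
  have hrem : ‖flowMom L pr F₀ m t x - mom₀ - Real.exp (-((1 - ν)⁻¹ * t)) •
        moments (fun v => F₀ (x - pr (t • v)) v - maxwellian v)‖ ≤ η := by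
    rw [← ENNReal.ofReal_le_ofReal_iff hη.le]
    refine (norm_flowMom_sub_le hp hβ hF hN hm hD ht x).trans
      (le_trans ?_ (ENNReal.ofReal_le_ofReal hKS))
    rw [ENNReal.ofReal_mul hK0.le]
    gcongr
    calc _ ≤ ∫⁻ s in Ioc 0 t, (ENNReal.ofReal (Real.exp (-((1 - ν)⁻¹ * (t - s)))) *
          ENNReal.ofReal S +
          (Ioc (t - δ) t).indicator (fun _ => ENNReal.ofReal (D * weightMass β)) s) :=
          setLIntegral_mono' measurableSet_Ioc hinner
      _ ≤ ENNReal.ofReal (1 - ν) * ENNReal.ofReal S +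
          ENNReal.ofReal (D * weightMass β) * ENNReal.ofReal δ := by
          rw [lintegral_add_right _ (measurable_const.indicator measurableSet_Ioc),
            lintegral_mul_const' _ _ ENNReal.ofReal_ne_top]
          gcongr
          · have := lintegral_decay_le ha ht
            rwa [inv_inv] at this
          · refine (setLIntegral_le_lintegral _ _).trans ?_
            rw [lintegral_indicator measurableSet_Ioc, setLIntegral_const, Real.volume_Ioc,
              sub_sub_cancel]
      _ = _ := by
          rw [ENNReal.ofReal_add (p := S * (1 - ν)) (by positivity) (by positivity),
            ENNReal.ofReal_mul (p := S) hS0,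
            ENNReal.ofReal_mul (q := δ) (by positivity), mul_comm (ENNReal.ofReal (1 - ν))]
  rw [hfix t ht] at hrem
  have h1 := norm_add_le (m t x - mom₀ - Real.exp (-((1 - ν)⁻¹ * t)) •
        moments (fun v => F₀ (x - pr (t • v)) v - maxwellian v)) (Real.exp (-((1 - ν)⁻¹ * t)) •
        moments (fun v => F₀ (x - pr (t • v)) v - maxwellian v))
  rw [sub_add_cancel, norm_smul, Real.norm_of_nonneg (Real.exp_pos _).le] at h1
  linarith

end Close

/-! ### The truncation is never active -/

/-- The law and the constants for given bounds `C₀` on the density and `M` on the datum: `L`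
coincides with the ES-BGK law on a box that contains the moments of all profiles close to `μ`, and
of all solutions during the initial layer `[0, (C₁ M)⁻¹]`. -/
structure Calibration (ν β C₀ M : ℝ) where
  L : RelaxLaw ν β
  c : ℝ
  B : ℝ
  κ : ℝ
  C₁ : ℝ
  c_pos : 0 < c
  κ_pos : 0 < κ
  one_le_C₁ : 1 ≤ C₁
  agrees : ∀ m, MomBox c B κ m → L.freq m = momFreq ν m ∧ ∀ v, L.equil m v = momGauss ν m v
  near : ∀ f, FiniteEnergy f → (∀ᵐ v, 0 ≤ f v) → ‖moments f - mom₀‖ ≤ 1 / 4 →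
    MomBox c B κ (moments f)
  early : ∀ f, Profile β (M + 1) f → C₀ / 2 ≤ momDensity (moments f) → MomBox c B κ (moments f)
  layer : (C₁ * M)⁻¹ * L.Λ ^ 2 ≤ 1 / 2

lemma exists_calibration {ν β C₀ M : ℝ} (hν : -1 / 2 < ν) (hν' : ν < 1) (hβ : 5 < β)
    (hC₀ : 0 < C₀) (hM : 0 < M) : Nonempty (Calibration ν β C₀ M) := by
  set c := min (C₀ / 2) (1 / 2) with hc
  have hc0 : 0 < c := lt_min (by linarith) (by norm_num)
  obtain ⟨κ₁, hκ₁, hbox⟩ := exists_momBox β hβ (M + 1) hc0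
  set κ := min κ₁ 1 with hκ
  have hκ0 : 0 < κ := lt_min hκ₁ one_pos
  set B := max (16 * ((M + 1) * weightMass β)) (‖mom₀‖ + 1) with hB
  obtain ⟨L, hL⟩ := exists_relaxLaw β hc0 hκ0 hν hν'
    (momBox_mom₀ (B := B) (min_le_right _ _) (le_max_right _ _) (min_le_right κ₁ 1))
  have hΛ := L.one_le
  refine ⟨⟨L, c, B, κ, max 1 (2 * L.Λ ^ 2 / M), hc0, hκ0, le_max_left _ _, hL, fun f hf h0 hn => ?_,
    fun f hf hd => ?_, ?_⟩⟩
  · exact momBox_of_near hf h0 hn (min_le_right _ _) (le_max_right _ _) (min_le_right κ₁ 1)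
  · have hd' : c ≤ momDensity (moments f) := (min_le_left _ _).trans hd
    exact momBox_moments (hf.finiteEnergy hβ) hf.nonneg
      ((hf.norm_moments_le hβ).trans (le_max_left _ _)) hd'
      fun b => (min_le_left _ _).trans (hbox f hf hd' b)
  · have h1 : 2 * L.Λ ^ 2 ≤ max 1 (2 * L.Λ ^ 2 / M) * M := by
      rw [← div_le_iff₀ hM]; exact le_max_right _ _
    have h2 : 0 < max 1 (2 * L.Λ ^ 2 / M) * M := by positivity
    rw [inv_mul_le_iff₀ h2]; linarith

section

variable {Ω : Type} [AddCommGroup Ω] [MeasureSpace Ω]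
  {ν β C₀ M : ℝ} {pr : R3 → Ω} {F₀ : Ω → R3 → ℝ} {m : ℝ → Ω → Mom} {N : ℝ}

lemma Profile.mono {f : R3 → ℝ} (hf : Profile β M f) (h : M ≤ N) : Profile β N f where
  meas := hf.meas
  nonneg := hf.nonneg
  le := hf.le.mono fun v hv =>
    hv.trans (mul_le_mul_of_nonneg_right h (inv_pos.2 (weight_pos β v)).le)

lemma Datum.mono {Ω : Type} [MeasureSpace Ω] {F₀ : Ω → R3 → ℝ} (hF : Datum β M F₀) (h : M ≤ N) :
    Datum β N F₀ where
  meas := hF.meas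
  nonneg := hF.nonneg
  le x v := (hF.le x v).trans (mul_le_mul_of_nonneg_right h (inv_pos.2 (weight_pos β v)).le)

lemma Datum.profile {Ω : Type} [AddCommGroup Ω] [MeasureSpace Ω] {pr : R3 → Ω} {F₀ : Ω → R3 → ℝ}
    (hF : Datum β N F₀) (hp : IsCover pr) (t : ℝ) (x : Ω) :
    Profile β N fun v => F₀ (x - pr (t • v)) v where
  meas := (hF.meas.comp (f := fun v => (x - pr (t • v), v))
    ((hp.measurable_shift measurable_const (by fun_prop)).prodMk measurable_id)).aestronglyMeasurable
  nonneg := .of_forall fun v => hF.nonneg _ _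
  le := .of_forall fun v => hF.le _ _

/-- During the initial layer the gain is small, and the density keeps half of its lower bound. -/
lemma Calibration.momBox_of_le (K : Calibration ν β C₀ M) (hp : IsCover pr) (hβ : 5 < β)
    (hF : Datum β M F₀) (hm : Measurable fun q : ℝ × Ω => m q.1 q.2) {t : ℝ}
    (ht : 0 ≤ t) (ht1 : t ≤ (K.C₁ * M)⁻¹) {x : Ω} (hx : C₀ ≤ ∫ v, F₀ (x - pr (t • v)) v) :
    MomBox K.c K.B K.κ (flowMom K.L pr F₀ m t x) := by
  have hΛ := K.L.one_le
  have hlayer : t * K.L.Λ ^ 2 ≤ 1 / 2 :=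
    (mul_le_mul_of_nonneg_right ht1 (sq_nonneg _)).trans K.layer
  have hprof := profile_flow (L := K.L) hp (hF.mono (le_max_left M K.L.Λ)) (le_max_right _ _) hm ht x
  have hbd : ∀ v, flow K.L pr F₀ m t x v ≤ (M + 1) * (weight β v)⁻¹ := fun v => by
    have hw := inv_pos.2 (weight_pos β v)
    have h1 := relax_le_add (bddMeas_charFreq (L := K.L) hp hm t x v) (bddMeas_charEquil hp hm t x v)
      ht (fun _ => K.L.freq_nonneg _) (fun _ => K.L.freq_le _) (fun _ => (K.L.equil_pos _ _).le)
      (fun _ => K.L.equil_le _ _) (hF.nonneg (x - pr (t • v)) v)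
    calc _ ≤ _ := h1
      _ ≤ M * (weight β v)⁻¹ + t * (K.L.Λ * (K.L.Λ * (weight β v)⁻¹)) := by
          gcongr; exact hF.le _ _
      _ = (M + t * K.L.Λ ^ 2) * (weight β v)⁻¹ := by ring
      _ ≤ _ := by gcongr; linarith
  refine K.early _ ⟨hprof.meas, hprof.nonneg, .of_forall hbd⟩ ?_
  rw [← density_eq, density]
  have hΛt : t * K.L.Λ ≤ 1 / 2 := le_trans (by gcongr; nlinarith) hlayer
  have h2 : ∀ v, F₀ (x - pr (t • v)) v * (1 / 2) ≤ flow K.L pr F₀ m t x v := fun v => by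
    have ha := bddMeas_charFreq (L := K.L) hp hm t x v
    refine le_trans ?_ (relax_ge ha (bddMeas_charEquil hp hm t x v) ht
      (fun _ _ => K.L.freq_nonneg _) fun _ _ => (K.L.equil_pos _ _).le)
    refine mul_le_mul_of_nonneg_left ?_ (hF.nonneg _ _)
    have h3 : ∫ τ in (0 : ℝ)..t, charFreq K.L pr m t x v τ ≤ ∫ τ in (0 : ℝ)..t, K.L.Λ :=
      intervalIntegral.integral_mono_on ht (ha.intervalIntegrable _ _) (by simp)
        fun s _ => K.L.freq_le _
    rw [intervalIntegral.integral_const, smul_eq_mul, sub_zero] at h3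
    have h4 := Real.add_one_le_exp (-∫ τ in (0 : ℝ)..t, charFreq K.L pr m t x v τ)
    linarith
  have h5 := integral_mono (((hF.profile hp t x).finiteEnergy hβ).integrable.mul_const (1 / 2))
    (hprof.finiteEnergy hβ).integrable h2
  rw [integral_mul_const] at h5
  linarith

/-- The moments of the solution of the truncated problem never leave the box. The proof advances in
steps of the dispersion time `δ`: the entropy estimate up to time `t - δ` gives closeness to `μ` at
time `t`. -/
lemma exists_solution_in_box [SigmaFinite (volume : Measure Ω)] (K : Calibration ν β C₀ M) (hp : IsCover pr) (hν : -1 / 2 < ν)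
    (hν' : ν < 1) (hβ : 5 < β) :
    ∃ ε : ℝ, 0 < ε ∧ ∀ F₀ : Ω → R3 → ℝ, Datum β M F₀ → phaseEntropy F₀ ≤ ENNReal.ofReal ε →
      (∀ t : ℝ, 0 ≤ t → ∀ᵐ x, C₀ ≤ ∫ v, F₀ (x - pr (t • v)) v) →
      (∀ t, (K.C₁ * M)⁻¹ ≤ t → ∀ᵐ x, Real.exp (-((1 - ν)⁻¹ * t)) *
        ‖moments (fun v => F₀ (x - pr (t • v)) v - maxwellian v)‖ ≤ 1 / 8) →
      ∃ m : ℝ → Ω → Mom, Measurable (fun q : ℝ × Ω => m q.1 q.2) ∧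
        (∀ t, 0 ≤ t → ∀ x, flowMom K.L pr F₀ m t x = m t x) ∧
        ∀ t, 0 ≤ t → ∀ᵐ x, MomBox K.c K.B K.κ (m t x) := by
  have hN : K.L.Λ ≤ max M K.L.Λ := le_max_right _ _
  obtain ⟨ε, δ, hε, hδ, hclose⟩ := exists_flowMom_close K.L hp hν' hβ hN (η := 1 / 8) (by norm_num)
  refine ⟨ε, hε, fun F₀ hF hent hdens hsmall => ?_⟩
  have hFN := hF.mono (le_max_left M K.L.Λ)
  obtain ⟨m, hm, hfix, D, hD, hconv⟩ := exists_fixedPoint (L := K.L) hp hβ hFN hN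
  obtain ⟨k, hk, hE⟩ := exists_phaseEntropy_flow_le hp hβ hFN hN hm hconv
  refine ⟨m, hm, hfix, ?_⟩
  have hmain : ∀ n : ℕ, ∀ t, 0 ≤ t → t < n * δ → ∀ᵐ x, MomBox K.c K.B K.κ (m t x) := by
    intro n
    induction n with
    | zero => intro t ht htn; simp only [Nat.cast_zero, zero_mul] at htn; linarith
    | succ n ih =>
      intro t ht htn
      rcases le_total t (K.C₁ * M)⁻¹ with h1 | h1
      · filter_upwards [hdens t ht] with x hx
        rw [← hfix t ht x]
        exact K.momBox_of_le hp hβ hF hm ht h1 hx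
      · have hEs : ∀ s ∈ Ioc 0 t, δ ≤ t - s →
            phaseEntropy (flow K.L pr F₀ m s) ≤ ENNReal.ofReal ε := fun s hs hsδ => by
          refine (phaseEntropy_flow_le hp hβ hFN hN hm hk.le
            (hent.trans_lt ENNReal.ofReal_lt_top).ne hE hs.1.le fun r hr => ?_).trans hent
          push_cast at htn
          filter_upwards [ih r hr.1.le (by linarith [hr.2])] with x hx
          have e : K.L.equil (m r x) = momGauss ν (m r x) := funext (K.agrees _ hx).2
          rw [e]
          rw [← hfix r hr.1.le x] at hx ⊢
          exact (profile_flow hp hFN hN hm hr.1.le x).velEntropy_momGauss_le hβ hν hν' K.c_pos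
            K.κ_pos hx
        filter_upwards [hsmall t h1] with x hx
        have h2 := hclose F₀ m hFN hm hfix t ht hEs x
        have hprof := profile_flow (L := K.L) hp hFN hN hm ht x
        rw [← hfix t ht x] at h2 ⊢
        exact K.near _ (hprof.finiteEnergy hβ) hprof.nonneg (h2.trans (by linarith))
  intro t ht
  obtain ⟨n, hn⟩ := exists_nat_gt (t / δ)
  exact hmain n t ht ((div_lt_iff₀ hδ).1 hn)

end

/-! ### Mild solutions as solutions of the truncated problem -/

lemma relax_congr_ae {A M a g : ℝ → ℝ} {t : ℝ} (ht : 0 ≤ t) (y : ℝ)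
    (h : ∀ᵐ s, s ∈ Ioc 0 t → A s = a s ∧ M s = g s) :
    y * Real.exp (-∫ τ in (0 : ℝ)..t, A τ) +
      ∫ s in (0 : ℝ)..t, Real.exp (-∫ τ in s..t, A τ) * A s * M s = relax a g y t := by
  have h1 : ∀ s, 0 ≤ s → s ≤ t → ∫ τ in s..t, A τ = ∫ τ in s..t, a τ := fun s hs hst => by
    refine intervalIntegral.integral_congr_ae ?_
    filter_upwards [h] with τ hτ hτs
    rw [uIoc_of_le hst] at hτs
    exact (hτ ⟨hs.trans_lt hτs.1, hτs.2⟩).1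
  rw [relax, linearSol, h1 0 le_rfl ht]
  congr 1
  refine intervalIntegral.integral_congr_ae ?_
  filter_upwards [h] with s hs hst
  rw [uIoc_of_le ht] at hst
  rw [h1 s hst.1.le hst.2, (hs hst).1, (hs hst).2, mul_assoc]

lemma intervalIntegrable_gain {A M a g : ℝ → ℝ} {t : ℝ} (ht : 0 ≤ t) (ha : BddMeas a)
    (hg : BddMeas g) (h : ∀ᵐ s, s ∈ Ioc 0 t → A s = a s ∧ M s = g s) :
    IntervalIntegrable A volume 0 t ∧
    IntervalIntegrable (fun s => Real.exp (-∫ τ in s..t, A τ) * A s * M s) volume 0 t := by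
  have h1 : ∀ s, 0 ≤ s → s ≤ t → ∫ τ in s..t, A τ = ∫ τ in s..t, a τ := fun s hs hst => by
    refine intervalIntegral.integral_congr_ae ?_
    filter_upwards [h] with τ hτ hτs
    rw [uIoc_of_le hst] at hτs
    exact (hτ ⟨hs.trans_lt hτs.1, hτs.2⟩).1
  constructor
  · refine (ha.intervalIntegrable 0 t).congr_ae ?_
    rw [uIoc_of_le ht]
    refine (ae_restrict_iff' measurableSet_Ioc).2 ?_
    filter_upwards [h] with s hs hst using (hs hst).1.symm
  · have h2 := (ha.exp_mul_intervalIntegrable (ha.mul hg) 0 t).const_mul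
      (Real.exp (-∫ τ in (0 : ℝ)..t, a τ))
    refine h2.congr_ae ?_
    rw [uIoc_of_le ht]
    refine (ae_restrict_iff' measurableSet_Ioc).2 ?_
    filter_upwards [h] with s hs hst
    have h3 := intervalIntegral.integral_add_adjacent_intervals (ha.intervalIntegrable 0 s)
      (ha.intervalIntegrable s t)
    rw [h1 s hst.1.le hst.2, (hs hst).1, (hs hst).2, ← mul_assoc, ← Real.exp_add, mul_assoc, ← h3]
    congr 2; ring

lemma collisionFrequency_eq_momFreq {f : R3 → ℝ} (hf : FiniteEnergy f) (ν : ℝ) :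
    collisionFrequency ν f = momFreq ν (moments f) := by
  by_cases h0 : momDensity (moments f) = 0
  · rw [collisionFrequency, momFreq, density_eq, h0, zero_mul, zero_mul]
  · exact collisionFrequency_eq hf h0 ν

lemma MomBox.momFreq_mem {c B κ ν : ℝ} {m : Mom} (hm : MomBox c B κ m) (hc : 0 ≤ c) (hκ : 0 ≤ κ)
    (hν' : ν < 1) : momFreq ν m ∈ Icc 0 (B / (1 - ν)) := by
  have hB : 0 ≤ B := (norm_nonneg m).trans hm.norm_le
  have h1ν : 0 < 1 - ν := by linarith
  by_cases h0 : momDensity m = 0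
  · rw [momFreq, h0, zero_mul, zero_div]; exact ⟨le_rfl, by positivity⟩
  have h1 := hκ.trans (hm.energy_ge (momVel m))
  have h2 : ∑ i, centred m (momVel m) i i = 3 * (momDensity m * momTemp m) := by
    simp only [centred_momVel h0, ← Finset.mul_sum]
    rw [momTemp]; ring
  have h3 : ∀ i, centred m (momVel m) i i = m (some i, some i) -
      momDensity m * momVel m i ^ 2 := fun i => by
    have : m (none, some i) = momDensity m * momVel m i := by
      simp only [momVel, PiLp.smul_apply, smul_eq_mul]; field_simp
    rw [centred, this, momDensity]; ring
  have h4 : ∀ i, centred m (momVel m) i i ≤ B := fun i => by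
    rw [h3]
    have h5 := le_of_abs_le ((abs_apply_le_norm m (some i, some i)).trans hm.norm_le)
    have h6 := mul_nonneg (hc.trans hm.density_ge) (sq_nonneg (momVel m i))
    linarith
  have h5 : momDensity m * momTemp m ≤ B := by
    have := Finset.sum_le_sum fun i (_ : i ∈ Finset.univ) => h4 i
    rw [h2] at this
    simp at this
    linarith
  exact ⟨div_nonneg (by linarith) h1ν.le, div_le_div_of_nonneg_right h5 h1ν.le⟩

lemma Profile.momBox_zero {β N : ℝ} {f : R3 → ℝ} (hf : Profile β N f) (hβ : 5 < β) :
    MomBox 0 (16 * (N * weightMass β)) 0 (moments f) := by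
  refine momBox_moments (hf.finiteEnergy hβ) hf.nonneg (hf.norm_moments_le hβ) ?_ fun b => ?_
  · rw [← density_eq]; exact integral_nonneg_of_ae hf.nonneg
  · rw [(sum_centred_moments (hf.finiteEnergy hβ) b).2]
    refine integral_nonneg_of_ae ?_
    filter_upwards [hf.nonneg] with v hv
    exact mul_nonneg (sq_nonneg _) hv

lemma anisotropicGaussian_nonneg {f : R3 → ℝ} (h0 : 0 ≤ momDensity (moments f)) (ν : ℝ) (v : R3) :
    0 ≤ anisotropicGaussian ν f v := by
  rw [anisotropicGaussian, density_eq]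
  exact mul_nonneg (div_nonneg h0 (Real.sqrt_nonneg _)) (Real.exp_pos _).le

section

variable {Ω : Type} [AddCommGroup Ω] [MeasureSpace Ω] [SigmaFinite (volume : Measure Ω)]
  {ν β C₀ M : ℝ} {pr : R3 → Ω} {F₀ : Ω → R3 → ℝ} {m : ℝ → Ω → Mom} {N : ℝ}

lemma IsCover.ae_flow (hp : IsCover pr) {P : Ω × R3 → Prop} (h : ∀ᵐ p, P p) (t : ℝ) :
    ∀ᵐ p : Ω × R3, P (p.1 - pr (t • p.2), p.2) :=
  (hp.measurePreserving_flow t).quasiMeasurePreserving.ae h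

/-- A property that holds at almost every point at each time holds at almost every time along
almost every characteristic. -/
lemma IsCover.ae_characteristic (hp : IsCover pr) {P : ℝ → Ω → Prop}
    (hP : MeasurableSet {q : ℝ × Ω | P q.1 q.2}) {t : ℝ}
    (h : ∀ s ∈ Ioc 0 t, ∀ᵐ y, P s y) :
    ∀ᵐ p : Ω × R3, ∀ᵐ s : ℝ, s ∈ Ioc 0 t → P s (p.1 - pr ((t - s) • p.2)) := by
  have hS : MeasurableSet {q : (Ω × R3) × ℝ |
      q.2 ∈ Ioc 0 t → P q.2 (q.1.1 - pr ((t - q.2) • q.1.2))} := by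
    simp only [imp_iff_not_or]
    refine MeasurableSet.union ?_ ?_
    · exact (measurable_snd measurableSet_Ioc).compl
    · exact (measurable_snd.prodMk (hp.measurable_shift (by fun_prop) (by fun_prop))) hP
  rw [Measure.ae_ae_comm hS]
  refine .of_forall fun s => ?_
  by_cases hs : s ∈ Ioc 0 t
  · have h1 : ∀ᵐ p : Ω × R3, P s p.1 := Measure.quasiMeasurePreserving_fst.ae (h s hs)
    filter_upwards [hp.ae_flow h1 (t - s)] with p hp _ using hp
  · exact .of_forall fun p hs' => absurd hs' hs

lemma ae_ae_of_ae {Ω : Type} [MeasureSpace Ω] {P : Ω × R3 → Prop} (h : ∀ᵐ p, P p) : ∀ᵐ x, ∀ᵐ v, P (x, v) :=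
  Measure.ae_ae_of_ae_prod h

lemma measurableSet_momBox {Ω : Type} [MeasureSpace Ω] {m : ℝ → Ω → Mom}
    (hm : Measurable fun q : ℝ × Ω => m q.1 q.2) (c B κ : ℝ) :
    MeasurableSet {q : ℝ × Ω | MomBox c B κ (m q.1 q.2)} :=
  hm (isClosed_momBox c B κ).measurableSet

lemma measurableSet_finiteEnergy {Ω : Type} [MeasureSpace Ω] {H : ℝ → Ω → R3 → ℝ}
    (hH : Measurable fun q : ℝ × Ω × R3 => H q.1 q.2.1 q.2.2) :
    MeasurableSet {q : ℝ × Ω | FiniteEnergy (H q.1 q.2)} := by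
  refine measurableSet_integrable (f := fun (q : ℝ × Ω) (v : R3) =>
    (1 + ‖v‖ ^ 2) * H q.1 q.2 v) (Measurable.stronglyMeasurable ?_)
  have := hH.comp (f := fun p : (ℝ × Ω) × R3 => (p.1.1, p.1.2, p.2)) (by fun_prop)
  exact Measurable.mul (by fun_prop) this

lemma IsMildSolution.measurable_moments {Ω : Type} [AddCommGroup Ω] [MeasureSpace Ω] {pr : R3 → Ω}
    {F₀ : Ω → R3 → ℝ} {H : ℝ → Ω → R3 → ℝ} (hH : IsMildSolution pr ν F₀ H) :
    Measurable fun q : ℝ × Ω => ESBGK.moments (H q.1 q.2) :=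
  ESBGK.measurable_moments (hH.measurable.comp (f := fun p : (ℝ × Ω) × R3 => (p.1.1, p.1.2, p.2))
    (by fun_prop))

/-- The density of a bounded mild solution decays at most exponentially. -/
lemma IsMildSolution.density_ge (hp : IsCover pr) (hν' : ν < 1) (hβ : 5 < β)
    (hF : Datum β M F₀) (hdens : ∀ t : ℝ, 0 ≤ t → ∀ᵐ x, C₀ ≤ ∫ v, F₀ (x - pr (t • v)) v) {τ : ℝ}
    (hN : 0 ≤ N) {H : ℝ → Ω → R3 → ℝ} (hH : IsMildSolution pr ν F₀ H)
    (hprof : ∀ t, 0 ≤ t → t ≤ τ → ∀ᵐ x, Profile β N (H t x)) {t : ℝ} (ht : 0 ≤ t) (htτ : t ≤ τ) :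
    ∀ᵐ x, C₀ * Real.exp (-(16 * (N * weightMass β) / (1 - ν) * τ)) ≤
      momDensity (ESBGK.moments (H t x)) := by
  set A := 16 * (N * weightMass β) / (1 - ν) with hA
  have hw := weightMass_nonneg β
  have h1ν : 0 < 1 - ν := by linarith
  have hA0 : 0 ≤ A := by positivity
  have hchar := hp.ae_characteristic (t := t) (P := fun s y => FiniteEnergy (H s y) ∧
      MomBox 0 (16 * (N * weightMass β)) 0 (ESBGK.moments (H s y)))
    ((measurableSet_finiteEnergy hH.measurable).inter
      (measurableSet_momBox (m := fun s y => ESBGK.moments (H s y)) hH.measurable_moments 0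
        (16 * (N * weightMass β)) 0)) fun s hs => by
      filter_upwards [hprof s hs.1.le (hs.2.trans htτ)] with y hy
      exact ⟨hy.finiteEnergy hβ, hy.momBox_zero hβ⟩
  have hlow : ∀ᵐ p : Ω × R3, F₀ (p.1 - pr (t • p.2)) p.2 * Real.exp (-(A * τ)) ≤ H t p.1 p.2 := by
    filter_upwards [hchar, hH.mild_form t ht, hH.frequency t ht] with p h1 h2 h3
    have hfr : ∀ᵐ s, s ∈ Ioc 0 t → collisionFrequency ν (H s (p.1 - pr ((t - s) • p.2))) ∈
        Icc 0 A := by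
      filter_upwards [h1] with s hs hst
      rw [collisionFrequency_eq_momFreq (hs hst).1]
      exact (hs hst).2.momFreq_mem le_rfl le_rfl hν'
    have hint : ∫ s in (0 : ℝ)..t, collisionFrequency ν (H s (p.1 - pr ((t - s) • p.2))) ≤
        A * τ := by
      calc _ ≤ ∫ s in (0 : ℝ)..t, A := by
            refine intervalIntegral.integral_mono_ae_restrict ht h3 (by simp) ?_
            rw [← Measure.restrict_congr_set Ioc_ae_eq_Icc]
            refine (ae_restrict_iff' measurableSet_Ioc).2 ?_
            filter_upwards [hfr] with s hs hst using (hs hst).2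
        _ ≤ _ := by
            rw [intervalIntegral.integral_const, smul_eq_mul, sub_zero, mul_comm]; gcongr
    rw [h2]
    refine le_trans ?_ (le_add_of_nonneg_right ?_)
    · exact mul_le_mul_of_nonneg_left (Real.exp_le_exp.2 (neg_le_neg hint)) (hF.nonneg _ _)
    · refine intervalIntegral.integral_nonneg_of_ae_restrict ht ?_
      rw [← Measure.restrict_congr_set Ioc_ae_eq_Icc]
      refine (ae_restrict_iff' measurableSet_Ioc).2 ?_
      filter_upwards [hfr, h1] with s hs hs1 hst
      exact mul_nonneg (mul_nonneg (Real.exp_pos _).le (hs hst).1)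
        (anisotropicGaussian_nonneg (hs1 hst).2.density_ge _ _)
  filter_upwards [ae_ae_of_ae hlow, hprof t ht htτ, hdens t ht] with x h1 h2 h3
  have h4 := integral_mono_ae
    (((hF.profile hp t x).finiteEnergy hβ).integrable.mul_const (Real.exp (-(A * τ))))
    (h2.finiteEnergy hβ).integrable h1
  rw [integral_mul_const] at h4
  rw [← density_eq, density]
  exact le_trans (by gcongr) h4

/-- On a bounded time interval, all solutions with a common bound solve the same truncated
problem. -/
lemma exists_law_eq_flow (hp : IsCover pr) (hν : -1 / 2 < ν) (hν' : ν < 1) (hβ : 5 < β)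
    (hC₀ : 0 < C₀) (hF : Datum β M F₀)
    (hdens : ∀ t : ℝ, 0 ≤ t → ∀ᵐ x, C₀ ≤ ∫ v, F₀ (x - pr (t • v)) v) (τ : ℝ) (hN : 0 ≤ N) :
    ∃ L : RelaxLaw ν β, ∀ H : ℝ → Ω → R3 → ℝ, IsMildSolution pr ν F₀ H →
      (∀ t, 0 ≤ t → t ≤ τ → ∀ᵐ x, Profile β N (H t x)) → ∀ t, 0 ≤ t → t ≤ τ →
      ∀ᵐ p : Ω × R3, H t p.1 p.2 = flow L pr F₀ (fun s y => moments (H s y)) t p.1 p.2 := by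
  set c := min (C₀ * Real.exp (-(16 * (N * weightMass β) / (1 - ν) * τ))) (1 / 2) with hc
  have hc0 : 0 < c := lt_min (by positivity) (by norm_num)
  obtain ⟨κ₁, hκ₁, hbox⟩ := exists_momBox β hβ N hc0
  set κ := min κ₁ 1 with hκ
  have hκ0 : 0 < κ := lt_min hκ₁ one_pos
  set B := max (16 * (N * weightMass β)) (‖mom₀‖ + 1) with hB
  obtain ⟨L, hL⟩ := exists_relaxLaw β hc0 hκ0 hν hν'
    (momBox_mom₀ (B := B) (min_le_right _ _) (le_max_right _ _) (min_le_right κ₁ 1))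
  refine ⟨L, fun H hH hprof t ht htτ => ?_⟩
  have hchar := hp.ae_characteristic (t := t) (P := fun s y => FiniteEnergy (H s y) ∧
      MomBox c B κ (moments (H s y)))
    ((measurableSet_finiteEnergy hH.measurable).inter
      (measurableSet_momBox (m := fun s y => ESBGK.moments (H s y)) hH.measurable_moments _ _ _)) fun s hs => by
      filter_upwards [hprof s hs.1.le (hs.2.trans htτ), hH.density_ge hp hν' hβ hF hdens hN hprof
        hs.1.le (hs.2.trans htτ)] with y hy hd
      have hd' : c ≤ momDensity (moments (H s y)) := (min_le_left _ _).trans hd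
      exact ⟨hy.finiteEnergy hβ, momBox_moments (hy.finiteEnergy hβ) hy.nonneg
        ((hy.norm_moments_le hβ).trans (le_max_left _ _)) hd'
        fun b => (min_le_left _ _).trans (hbox _ hy hd' b)⟩
  filter_upwards [hchar, hH.mild_form t ht] with p h1 h2
  rw [h2]
  refine relax_congr_ae ht _ ?_
  filter_upwards [h1] with s hs hst
  obtain ⟨hfe, hb⟩ := hs hst
  have h0 := (hb.density_pos hc0).ne'
  exact ⟨by rw [collisionFrequency_eq hfe h0, charFreq, (hL _ hb).1],
    by rw [anisotropicGaussian_eq hfe h0, charEquil, (hL _ hb).2]⟩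

/-- The solution of the truncated problem is a mild solution as long as its moments stay in the
box where the truncated law is the ES-BGK law. -/
lemma isMildSolution_flow (hp : IsCover pr) (hβ : 5 < β) {L : RelaxLaw ν β} {c B κ : ℝ} (hc : 0 < c)
    (hL : ∀ m, MomBox c B κ m → L.freq m = momFreq ν m ∧ ∀ v, L.equil m v = momGauss ν m v)
    (hF : Datum β N F₀) (hN : L.Λ ≤ N) (hm : Measurable fun q : ℝ × Ω => m q.1 q.2)
    (hfix : ∀ t, 0 ≤ t → ∀ x, flowMom L pr F₀ m t x = m t x)
    (hbox : ∀ t, 0 ≤ t → ∀ᵐ x, MomBox c B κ (m t x)) :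
    IsMildSolution pr ν F₀ (flow L pr F₀ m) := by
  have hchar : ∀ t, 0 ≤ t → ∀ᵐ p : Ω × R3, ∀ᵐ s, s ∈ Ioc 0 t →
      collisionFrequency ν (flow L pr F₀ m s (p.1 - pr ((t - s) • p.2))) =
        charFreq L pr m t p.1 p.2 s ∧
      anisotropicGaussian ν (flow L pr F₀ m s (p.1 - pr ((t - s) • p.2))) p.2 =
        charEquil L pr m t p.1 p.2 s := fun t ht => by
    have h := hp.ae_characteristic (t := t) (P := fun s y => MomBox c B κ (m s y))
      (measurableSet_momBox (m := m) hm _ _ _) fun s hs => hbox s hs.1.le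
    filter_upwards [h] with p h1
    filter_upwards [h1] with s hs hst
    have hb := hs hst
    have hfe := (profile_flow hp hF hN hm hst.1.le (p.1 - pr ((t - s) • p.2))).finiteEnergy hβ
    have e := hfix s hst.1.le (p.1 - pr ((t - s) • p.2))
    rw [flowMom] at e
    have h0 : momDensity (moments (flow L pr F₀ m s (p.1 - pr ((t - s) • p.2)))) ≠ 0 := by
      rw [e]; exact (hb.density_pos hc).ne'
    exact ⟨by rw [collisionFrequency_eq hfe h0, e, charFreq, (hL _ hb).1],
      by rw [anisotropicGaussian_eq hfe h0, e, charEquil, (hL _ hb).2]⟩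
  have hgain := fun t ht => (hchar t ht).mono fun p h => intervalIntegrable_gain ht
    (bddMeas_charFreq (L := L) hp hm t p.1 p.2) (bddMeas_charEquil hp hm t p.1 p.2) h
  exact
    { measurable := measurable_flow hp hF hm
      moments := fun t ht => .of_forall fun x => (profile_flow hp hF hN hm ht x).finiteEnergy hβ
      frequency := fun t ht => (hgain t ht).mono fun p h => h.1
      gain := fun t ht => (hgain t ht).mono fun p h => h.2
      mild_form := fun t ht => (hchar t ht).mono fun p h =>
        (relax_congr_ae ht (F₀ (p.1 - pr (t • p.2)) p.2) h).symm }

/-- Two bounded mild solutions with the same datum coincide. -/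
lemma IsMildSolution.unique (hp : IsCover pr) (hν : -1 / 2 < ν) (hν' : ν < 1) (hβ : 5 < β)
    (hC₀ : 0 < C₀) (hF : Datum β M F₀)
    (hdens : ∀ t : ℝ, 0 ≤ t → ∀ᵐ x, C₀ ≤ ∫ v, F₀ (x - pr (t • v)) v) {τ : ℝ} (hτ : 0 ≤ τ)
    (hN : 0 ≤ N) {G H : ℝ → Ω → R3 → ℝ} (hG : IsMildSolution pr ν F₀ G)
    (hH : IsMildSolution pr ν F₀ H)
    (hGp : ∀ t, 0 ≤ t → t ≤ τ → ∀ᵐ x, Profile β N (G t x))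
    (hHp : ∀ t, 0 ≤ t → t ≤ τ → ∀ᵐ x, Profile β N (H t x)) :
    ∀ᵐ p : Ω × R3, G τ p.1 p.2 = H τ p.1 p.2 := by
  obtain ⟨L, hL⟩ := exists_law_eq_flow hp hν hν' hβ hC₀ hF hdens τ hN
  have eG := hL G hG hGp
  have eH := hL H hH hHp
  set g : ℝ → Ω → Mom := fun s y => ESBGK.moments (G s y) with hg
  set h : ℝ → Ω → Mom := fun s y => ESBGK.moments (H s y) with hh
  have hgm : Measurable fun q : ℝ × Ω => g q.1 q.2 := hG.measurable_moments
  have hhm : Measurable fun q : ℝ × Ω => h q.1 q.2 := hH.measurable_moments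
  set N' := max M L.Λ with hN'
  have hΛN : L.Λ ≤ N' := le_max_right _ _
  have hF' : Datum β N' F₀ := hF.mono (le_max_left _ _)
  have hw := weightMass_nonneg β
  have hl := lipConst_nonneg hΛN
  set l := 2 * (lipConst L N' + 1) with hldef
  have hl0 : 0 < l := by rw [hldef]; linarith
  set D := 2 * (16 * (N * weightMass β)) with hD
  have hD0 : 0 ≤ D := by positivity
  have hchar : ∀ e : ℝ → ℝ, Continuous e → ∀ t, (∀ s ∈ Ioc 0 t, ∀ᵐ y, ‖g s y - h s y‖ ≤ e s) →
      ∀ᵐ p : Ω × R3, ∀ᵐ s, s ∈ Ioc 0 t →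
        ‖g s (p.1 - pr ((t - s) • p.2)) - h s (p.1 - pr ((t - s) • p.2))‖ ≤ e s :=
    fun e he t hst => hp.ae_characteristic (P := fun s y => ‖g s y - h s y‖ ≤ e s)
      (measurableSet_le (hgm.sub hhm).norm (he.measurable.comp measurable_fst)) hst
  have hstep : ∀ n : ℕ, ∀ t, 0 ≤ t → t ≤ τ → ∀ᵐ x, ‖g t x - h t x‖ ≤
      D * (1 / 2) ^ n * Real.exp (l * t) := by
    intro n
    induction n with
    | zero =>
      intro t ht htτ
      filter_upwards [hGp t ht htτ, hHp t ht htτ] with x h1 h2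
      have h3 : 1 ≤ Real.exp (l * t) := Real.one_le_exp (by positivity)
      calc _ ≤ ‖g t x‖ + ‖h t x‖ := norm_sub_le _ _
        _ ≤ D := by linarith [h1.norm_moments_le hβ, h2.norm_moments_le hβ]
        _ ≤ _ := by rw [pow_zero, mul_one]; exact le_mul_of_one_le_right hD0 h3
    | succ n ih =>
      intro t ht htτ
      have h1 := hchar (fun s => D * (1 / 2) ^ n * Real.exp (l * s)) (by fun_prop) t
        fun s hs => ih s hs.1.le (hs.2.trans htτ)
      have h2 : ∀ᵐ p : Ω × R3, |G t p.1 p.2 - H t p.1 p.2| ≤ (L.Λ * (N' + L.Λ) *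
          ∫ s in (0 : ℝ)..t, D * (1 / 2) ^ n * Real.exp (l * s)) * (weight β p.2)⁻¹ := by
        filter_upwards [h1, eG t ht htτ, eH t ht htτ] with p h1 h2 h3
        rw [h2, h3]
        exact abs_flow_sub_le hp hF' hΛN hgm hhm ht p.1 p.2
          (Continuous.intervalIntegrable (by fun_prop) _ _) h1
      filter_upwards [ae_ae_of_ae h2, hGp t ht htτ, hHp t ht htτ] with x h3 h4 h5
      refine (norm_moments_sub_le hβ (h4.finiteEnergy hβ) (h5.finiteEnergy hβ) h3).trans ?_
      rw [intervalIntegral.integral_const_mul]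
      have h6 := integral_exp_le hl0 t
      have h7 : lipConst L N' * l⁻¹ ≤ 1 / 2 := by
        rw [← div_eq_mul_inv, div_le_div_iff₀ hl0 (by norm_num), hldef]; linarith
      calc _ = lipConst L N' * (D * (1 / 2) ^ n * ∫ s in (0 : ℝ)..t, Real.exp (l * s)) := by
            rw [lipConst]; ring
        _ ≤ lipConst L N' * (D * (1 / 2) ^ n * (l⁻¹ * Real.exp (l * t))) := by gcongr
        _ = lipConst L N' * l⁻¹ * (D * (1 / 2) ^ n * Real.exp (l * t)) := by ring
        _ ≤ 1 / 2 * (D * (1 / 2) ^ n * Real.exp (l * t)) := by gcongr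
        _ = _ := by rw [pow_succ]; ring
  have heq : ∀ t ∈ Ioc 0 τ, ∀ᵐ x, ‖g t x - h t x‖ ≤ 0 := fun t ht => by
    filter_upwards [ae_all_iff.2 fun n => hstep n t ht.1.le ht.2] with x hx
    refine ge_of_tendsto' (x := Filter.atTop) ?_ hx
    have := ((tendsto_pow_atTop_nhds_zero_of_lt_one (r := (1 / 2 : ℝ)) (by norm_num)
      (by norm_num)).const_mul D).mul_const (Real.exp (l * t))
    rwa [mul_zero, zero_mul] at this
  filter_upwards [hchar (fun _ => 0) continuous_const τ heq, eG τ hτ le_rfl, eH τ hτ le_rfl]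
    with p h1 h2 h3
  have h4 := abs_flow_sub_le hp hF' hΛN hgm hhm hτ p.1 p.2 (e := fun _ => 0) (by simp) h1
  rw [intervalIntegral.integral_zero, mul_zero, zero_mul, abs_nonpos_iff, sub_eq_zero] at h4
  rw [h2, h3, h4]

end

/-! ### Existence and uniqueness over an abstract position space -/

section

variable {Ω : Type} [MeasureSpace Ω] {β : ℝ} {F₀ F₁ : Ω → R3 → ℝ}

lemma le_of_weightedNorm_le {B : ℝ≥0} (h : weightedNorm β F₀ ≤ B) :
    ∀ᵐ p : Ω × R3, F₀ p.1 p.2 ≤ B * (weight β p.2)⁻¹ := by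
  rw [weightedNorm, eLpNorm_exponent_top] at h
  filter_upwards [ae_le_eLpNormEssSup (f := fun p : Ω × R3 => weight β p.2 * F₀ p.1 p.2)
    (μ := volume)] with p hp
  have h1 : ‖weight β p.2 * F₀ p.1 p.2‖ₑ ≤ (B : ℝ≥0∞) := hp.trans h
  rw [enorm_le_coe] at h1
  have h2 : weight β p.2 * F₀ p.1 p.2 ≤ B := (le_abs_self _).trans (by exact_mod_cast h1)
  rw [← div_eq_mul_inv, le_div_iff₀ (weight_pos β p.2), mul_comm]
  exact h2

lemma weightedNorm_le {N : ℝ} (h0 : ∀ x v, 0 ≤ F₀ x v)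
    (h : ∀ x v, F₀ x v ≤ N * (weight β v)⁻¹) : weightedNorm β F₀ ≤ ENNReal.ofReal N := by
  refine eLpNorm_exponent_top.trans_le (eLpNormEssSup_le_of_ae_bound (.of_forall fun p => ?_))
  have hw := weight_pos β p.2
  rw [Real.norm_of_nonneg (mul_nonneg hw.le (h0 _ _)), mul_comm, ← le_div_iff₀ hw, div_eq_mul_inv]
  exact h _ _

/-- A datum with finite weighted norm agrees almost everywhere with one that obeys the bounds
everywhere. -/
lemma exists_datum {M : ℝ≥0} (hm : Measurable fun p : Ω × R3 => F₀ p.1 p.2)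
    (h0 : ∀ᵐ p : Ω × R3, 0 ≤ F₀ p.1 p.2) (hM : weightedNorm β F₀ ≤ M) :
    ∃ F₁ : Ω → R3 → ℝ, Datum β M F₁ ∧ ∀ᵐ p : Ω × R3, F₀ p.1 p.2 = F₁ p.1 p.2 := by
  have hw := fun v => inv_pos.2 (weight_pos β v)
  refine ⟨fun x v => max 0 (min (F₀ x v) (M * (weight β v)⁻¹)), ⟨?_, fun x v => le_max_left _ _,
    fun x v => max_le (mul_nonneg M.2 (hw v).le) (min_le_right _ _)⟩, ?_⟩
  · have := measurable_weight β
    fun_prop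
  · filter_upwards [h0, le_of_weightedNorm_le hM] with p h1 h2
    rw [min_eq_left h2, max_eq_right h1]

lemma entropy_congr (h : ∀ᵐ p : Ω × R3, F₀ p.1 p.2 = F₁ p.1 p.2) : entropy F₀ = entropy F₁ := by
  have h1 : ∫ p : Ω × R3, entropyDensity F₀ p = ∫ p : Ω × R3, entropyDensity F₁ p :=
    integral_congr_ae (h.mono fun p hp => by simp only [entropyDensity, hp])
  have h2 : defectMass F₀ = defectMass F₁ :=
    integral_congr_ae (h.mono fun p hp => by simp only [hp])
  have h3 : defectEnergy F₀ = defectEnergy F₁ :=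
    integral_congr_ae (h.mono fun p hp => by simp only [hp])
  rw [entropy, entropy, h1, h2, h3]

lemma EntropyDefined.congr (hF : EntropyDefined F₀)
    (h : ∀ᵐ p : Ω × R3, F₀ p.1 p.2 = F₁ p.1 p.2) : EntropyDefined F₁ where
  entropy := hF.entropy.congr (h.mono fun p hp => by simp only [entropyDensity, hp])
  mass := hF.mass.congr (h.mono fun p hp => by simp only [hp])
  energy := hF.energy.congr (h.mono fun p hp => by simp only [hp])

lemma norm_moments_le_momentLength (g : R3 → ℝ) : ‖moments g‖ ≤ 16 * momentLength g := by
  have hsq : ∀ p : Idx × Idx, moments g p ^ 2 ≤ (∫ v, g v) ^ 2 + (∑ i, (∫ v, v i * g v) ^ 2) +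
      (∫ v, ‖v‖ ^ 2 * g v) ^ 2 + ∑ i, ∑ j, (∫ v, v i * v j * g v) ^ 2 := by
    have h1 : 0 ≤ ∑ i, (∫ v : R3, v i * g v) ^ 2 := Finset.sum_nonneg fun i _ => sq_nonneg _
    have h2 : 0 ≤ ∑ i, ∑ j, (∫ v : R3, v i * v j * g v) ^ 2 :=
      Finset.sum_nonneg fun i _ => Finset.sum_nonneg fun j _ => sq_nonneg _
    have h3 : ∀ i, (∫ v : R3, v i * g v) ^ 2 ≤ ∑ i, (∫ v : R3, v i * g v) ^ 2 := fun i =>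
      Finset.single_le_sum (f := fun i => (∫ v : R3, v i * g v) ^ 2) (fun i _ => sq_nonneg _)
        (Finset.mem_univ i)
    have h4 : ∀ i j, (∫ v : R3, v i * v j * g v) ^ 2 ≤
        ∑ i, ∑ j, (∫ v : R3, v i * v j * g v) ^ 2 := fun i j =>
      (Finset.single_le_sum (f := fun j => (∫ v : R3, v i * v j * g v) ^ 2) (fun j _ => sq_nonneg _)
        (Finset.mem_univ j)).trans (Finset.single_le_sum
        (f := fun i => ∑ j, (∫ v : R3, v i * v j * g v) ^ 2)
        (fun i _ => Finset.sum_nonneg fun j _ => sq_nonneg _) (Finset.mem_univ i))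
    have h5 := sq_nonneg (∫ v, g v)
    have h6 := sq_nonneg (∫ v, ‖v‖ ^ 2 * g v)
    rintro ⟨_ | i, _ | j⟩ <;> simp only [moments_apply, extVel, one_mul, mul_one]
    · linarith
    · linarith [h3 j]
    · linarith [h3 i]
    · linarith [h4 i j]
  refine (norm_le_sum_abs _).trans ?_
  calc ∑ p, |moments g p| ≤ ∑ _p : Idx × Idx, momentLength g :=
        Finset.sum_le_sum fun p _ => Real.abs_le_sqrt (hsq p)
    _ = 16 * momentLength g := by
        rw [Finset.sum_const, nsmul_eq_mul]; simp [Fintype.card_prod, Idx]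

end

section

variable {Ω : Type} [AddCommGroup Ω] [MeasureSpace Ω] [SigmaFinite (volume : Measure Ω)]
  {ν β C₀ : ℝ} {M : ℝ≥0} {pr : R3 → Ω} {F₀ F₁ : Ω → R3 → ℝ} {H : ℝ → Ω → R3 → ℝ}

lemma IsMildSolution.congr (hp : IsCover pr) (hH : IsMildSolution pr ν F₀ H)
    (h : ∀ᵐ p : Ω × R3, F₀ p.1 p.2 = F₁ p.1 p.2) : IsMildSolution pr ν F₁ H where
  measurable := hH.measurable
  moments := hH.moments
  frequency := hH.frequency
  gain := hH.gain
  mild_form t ht := by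
    filter_upwards [hH.mild_form t ht, hp.ae_flow h t] with p h1 h2
    rw [h1, h2]

lemma ae_profile {Ω : Type} [MeasureSpace Ω] {H : ℝ → Ω → R3 → ℝ} {N : ℝ≥0} (hH : Measurable fun q : ℝ × Ω × R3 => H q.1 q.2.1 q.2.2) {t : ℝ}
    (h0 : ∀ᵐ p : Ω × R3, 0 ≤ H t p.1 p.2) (hN : weightedNorm β (H t) ≤ N) :
    ∀ᵐ x, Profile β N (H t x) := by
  filter_upwards [ae_ae_of_ae h0, ae_ae_of_ae (le_of_weightedNorm_le hN)] with x h1 h2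
  exact ⟨(hH.comp (f := fun v => (t, x, v)) (by fun_prop)).aestronglyMeasurable, h1, h2⟩

lemma IsAdmissible.pos [NeZero (volume : Measure Ω)] {ε₀ C₁ : ℝ} (hC₀ : 0 < C₀)
    (h : IsAdmissible pr ν β C₀ M ε₀ C₁ F₀) (hp : IsCover pr) : 0 < M := by
  by_contra hM
  obtain rfl : M = 0 := le_antisymm (not_lt.1 hM) bot_le
  have h1 : ∀ᵐ p : Ω × R3, F₀ p.1 p.2 = 0 := by
    filter_upwards [h.nonneg, le_of_weightedNorm_le h.norm_eq.le] with p h2 h3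
    simp only [NNReal.coe_zero, zero_mul] at h3
    exact le_antisymm h3 h2
  obtain ⟨x, hx, hx'⟩ := ((h.density_ge 0 le_rfl).and (ae_ae_of_ae (hp.ae_flow h1 0))).exists
  rw [integral_eq_zero_of_ae hx'] at hx
  linarith

/-- Global existence and uniqueness, for any position space with the covering properties. -/
lemma exists_hasUniqueGlobalSolution [NeZero (volume : Measure Ω)] (K : Calibration ν β C₀ M)
    (hp : IsCover pr) (hν : -1 / 2 < ν) (hν' : ν < 1) (hβ : 5 < β) (hC₀ : 0 < C₀) :
    ∃ ε₀ : ℝ, 0 < ε₀ ∧ ∀ ε ≤ ε₀, ∀ F₀ : Ω → R3 → ℝ, IsAdmissible pr ν β C₀ M ε K.C₁ F₀ →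
      HasUniqueGlobalSolution pr ν β (max M K.L.Λ) F₀ := by
  obtain ⟨ε₀, hε₀, hsol⟩ := exists_solution_in_box K hp hν hν' hβ
  refine ⟨min ε₀ (1 / 128), by positivity, fun ε hε F₀ hF₀ => ?_⟩
  obtain ⟨F₁, hF₁, heq⟩ := exists_datum hF₀.measurable hF₀.nonneg hF₀.norm_eq.le
  have hflow := fun t => ae_ae_of_ae (hp.ae_flow heq t)
  have hdens : ∀ t : ℝ, 0 ≤ t → ∀ᵐ x, C₀ ≤ ∫ v, F₁ (x - pr (t • v)) v := fun t ht => by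
    filter_upwards [hF₀.density_ge t ht, hflow t] with x h1 h2
    rwa [← integral_congr_ae h2]
  obtain ⟨hent0, hent⟩ := entropy_eq (hF₀.entropyDefined.congr heq) hF₁.nonneg
  have hsm : ∀ t, (K.C₁ * M)⁻¹ ≤ t → ∀ᵐ x, entropy F₁ + Real.exp (-(t / (1 - ν))) *
      momentLength (fun v => F₁ (x - pr (t • v)) v - maxwellian v) ≤ ε := fun t ht => by
    filter_upwards [hF₀.small t ht, hflow t] with x h1 h2
    have h3 : ∀ g : R3 → ℝ, ∫ v, g v * (F₀ (x - pr (t • v)) v - maxwellian v) =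
        ∫ v, g v * (F₁ (x - pr (t • v)) v - maxwellian v) := fun g =>
      integral_congr_ae (h2.mono fun v hv => by simp only [hv])
    have h4 := h3 fun _ => 1
    simp only [one_mul] at h4
    rw [entropy_congr heq, momentLength, h4, h3 fun v => ‖v‖ ^ 2] at h1
    simp only [fun i => h3 fun v => v i, fun i j => h3 fun v => v i * v j] at h1
    exact h1
  have hlen : ∀ g : R3 → ℝ, 0 ≤ momentLength g := fun g => Real.sqrt_nonneg _
  have hF₁e : phaseEntropy F₁ ≤ ENNReal.ofReal ε₀ := by
    obtain ⟨x, hx⟩ := (hsm _ le_rfl).exists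
    rw [hent]
    refine ENNReal.ofReal_le_ofReal ?_
    refine le_trans ?_ (hx.trans (hε.trans (min_le_left _ _)))
    exact le_add_of_nonneg_right (mul_nonneg (Real.exp_pos _).le (hlen _))
  obtain ⟨m, hm, hfix, hbox⟩ := hsol F₁ hF₁ hF₁e hdens fun t ht => by
    filter_upwards [hsm t ht] with x hx
    have h1 := hε.trans (min_le_right _ _)
    have h2 := norm_moments_le_momentLength fun v => F₁ (x - pr (t • v)) v - maxwellian v
    rw [show (1 - ν)⁻¹ * t = t / (1 - ν) by rw [div_eq_inv_mul]]
    have h3 := mul_le_mul_of_nonneg_left h2 (Real.exp_pos (-(t / (1 - ν)))).le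
    linarith
  have hF₁N : Datum β (max M K.L.Λ) F₁ := hF₁.mono (le_max_left _ _)
  have hΛN : K.L.Λ ≤ max (M : ℝ) K.L.Λ := le_max_right _ _
  have hF := isMildSolution_flow hp hβ K.c_pos K.agrees hF₁N hΛN hm hfix hbox
  refine ⟨flow K.L pr F₁ m, hF.congr hp (heq.mono fun p h => h.symm), fun t ht => .of_forall fun p =>
    flow_nonneg hp hF₁N hm ht _ _, fun t ht => weightedNorm_le (flow_nonneg hp hF₁N hm ht)
    (flow_le hp hF₁N hΛN hm ht), fun G hG hG0 hGb τ hτ => ?_⟩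
  obtain ⟨B, hB⟩ := hGb τ
  have hN0 : 0 ≤ max (B : ℝ) (max M K.L.Λ) := B.2.trans (le_max_left _ _)
  refine IsMildSolution.unique hp hν hν' hβ hC₀ hF₁ hdens hτ hN0 (hG.congr hp heq) hF
    (fun t ht htτ => ?_) fun t ht htτ => .of_forall fun x => ?_
  · filter_upwards [ae_profile hG.measurable (hG0 t ht) (hB t ht htτ)] with x hx
    exact hx.mono (le_max_left _ _)
  · exact (profile_flow hp hF₁N hΛN hm ht x).mono (le_max_right _ _)

end

/-! ### The Euclidean space and the torus -/

lemma lintegral_comp_smul_R3 {θ : ℝ} (hθ : 0 < θ) {f : R3 → ℝ≥0∞} (hf : Measurable f) :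
    ∫⁻ v, f (θ • v) = ENNReal.ofReal (θ ^ 3)⁻¹ * ∫⁻ y, f y := by
  have h := Measure.map_addHaar_smul (volume : Measure R3) hθ.ne'
  rw [finrank_euclideanSpace, Fintype.card_fin, abs_of_pos (by positivity)] at h
  rw [← lintegral_map (f := f) hf (measurable_const_smul θ), h, lintegral_smul_measure, smul_eq_mul]

lemma isCover_R3 : IsCover (fun y : R3 => y) where
  measurable_sub := measurable_sub
  measurable_pr := measurable_id
  map_add _ _ := rfl
  shift c := measurePreserving_sub_right volume c
  spread δ R hδ := by
    refine ⟨(δ ^ 3)⁻¹.toNNReal, fun θ hθ x g hg => ?_⟩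
    have hθ0 : 0 < θ := hδ.trans_le hθ
    calc _ ≤ ∫⁻ v : R3, g (x - θ • v) := setLIntegral_le_lintegral _ _
      _ = ENNReal.ofReal (θ ^ 3)⁻¹ * ∫⁻ y, g (x - y) :=
          lintegral_comp_smul_R3 hθ0 (f := fun y => g (x - y)) (hg.comp (by fun_prop))
      _ = ENNReal.ofReal (θ ^ 3)⁻¹ * ∫⁻ y, g y := by rw [lintegral_sub_left_eq_self]
      _ ≤ ENNReal.ofReal (δ ^ 3)⁻¹ * ∫⁻ y, g y := by gcongr

lemma map_coe_addCircle (L : ℝ) [Fact (0 < L)] (a : ℝ) (n : ℕ) :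
    Measure.map (fun y : ℝ => (y : AddCircle L)) (volume.restrict (Ioc a (a + n * L))) =
      (n : ℝ≥0∞) • volume := by
  have hL : 0 < L := Fact.out
  have hmk : Measurable fun y : ℝ => (y : AddCircle L) := AddCircle.measurable_mk'
  induction n with
  | zero => simp
  | succ n ih =>
    have h1 : Ioc a (a + (n + 1 : ℕ) * L) = Ioc a (a + n * L) ∪ Ioc (a + n * L) (a + n * L + L) := by
      rw [Ioc_union_Ioc_eq_Ioc (by nlinarith [n.cast_nonneg (α := ℝ)]) (by linarith)]
      congr 1; push_cast; ring
    rw [h1, Measure.restrict_union (by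
      rw [Ioc_disjoint_Ioc]; simp) measurableSet_Ioc, Measure.map_add _ _ hmk, ih,
      (AddCircle.measurePreserving_mk L (a + n * L)).map_eq]
    push_cast
    rw [add_smul, one_smul]

lemma pi_smul_volume (L : ℝ) [Fact (0 < L)] (n : ℕ) :
    Measure.pi (fun _ : Fin 3 => (n : ℝ≥0∞) • (volume : Measure (AddCircle L))) =
      (n : ℝ≥0∞) ^ 3 • (volume : Measure (T3 L)) := by
  have : IsFiniteMeasure ((n : ℝ≥0∞) • (volume : Measure (AddCircle L))) :=
    Measure.smul_finite _ (ENNReal.natCast_ne_top n)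
  refine Measure.pi_eq fun s _ => ?_
  simp only [Measure.smul_apply, volume_pi_pi, smul_eq_mul, Finset.prod_mul_distrib,
    Finset.prod_const, Finset.card_univ, Fintype.card_fin]

/-- A cube of side `n L` covers the torus `n³` times. -/
lemma lintegral_cube_toT3 (L : ℝ) [Fact (0 < L)] (a : ℝ) (n : ℕ) {g : T3 L → ℝ≥0∞}
    (hg : Measurable g) :
    ∫⁻ y in {y : R3 | ∀ i, y i ∈ Ioc a (a + n * L)}, g (toT3 L y) = (n : ℝ≥0∞) ^ 3 * ∫⁻ w, g w := by
  have hmk : Measurable fun y : ℝ => (y : AddCircle L) := AddCircle.measurable_mk'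
  have h1 : ∫⁻ y in {y : R3 | ∀ i, y i ∈ Ioc a (a + n * L)}, g (toT3 L y) =
      ∫⁻ z in univ.pi fun _ : Fin 3 => Ioc a (a + n * L), g fun i => (z i : AddCircle L) := by
    rw [← (PiLp.volume_preserving_ofLp (Fin 3)).setLIntegral_comp_preimage
      (MeasurableSet.univ_pi fun _ => measurableSet_Ioc)
      (f := fun z : Fin 3 → ℝ => g fun i => (z i : AddCircle L)) (by fun_prop)]
    congr 2
    ext y; simp
  have hσ : ∀ i : Fin 3, SigmaFinite (Measure.map (fun y : ℝ => (y : AddCircle L))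
      (volume.restrict (Ioc a (a + n * L)))) := fun _ => by
    have : IsFiniteMeasure ((n : ℝ≥0∞) • (volume : Measure (AddCircle L))) :=
      Measure.smul_finite _ (ENNReal.natCast_ne_top n)
    rw [map_coe_addCircle]; infer_instance
  rw [h1, volume_pi, Measure.restrict_pi_pi]
  have h2 := Measure.pi_map_pi (μ := fun _ : Fin 3 => (volume : Measure ℝ).restrict
    (Ioc a (a + n * L))) (f := fun _ (y : ℝ) => (y : AddCircle L)) (fun _ => hmk.aemeasurable)
  rw [← lintegral_map (f := g) (g := fun (z : Fin 3 → ℝ) i => (z i : AddCircle L)) hg (by fun_prop), h2]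
  simp only [map_coe_addCircle]
  rw [pi_smul_volume, lintegral_smul_measure, smul_eq_mul]

lemma isCover_T3 (L : ℝ) [Fact (0 < L)] : IsCover (toT3 L) where
  measurable_sub := measurable_sub
  measurable_pr := by
    have hmk : Measurable fun y : ℝ => (y : AddCircle L) := AddCircle.measurable_mk'
    unfold toT3; fun_prop
  map_add _ _ := by ext i; simp [toT3]
  shift c := measurePreserving_sub_right volume c
  spread δ R hδ := by
    have hL : 0 < L := Fact.out
    refine ⟨((2 * (|R| / L + δ⁻¹)) ^ 3).toNNReal, fun θ hθ x g hg => ?_⟩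
    have hθ0 : 0 < θ := hδ.trans_le hθ
    have hmk : Measurable fun y : ℝ => (y : AddCircle L) := AddCircle.measurable_mk'
    have hneg : (volume : Measure (AddCircle L)).IsNegInvariant :=
      Measure.IsAddHaarMeasure.isNegInvariant_of_regular _
    have hneg3 : (volume : Measure (T3 L)).IsNegInvariant :=
      Measure.pi.isNegInvariant _
    have hT : Measurable (toT3 L) := by unfold toT3; fun_prop
    have hG : Measurable fun w : T3 L => g (x - w) := hg.comp (measurable_const.sub measurable_id)
    set n := ⌊θ * |R| / L⌋₊ + 1 with hn
    have hn1 : θ * |R| < n * L := by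
      rw [← div_lt_iff₀ hL, hn]; push_cast; exact Nat.lt_floor_add_one _
    have hn2 : (n : ℝ) ≤ θ * |R| / L + 1 := by
      rw [hn]; push_cast
      linarith [Nat.floor_le (show 0 ≤ θ * |R| / L by positivity)]
    set Q := {y : R3 | ∀ i, y i ∈ Ioc (-(n * L)) (-(n * L) + (2 * n : ℕ) * L)} with hQ
    have hQm : MeasurableSet Q := by
      rw [hQ, ofPred_forall]
      exact MeasurableSet.iInter fun i => (by fun_prop : Measurable fun y : R3 => y i)
        measurableSet_Ioc
    have hsub : ∀ v ∈ Metric.closedBall (0 : R3) R, θ • v ∈ Q := fun v hv i => by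
      have h1 : ‖v‖ ≤ |R| := (by simpa using hv : ‖v‖ ≤ R).trans (le_abs_self R)
      have h2 : |(θ • v) i| < n * L := by
        refine lt_of_le_of_lt ?_ hn1
        rw [PiLp.smul_apply, smul_eq_mul, abs_mul, abs_of_pos hθ0]
        exact mul_le_mul_of_nonneg_left ((PiLp.norm_apply_le v i).trans h1) hθ0.le
      rw [abs_lt] at h2
      refine ⟨h2.1, ?_⟩
      push_cast
      linarith [h2.2]
    calc ∫⁻ v in Metric.closedBall (0 : R3) R, g (x - toT3 L (θ • v))
        ≤ ∫⁻ v : R3, Q.indicator (fun y => g (x - toT3 L y)) (θ • v) := by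
          rw [← lintegral_indicator Metric.isClosed_closedBall.measurableSet]
          refine lintegral_mono fun v => ?_
          by_cases hv : v ∈ Metric.closedBall (0 : R3) R
          · rw [indicator_of_mem hv, indicator_of_mem (hsub v hv)]
          · rw [indicator_of_notMem hv]; exact zero_le
      _ = ENNReal.ofReal (θ ^ 3)⁻¹ * ∫⁻ y, Q.indicator (fun y => g (x - toT3 L y)) y :=
          lintegral_comp_smul_R3 hθ0 ((hG.comp hT).indicator hQm)
      _ = ENNReal.ofReal (θ ^ 3)⁻¹ * (((2 * n : ℕ) : ℝ≥0∞) ^ 3 * ∫⁻ w, g w) := by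
          rw [lintegral_indicator hQm, hQ, lintegral_cube_toT3 L _ _ hG,
            lintegral_sub_left_eq_self]
      _ = ENNReal.ofReal ((θ ^ 3)⁻¹ * ((2 * n : ℕ) : ℝ) ^ 3) * ∫⁻ w, g w := by
          rw [ENNReal.ofReal_mul (by positivity), ENNReal.ofReal_pow (by positivity),
            ENNReal.ofReal_natCast, mul_assoc]
      _ ≤ ENNReal.ofReal ((2 * (|R| / L + δ⁻¹)) ^ 3) * ∫⁻ w, g w := by
          gcongr
          rw [← inv_pow, ← mul_pow]
          push_cast
          refine pow_le_pow_left₀ (by positivity) ?_ 3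
          calc θ⁻¹ * (2 * n) ≤ θ⁻¹ * (2 * (θ * |R| / L + 1)) := by gcongr
            _ = 2 * (|R| / L + θ⁻¹) := by field_simp
            _ ≤ 2 * (|R| / L + δ⁻¹) := by gcongr

end ESBGK

end

theorem theorem1p1 (L : ℝ) [Fact (0 < L)] (ν β C₀ : ℝ) (hν : -1 / 2 < ν) (hν' : ν < 1)
    (hβ : 7 < β) (hC₀ : 0 < C₀) (M : ℝ≥0) :
    ∃ ε₀ C₁ C₂ : ℝ, 0 < ε₀ ∧ 1 ≤ C₁ ∧ 1 ≤ C₂ ∧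
      (∀ F₀ : ESBGK.R3 → ESBGK.R3 → ℝ,
        ESBGK.IsAdmissible (fun y : ESBGK.R3 => y) ν β C₀ M ε₀ C₁ F₀ →
        ESBGK.HasUniqueGlobalSolution (fun y : ESBGK.R3 => y) ν β C₂ F₀) ∧
      (∀ F₀ : ESBGK.T3 L → ESBGK.R3 → ℝ,
        ESBGK.IsAdmissible (ESBGK.toT3 L) ν β C₀ M ε₀ C₁ F₀ →
        ESBGK.HasUniqueGlobalSolution (ESBGK.toT3 L) ν β C₂ F₀) := by
  have hβ5 : 5 < β := by linarith
  rcases eq_or_ne M 0 with hM | hM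
  -- For `M = 0` no datum is admissible, as its density is bounded below.
  · exact ⟨1, 1, 1, one_pos, le_rfl, le_rfl,
      fun F₀ h => absurd hM (h.pos hC₀ ESBGK.isCover_R3).ne',
      fun F₀ h => absurd hM (h.pos hC₀ (ESBGK.isCover_T3 L)).ne'⟩
  · obtain ⟨K⟩ := ESBGK.exists_calibration hν hν' hβ5 hC₀ (M := M)
      (NNReal.coe_pos.2 (pos_iff_ne_zero.2 hM))
    obtain ⟨ε₁, h₁, hR⟩ :=
      ESBGK.exists_hasUniqueGlobalSolution K ESBGK.isCover_R3 hν hν' hβ5 hC₀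
    obtain ⟨ε₂, h₂, hT⟩ :=
      ESBGK.exists_hasUniqueGlobalSolution K (ESBGK.isCover_T3 L) hν hν' hβ5 hC₀
    exact ⟨min ε₁ ε₂, K.C₁, max M K.L.Λ, lt_min h₁ h₂, K.one_le_C₁,
      K.L.one_le.trans (le_max_right _ _), hR _ (min_le_left _ _), hT _ (min_le_right _ _)⟩
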